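/- Let $V$ be a finite-dimensional non-degenerate rational quadratic space with bilinear form $(\cdot,\cdot)$, let $L\subset V$ be an even lattice of full rank with dual $L^*$, and let $U\subseteq V$ be an isotropic subspace. Put $I=U\cap L$, $I_{L^*}=U\cap L^*$, $W=U^\perp/U$, and let $\Lambda=(U^\perp\cap L)/I\subset W$ with dual $\Lambda^*$ and $\Delta_\Lambda=\Lambda^*/\Lambda$. Let $\tilde I\subset L^*$ be a subgroup whose pairing with $I$ is unimodular (integral, and identifying $\tilde I$ with $\mathrm{Hom}(I,\mathbb Z)$), and put $\tilde U=\tilde I_{\mathbb Q}$ and $\tilde W=(U\oplus\tilde U)^\perp$, so that $V=U\oplus\tilde W\oplus\tilde U$, $\tilde W\cong W$ and $\tilde U\cong U^*$. Maps between $W$, $U^*$, $U$ transported through these isomorphisms are marked by a tilde. Let $\alpha:\tilde U\to U$ be given by $(\tilde u,\tilde v)=2(\alpha\tilde u,\tilde v)$; it is the unique symmetric map for which $\{\tilde u-\alpha\tilde u\}$ is isotropic. Let $\tilde I_L$ be the set of $\mu\in\tilde I$ for which there is $\nu\in L$ with $(\mu,\lambda)=(\nu,\lambda)$ for all $\lambda\in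 I$, and let $\iota:\tilde I_L\to\Delta_\Lambda$ be the homomorphism with $\iota\tilde u=w+\Lambda$ whenever $u\in U$, $w\in\tilde W\cong W$, $\tilde u\in\tilde I_L$ and $u+w+\tilde u\in L$. Let $\iota^*:\Delta_\Lambda\to U/I_{L^*}$ be its $\mathbb Q/\mathbb Z$-dual, characterized by $(\iota^*\delta,\tilde u)=(\delta,\iota\tilde u)$ in $\mathbb Q/\mathbb Z$ for all $\tilde u\in\tilde I_L$. For an even lattice $N$ in a rational quadratic space $E$, let $\Gamma_N$ be the group of automorphisms of $N$ that act trivially on $N^*/N$ and lie in the identity component $\mathrm{SO}^+(E_{\mathbb R})$ of $\mathrm O(E_{\mathbb R})$. Let $\mathcal P_U$ be the stabilizer of $U$ in $\mathrm O(V)$, let $\mathcal P_U^0$ be its intersection with the identity component of the stabilizer of $U_{\mathbb R}$ in $\mathrm O(V_{\mathbb R})$, and let $\Gamma_{L,I}=\mathcal P_U^0\cap\Gamma_L$. Let $\mathrm{SL}(I_{L^*},I)$ be the group of automorphisms $M$ of $I$ of determinant $1$ with $u-Mu\in I$ for all $u\in I_{L^*}$. Write $\mathrm{Hom}^{as}(U^*,U)$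 for the maps $\eta$ with $f(\eta g)=-g(\eta f)$ for $f,g\in U^*$, and $\mathrm{Hom}^{as}(I^*,I)$ for those that also send $I^*=\mathrm{Hom}(I,\mathbb Z)$ into $I$. For $\psi\in\mathrm{Hom}(W,U)$ let $\psi^*:U^*\to W$ be its dual (using $W^*\cong W$), and for $M\in\mathrm{GL}(U)$ let $M^*$ be its dual on $U^*$ and $M^{-*}=(M^*)^{-1}$. **Proposition 3.2.** Quadruples $(M,\gamma,\psi,\eta)\in\mathrm{GL}(U)\times\mathrm O(W)\times\mathrm{Hom}(W,U)\times\mathrm{Hom}^{as}(U^*,U)$ correspond bijectively to elements $A\in\mathcal P_U$ through $$Au=Mu,\qquad Aw=\tilde\gamma w-\tilde\psi\tilde\gamma w,$$ $$A\tilde u=\widetilde{M^{-*}}\tilde u+\widetilde{\psi^*}\widetilde{M^{-*}}\tilde u+\Big(M\alpha\tilde u-\alpha\widetilde{M^{-*}}\tilde u-\tfrac12\tilde\psi\widetilde{\psi^*}\widetilde{M^{-*}}\tilde u-\tilde\eta\widetilde{M^{-*}}\tilde u\Big)$$ for $u\in U$, $w\in\tilde W$, $\tilde u\in\tilde U$.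 The element $A$ with coordinates $(M,\gamma,\psi,\eta)$ lies in $\Gamma_{L,I}$ if and only if (i) $\gamma\in\Gamma_\Lambda$; (ii) $M\in\mathrm{SL}(I_{L^*},I)$ (so that $\mathrm{Id}_U-M:U/I_{L^*}\to U/I$ is well defined); (iii) $\psi(\Lambda)\subseteq I$, and the map $\Delta_\Lambda\to U/I$ induced by $\psi$ equals $(\mathrm{Id}_U-M)\circ\iota^*$; (iv) $\tilde\eta=(\mathrm{Id}_U-M)\,\alpha\,(\mathrm{Id}_{\tilde U}-\widetilde{M^*})+M\alpha-\alpha\widetilde{M^*}-\tfrac12\tilde\psi\widetilde{\psi^*}-\tilde\kappa$ for some $\kappa\in\mathrm{Hom}(I^*,I)$. Moreover, for all $\gamma\in\Gamma_\Lambda$ and $M\in\mathrm{SL}(I_{L^*},I)$ there are $\psi$ and $\eta$ such that the element with coordinates $(M,\gamma,\psi,\eta)$ lies in $\Gamma_{L,I}$; for every $M\in\mathrm{SL}(I_{L^*},I)$ there is $\psi$ satisfying (iii); and for every such $M$ and $\psi$ there is $\eta\in\mathrm{Hom}^{as}(U^*,U)$ satisfying (iv), and the set of all such $\eta$ is a coset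 of $\mathrm{Hom}^{as}(I^*,I)$. -/

import Mathlib

open scoped TensorProduct

noncomputable section

/-- The orthogonal group of a bilinear form. -/
def bilinOrthogonalGroup {K E : Type*} [Field K] [AddCommGroup E] [Module K E]
    (B : LinearMap.BilinForm K E) : Subgroup (E ≃ₗ[K] E) where
  carrier := {A | ∀ x y, B (A x) (A y) = B x y}
  mul_mem' := by
    intro a b ha hb x y
    change B (a (b x)) (a (b y)) = B x y
    rw [ha, hb]
  one_mem' := fun _ _ => rfl
  inv_mem' := by
    intro a ha x y
    have h := ha (a.symm x) (a.symm y)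
    rw [LinearEquiv.apply_symm_apply, LinearEquiv.apply_symm_apply] at h
    exact h.symm

/-- The stabilizer of a subspace `X` in the orthogonal group. -/
def bilinParabolic {K E : Type*} [Field K] [AddCommGroup E] [Module K E]
    (B : LinearMap.BilinForm K E) (X : Submodule K E) : Subgroup (E ≃ₗ[K] E) where
  carrier := {A | A ∈ bilinOrthogonalGroup B ∧ ∀ x, A x ∈ X ↔ x ∈ X}
  mul_mem' := by
    rintro a b ⟨ha, ha'⟩ ⟨hb, hb'⟩
    exact ⟨mul_mem ha hb, fun x => (ha' (b x)).trans (hb' x)⟩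
  one_mem' := ⟨one_mem _, fun _ => Iff.rfl⟩
  inv_mem' := by
    rintro a ⟨ha, ha'⟩
    refine ⟨inv_mem ha, fun x => ?_⟩
    have h := ha' (a.symm x)
    rw [LinearEquiv.apply_symm_apply] at h
    exact h.symm

/-- The usual topology on the general linear group of a finite-dimensional real vector space, as a
subset of its space of endomorphisms. -/
@[reducible] def generalLinearTopology (E : Type*) [AddCommGroup E] [Module ℝ E] :
    TopologicalSpace (E ≃ₗ[ℝ] E) :=
  TopologicalSpace.induced (fun A => (A : E →ₗ[ℝ] E)) (moduleTopology ℝ (E →ₗ[ℝ] E))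

/-- The identity component of a subgroup of a real general linear group. -/
def identityComponent {E : Type*} [AddCommGroup E] [Module ℝ E] (G : Subgroup (E ≃ₗ[ℝ] E)) :
    Set (E ≃ₗ[ℝ] E) :=
  @connectedComponentIn _ (generalLinearTopology E) (G : Set (E ≃ₗ[ℝ] E)) 1

/-- The dual `{x | (x, Λ) ⊆ ℤ}` of a lattice in a rational quadratic space. -/
def dualLattice {E : Type*} [AddCommGroup E] [Module ℚ E] (B : LinearMap.BilinForm ℚ E)
    (Λ : AddSubgroup E) : AddSubgroup E :=
  (B.dualSubmodule (AddSubgroup.toIntSubmodule Λ)).toAddSubgroup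

theorem mem_dualLattice {E : Type*} [AddCommGroup E] [Module ℚ E] {B : LinearMap.BilinForm ℚ E}
    {Λ : AddSubgroup E} {x : E} :
    x ∈ dualLattice B Λ ↔ ∀ y ∈ Λ, ∃ n : ℤ, B x y = n := by
  refine forall₂_congr fun y _ => ?_
  rw [Submodule.mem_one]
  exact exists_congr fun n => eq_comm

/-- The discriminant kernel `Γ_Λ` of a lattice `Λ` in a rational quadratic space `E`: the
automorphisms of `Λ` that act trivially on `Λ* / Λ` and lie in `SO⁺(E_ℝ)`, the identity component
of the real orthogonal group. -/
def discriminantKernel {E : Type*} [AddCommGroup E] [Module ℚ E] (B : LinearMap.BilinForm ℚ E)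
    (Λ : AddSubgroup E) : Set (E ≃ₗ[ℚ] E) :=
  {A | A ∈ bilinOrthogonalGroup B ∧ (∀ x, A x ∈ Λ ↔ x ∈ Λ) ∧
    (∀ x ∈ dualLattice B Λ, A x - x ∈ Λ) ∧
    A.baseChange ℚ ℝ E E ∈
      identityComponent (bilinOrthogonalGroup (LinearMap.BilinForm.baseChange ℝ B))}

/-- The pairing between two subgroups is unimodular: it is integral, and it identifies `Y` with the
`ℤ`-dual of `X`. -/
def IsUnimodularPairing {E : Type*} [AddCommGroup E] [Module ℚ E] (B : LinearMap.BilinForm ℚ E)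
    (X Y : AddSubgroup E) : Prop :=
  (∀ x ∈ X, ∀ y ∈ Y, ∃ n : ℤ, B x y = n) ∧
    ∀ f : X →+ ℤ, ∃! y : Y, ∀ x : X, B (x : E) (y : E) = (f x : ℚ)

/-- `SL(J, I)`: the automorphisms of determinant 1 of the lattice `I`, extended to its rational
span `X`, that satisfy `u - M u ∈ I` for all `u ∈ J`. -/
def congruenceSL {X : Type*} [AddCommGroup X] [Module ℚ X] (J I : AddSubgroup X) :
    Set (X ≃ₗ[ℚ] X) :=
  {M | (∀ u, M u ∈ I ↔ u ∈ I) ∧ LinearMap.det (M : X →ₗ[ℚ] X) = 1 ∧ ∀ u ∈ J, u - M u ∈ I}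

/-- `Hom^{as}(X*, X)`. -/
def homAs (X : Type*) [AddCommGroup X] [Module ℚ X] :
    Submodule ℚ (Module.Dual ℚ X →ₗ[ℚ] X) where
  carrier := {η | ∀ f g : Module.Dual ℚ X, f (η g) = -g (η f)}
  add_mem' := by
    intro a b ha hb f g
    simp only [LinearMap.add_apply, map_add, ha f g, hb f g]
    ring
  zero_mem' := by intro f g; simp
  smul_mem' := by
    intro c a ha f g
    simp only [LinearMap.smul_apply, map_smul, ha f g, smul_eq_mul]
    ring

/-- `Hom(I*, I)` for a lattice `I` spanning the rational space `X`: the linear maps `X* → X` that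
send `I* = {f | f(I) ⊆ ℤ}` to `I`. -/
def homDual {X : Type*} [AddCommGroup X] [Module ℚ X] (I : AddSubgroup X) :
    AddSubgroup (Module.Dual ℚ X →ₗ[ℚ] X) where
  carrier := {κ | ∀ f : Module.Dual ℚ X, (∀ u ∈ I, ∃ n : ℤ, f u = n) → κ f ∈ I}
  add_mem' := fun ha hb f hf => I.add_mem (ha f hf) (hb f hf)
  zero_mem' := fun _ _ => I.zero_mem
  neg_mem' := fun ha f hf => I.neg_mem (ha f hf)

/-- `Hom^{as}(I*, I)`. -/
def homAsDual {X : Type*} [AddCommGroup X] [Module ℚ X] (I : AddSubgroup X) :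
    AddSubgroup (Module.Dual ℚ X →ₗ[ℚ] X) :=
  (homAs X).toAddSubgroup ⊓ homDual I

/-- The data: a non-degenerate rational quadratic space `V` with an even lattice `L`, an isotropic
subspace `U`, and a subgroup `Ĩ` of `L*` whose pairing with `I = U ∩ L` is unimodular. -/
structure IsotropicDatum (V : Type*) [AddCommGroup V] [Module ℚ V] where
  /-- the bilinear form of the quadratic space -/
  form : LinearMap.BilinForm ℚ V
  symm : form.IsSymm
  nondeg : form.Nondegenerate
  /-- the even lattice -/
  L : AddSubgroup V
  fg : L.FG
  span_eq_top : Submodule.span ℚ (L : Set V) = ⊤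
  even : ∀ x ∈ L, ∃ n : ℤ, form x x = 2 * n
  /-- the isotropic subspace -/
  U : Submodule ℚ V
  isotropic : ∀ u ∈ U, ∀ v ∈ U, form u v = 0
  /-- the complementary lattice `Ĩ` -/
  It : AddSubgroup V
  It_le : It ≤ dualLattice form L
  unimodular : IsUnimodularPairing form (L ⊓ U.toAddSubgroup) It

namespace IsotropicDatum

variable {V : Type*} [AddCommGroup V] [Module ℚ V] (S : IsotropicDatum V)

/-- `U^⊥`. -/
def Uperp : Submodule ℚ V := S.form.orthogonal S.U

/-- `Ũ = Ĩ_ℚ`. -/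
def Ut : Submodule ℚ V := Submodule.span ℚ (S.It : Set V)

/-- `W̃ = (U ⊕ Ũ)^⊥`. -/
def Wt : Submodule ℚ V := S.form.orthogonal (S.U ⊔ S.Ut)

/-- `L*`. -/
def Ldual : AddSubgroup V := dualLattice S.form S.L

/-- `I = U ∩ L`, as a subgroup of `U`. -/
def I : AddSubgroup S.U := S.L.comap S.U.subtype.toAddMonoidHom

/-- `I_{L*} = U ∩ L*`, as a subgroup of `U`. -/
def ILdual : AddSubgroup S.U := S.Ldual.comap S.U.subtype.toAddMonoidHom

/-- `Ĩ_L`: the elements of `Ĩ` whose pairing with `I` is that of some element of `L`. -/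
def ItL : AddSubgroup V where
  carrier := {μ | μ ∈ S.It ∧ ∃ ν ∈ S.L, ∀ u ∈ S.I, S.form μ u = S.form ν u}
  add_mem' := by
    rintro a b ⟨ha, x, hx, hx'⟩ ⟨hb, y, hy, hy'⟩
    refine ⟨add_mem ha hb, x + y, add_mem hx hy, fun u hu => ?_⟩
    simp [hx' u hu, hy' u hu]
  zero_mem' := ⟨zero_mem _, 0, zero_mem _, fun _ _ => rfl⟩
  neg_mem' := by
    rintro a ⟨ha, x, hx, hx'⟩
    refine ⟨neg_mem ha, -x, neg_mem hx, fun u hu => ?_⟩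
    simp [hx' u hu]

/-- `W = U^⊥ / U`. -/
def W : Type _ := S.Uperp ⧸ S.U.submoduleOf S.Uperp

instance : AddCommGroup S.W :=
  inferInstanceAs (AddCommGroup (S.Uperp ⧸ S.U.submoduleOf S.Uperp))

instance : Module ℚ S.W :=
  inferInstanceAs (Module ℚ (S.Uperp ⧸ S.U.submoduleOf S.Uperp))

instance [FiniteDimensional ℚ V] : FiniteDimensional ℚ S.W :=
  inferInstanceAs (FiniteDimensional ℚ (S.Uperp ⧸ S.U.submoduleOf S.Uperp))

/-- The projection from `U^⊥` to `W`. -/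
def mkW : S.Uperp →ₗ[ℚ] S.W := (S.U.submoduleOf S.Uperp).mkQ

theorem mkW_surjective : Function.Surjective S.mkW := Submodule.mkQ_surjective _

theorem mkW_eq_zero (x : S.Uperp) : S.mkW x = 0 ↔ (x : V) ∈ S.U := by
  change (S.U.submoduleOf S.Uperp).mkQ x = 0 ↔ _
  rw [Submodule.mkQ_apply, Submodule.Quotient.mk_eq_zero]
  rfl

theorem form_comm (x y : V) : S.form x y = S.form y x := by
  simpa using S.symm.eq x y

/-- The bilinear form on `W` induced by the one on `U^⊥`. -/
def formW : LinearMap.BilinForm ℚ S.W :=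
  (S.U.submoduleOf S.Uperp).liftQ
    (LinearMap.flip ((S.U.submoduleOf S.Uperp).liftQ
      (S.form.domRestrict₁₂ S.Uperp S.Uperp)
      (by
        intro x hx
        refine LinearMap.ext fun y => ?_
        exact y.2 x hx)))
    (by
      intro x hx
      refine LinearMap.ext fun y => ?_
      obtain ⟨y, rfl⟩ := S.mkW_surjective y
      change S.form y x = 0
      rw [S.form_comm]
      exact y.2 x hx)

theorem formW_mk (x y : S.Uperp) : S.formW (S.mkW x) (S.mkW y) = S.form x y := S.form_comm y x

theorem formW_comm (x y : S.W) : S.formW x y = S.formW y x := by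
  obtain ⟨x, rfl⟩ := S.mkW_surjective x
  obtain ⟨y, rfl⟩ := S.mkW_surjective y
  rw [formW_mk, formW_mk, S.form_comm]

theorem formW_nondeg [FiniteDimensional ℚ V] : S.formW.Nondegenerate := by
  have key : ∀ x : S.W, (∀ y, S.formW x y = 0) → x = 0 := by
    intro x hx
    obtain ⟨x, rfl⟩ := S.mkW_surjective x
    rw [mkW_eq_zero, ← LinearMap.BilinForm.orthogonal_orthogonal S.nondeg S.symm.isRefl S.U]
    intro y hy
    have := hx (S.mkW ⟨y, hy⟩)
    rw [formW_mk] at this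
    change S.form y x = 0
    rw [S.form_comm]
    exact this
  refine ⟨key, fun y hy => key y fun x => ?_⟩
  rw [formW_comm]
  exact hy x

/-! ### Dual bases of `I` and `Ĩ` -/

theorem I_le (u : S.U) (hu : u ∈ S.I) : (u : V) ∈ S.L ⊓ S.U.toAddSubgroup := ⟨hu, u.2⟩

theorem exists_dualBasis : ∃ (n : ℕ) (b : Fin n → S.U) (c : Fin n → V),
    (∀ i, b i ∈ S.I) ∧ (∀ i, c i ∈ S.It) ∧
    (∀ i j, S.form (b i) (c j) = if i = j then 1 else 0) ∧
    (∀ u ∈ S.I, ∃ m : Fin n → ℤ, u = ∑ i, m i • b i) ∧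
    (∀ y ∈ S.It, ∃ m : Fin n → ℤ, y = ∑ i, m i • c i) := by
  let X : AddSubgroup V := S.L ⊓ S.U.toAddSubgroup
  have h1 : Module.Finite ℤ S.L := Module.Finite.iff_addGroup_fg.2
    ((AddGroup.fg_iff_addSubgroup_fg _).2 S.fg)
  have h2 : Module.Finite ℤ X := by
    have hle : X ≤ S.L := inf_le_left
    exact Module.Finite.of_injective (AddSubgroup.inclusion hle).toIntLinearMap
      (AddSubgroup.inclusion_injective hle)
  have h3 : Module.IsTorsionFree ℤ V := Module.IsTorsionFree.trans_faithfulSMul ℤ ℚ V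
  have h4 : Module.IsTorsionFree ℤ X :=
    Function.Injective.moduleIsTorsionFree (fun x : X => (x : V)) Subtype.val_injective
      (fun _ _ => rfl)
  let B := Module.finBasis ℤ X
  choose y hy using fun j => S.unimodular.2 (B.coord j).toAddMonoidHom
  have hy1 : ∀ j (x : X), S.form (x : V) (y j : V) = ((B.coord j x : ℤ) : ℚ) :=
    fun j x => (hy j).1 x
  refine ⟨_, fun i => ⟨(B i : V), (B i).2.2⟩, fun i => y i, fun i => (B i).2.1,
    fun i => (y i).2, ?_, ?_, ?_⟩
  · intro i j
    rw [hy1]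
    simp [Finsupp.single_apply]
  · intro u hu
    refine ⟨fun i => B.repr ⟨u, hu, u.2⟩ i, ?_⟩
    have h := congrArg (Subtype.val) (B.sum_repr ⟨(u : V), hu, u.2⟩)
    apply Subtype.ext
    simp only [AddSubgroup.val_finsetSum, AddSubgroup.coe_zsmul] at h
    simp only [Submodule.coe_sum]
    exact h.symm
  · intro z hz
    have hint : ∀ x : X, ∃ n : ℤ, S.form x z = n := fun x => S.unimodular.1 x x.2 z hz
    choose m hm using fun i => hint (B i)
    refine ⟨m, ?_⟩
    have hsum : (∑ i, m i • (y i : V)) ∈ S.It :=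
      AddSubgroup.sum_mem _ fun i _ => AddSubgroup.zsmul_mem _ (y i).2 _
    choose f hf using hint
    let F : X →+ ℤ := AddMonoidHom.mk' f (by
      intro a b
      have : ((f (a + b) : ℤ) : ℚ) = ((f a + f b : ℤ) : ℚ) := by
        push_cast
        rw [← hf, ← hf, ← hf]
        simp
      exact_mod_cast this)
    have hu := (S.unimodular.2 F).unique (y₁ := ⟨z, hz⟩) (y₂ := ⟨_, hsum⟩) hf ?_
    · exact congrArg Subtype.val hu
    · intro x
      have hFG : F = ∑ i, m i • (B.coord i).toAddMonoidHom := by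
        have : F.toIntLinearMap = ∑ i, m i • B.coord i := by
          refine B.ext fun j => ?_
          have : f (B j) = m j := by
            have := (hf (B j)).symm.trans (hm j)
            exact_mod_cast this
          simp [F, this, Finsupp.single_apply]
        ext x
        have := LinearMap.congr_fun this x
        simpa using this
      rw [hFG]
      simp [hy1]

theorem exists_natCast_smul_mem (v : V) : ∃ k : ℕ, k ≠ 0 ∧ (k : ℚ) • v ∈ S.L := by
  have hv : v ∈ Submodule.span ℚ (S.L : Set V) := S.span_eq_top ▸ Submodule.mem_top
  induction hv using Submodule.span_induction with
  | mem x hx => exact ⟨1, one_ne_zero, by simpa using hx⟩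
  | zero => exact ⟨1, one_ne_zero, by simp⟩
  | add x y _ _ hx hy =>
    obtain ⟨k, hk, hx⟩ := hx
    obtain ⟨l, hl, hy⟩ := hy
    refine ⟨k * l, mul_ne_zero hk hl, ?_⟩
    have h : ((k * l : ℕ) : ℚ) • (x + y) = l • ((k : ℚ) • x) + k • ((l : ℚ) • y) := by
      rw [← Nat.cast_smul_eq_nsmul ℚ, ← Nat.cast_smul_eq_nsmul ℚ, smul_smul, smul_smul, smul_add]
      push_cast
      rw [mul_comm (l : ℚ)]
    rw [h]
    exact add_mem (nsmul_mem hx _) (nsmul_mem hy _)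
  | smul a x _ hx =>
    obtain ⟨k, hk, hx⟩ := hx
    refine ⟨k * a.den, mul_ne_zero hk a.den_ne_zero, ?_⟩
    have h : ((k * a.den : ℕ) : ℚ) • a • x = a.num • ((k : ℚ) • x) := by
      rw [← Int.cast_smul_eq_zsmul ℚ, smul_smul, smul_smul]
      push_cast
      rw [mul_assoc, Rat.den_mul_eq_num, mul_comm]
    rw [h]
    exact zsmul_mem hx _

theorem exists_dualBasis_rat : ∃ (n : ℕ) (b : Fin n → S.U) (c : Fin n → V),
    (∀ i, b i ∈ S.I) ∧ (∀ i, c i ∈ S.It) ∧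
    (∀ i j, S.form (b i) (c j) = if i = j then 1 else 0) ∧
    (∀ u : S.U, u = ∑ i, S.form u (c i) • b i) ∧
    (∀ y ∈ S.Ut, y = ∑ i, S.form (b i) y • c i) := by
  obtain ⟨n, b, c, hb, hc, hbc, hI, hIt⟩ := S.exists_dualBasis
  refine ⟨n, b, c, hb, hc, hbc, ?_, ?_⟩
  · intro u
    obtain ⟨k, hk, hku⟩ := S.exists_natCast_smul_mem u
    have hk' : (k : ℚ) ≠ 0 := Nat.cast_ne_zero.2 hk
    obtain ⟨m, hm⟩ := hI ((k : ℚ) • u) hku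
    have hm1 : ∀ j, (k : ℚ) * S.form u (c j) = m j := by
      intro j
      have : S.form (((k : ℚ) • u : S.U) : V) (c j) = m j := by
        rw [hm]
        simp [← Int.cast_smul_eq_zsmul ℚ, hbc, LinearMap.sum_apply]
      simpa using this
    have : (k : ℚ) • u = (k : ℚ) • ∑ i, S.form u (c i) • b i := by
      rw [hm, Finset.smul_sum]
      refine Finset.sum_congr rfl fun i _ => ?_
      rw [smul_smul, hm1, Int.cast_smul_eq_zsmul]
    exact smul_right_injective _ hk' this
  · intro y hy
    induction hy using Submodule.span_induction with
    | mem x hx =>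
      obtain ⟨m, hm⟩ := hIt x hx
      have hm1 : ∀ j, S.form (b j) x = m j := by
        intro j
        rw [hm]
        simp [← Int.cast_smul_eq_zsmul ℚ, hbc]
      simp_rw [hm1, Int.cast_smul_eq_zsmul]
      exact hm
    | zero => simp
    | add x y _ _ hx hy =>
      simp only [map_add, add_smul, Finset.sum_add_distrib]
      rw [← hx, ← hy]
    | smul a x _ hx =>
      simp only [map_smul, smul_eq_mul, mul_smul]
      rw [← Finset.smul_sum, ← hx]

/-! ### The isomorphisms attached to the complement -/

/-- The map `V → U*` given by the pairing. -/
def toDualU : V →ₗ[ℚ] Module.Dual ℚ S.U := S.U.subtype.dualMap ∘ₗ S.form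

/-- The map `V → Ũ*` given by the pairing. -/
def toDualUt : V →ₗ[ℚ] Module.Dual ℚ S.Ut := S.Ut.subtype.dualMap ∘ₗ S.form

@[simp] theorem toDualU_apply (v : V) (u : S.U) : S.toDualU v u = S.form v u := rfl

@[simp] theorem toDualUt_apply (v : V) (y : S.Ut) : S.toDualUt v y = S.form v y := rfl

theorem It_le_Ut {x : V} (hx : x ∈ S.It) : x ∈ S.Ut := Submodule.subset_span hx

theorem toDualU_bijective : Function.Bijective (S.toDualU ∘ₗ S.Ut.subtype) := by
  obtain ⟨n, b, c, hb, hc, hbc, hU, hUt⟩ := S.exists_dualBasis_rat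
  constructor
  · rw [← LinearMap.ker_eq_bot, LinearMap.ker_eq_bot']
    intro y hy
    apply Subtype.ext
    rw [hUt y y.2]
    refine Finset.sum_eq_zero fun i _ => ?_
    have : S.form y (b i) = 0 := LinearMap.congr_fun hy (b i)
    rw [S.form_comm, this, zero_smul]
  · intro f
    refine ⟨⟨∑ i, f (b i) • c i, sum_mem fun i _ => S.Ut.smul_mem _ (S.It_le_Ut (hc i))⟩, ?_⟩
    refine LinearMap.ext fun u => ?_
    conv_rhs => rw [hU u]
    simp only [LinearMap.comp_apply, Submodule.subtype_apply, toDualU_apply]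
    rw [S.form_comm]
    simp [mul_comm]

theorem toDualUt_bijective : Function.Bijective (S.toDualUt ∘ₗ S.U.subtype) := by
  obtain ⟨n, b, c, hb, hc, hbc, hU, hUt⟩ := S.exists_dualBasis_rat
  constructor
  · rw [← LinearMap.ker_eq_bot, LinearMap.ker_eq_bot']
    intro u hu
    rw [hU u]
    refine Finset.sum_eq_zero fun i _ => ?_
    have : S.form u (c i) = 0 := LinearMap.congr_fun hu ⟨c i, S.It_le_Ut (hc i)⟩
    rw [this, zero_smul]
  · intro f
    let c' : Fin n → S.Ut := fun i => ⟨c i, S.It_le_Ut (hc i)⟩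
    refine ⟨∑ i, f (c' i) • b i, ?_⟩
    refine LinearMap.ext fun y => ?_
    have hy : y = ∑ i, S.form (b i) y • c' i := by
      apply Subtype.ext
      simpa [c'] using hUt y y.2
    conv_rhs => rw [hy]
    simp [LinearMap.sum_apply, mul_comm]

/-- The isomorphism `Ũ ≅ U*`. -/
def utIso : S.Ut ≃ₗ[ℚ] Module.Dual ℚ S.U := LinearEquiv.ofBijective _ S.toDualU_bijective

/-- The isomorphism `U ≅ Ũ*`. -/
def uIso : S.U ≃ₗ[ℚ] Module.Dual ℚ S.Ut := LinearEquiv.ofBijective _ S.toDualUt_bijective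

theorem utIso_apply (y : S.Ut) (u : S.U) : S.utIso y u = S.form y u := rfl

theorem uIso_apply (u : S.U) (y : S.Ut) : S.uIso u y = S.form u y := rfl

/-- The projection of `V = U ⊕ W̃ ⊕ Ũ` onto `Ũ`. -/
def prUt : V →ₗ[ℚ] S.Ut := S.utIso.symm.toLinearMap ∘ₗ S.toDualU

/-- The projection of `V = U ⊕ W̃ ⊕ Ũ` onto `U`. -/
def prU : V →ₗ[ℚ] S.U :=
  S.uIso.symm.toLinearMap ∘ₗ S.toDualUt ∘ₗ (LinearMap.id - S.Ut.subtype ∘ₗ S.prUt)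

theorem form_prUt (v : V) (u : S.U) : S.form (S.prUt v) u = S.form v u := by
  rw [← utIso_apply]
  simp [prUt]

theorem form_prU (v : V) (y : S.Ut) : S.form (S.prU v) y = S.form (v - S.prUt v) y := by
  rw [← uIso_apply]
  simp [prU]

/-- The projection of `V = U ⊕ W̃ ⊕ Ũ` onto `W̃`. -/
def prWt : V →ₗ[ℚ] S.Wt :=
  LinearMap.codRestrict S.Wt (LinearMap.id - S.U.subtype ∘ₗ S.prU - S.Ut.subtype ∘ₗ S.prUt) (by
    intro v x hx
    obtain ⟨u, hu, y, hy, rfl⟩ := Submodule.mem_sup.1 hx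
    have h1 := S.form_prUt v ⟨u, hu⟩
    have h2 := S.form_prU v ⟨y, hy⟩
    have h3 := S.isotropic (S.prU v) (S.prU v).2 u hu
    simp only [map_sub, LinearMap.sub_apply] at h1 h2
    change S.form (u + y) (v - S.prU v - S.prUt v) = 0
    rw [S.form_comm]
    simp only [map_sub, map_add, LinearMap.sub_apply]
    linarith)

theorem pr_add (v : V) : (S.prU v : V) + S.prWt v + S.prUt v = v := by
  change (S.prU v : V) + (v - S.prU v - S.prUt v) + S.prUt v = v
  abel

theorem form_U_Wt (u : S.U) (w : S.Wt) : S.form u w = 0 :=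
  w.2 u (Submodule.mem_sup_left u.2)

theorem form_Ut_Wt (y : S.Ut) (w : S.Wt) : S.form y w = 0 :=
  w.2 y (Submodule.mem_sup_right y.2)

theorem prUt_eq (u : S.U) (w : S.Wt) (y : S.Ut) : S.prUt (u + w + y) = y := by
  apply S.utIso.injective
  refine LinearMap.ext fun x => ?_
  rw [utIso_apply, utIso_apply, form_prUt]
  have h1 := S.isotropic u u.2 x x.2
  have h2 := S.form_U_Wt x w
  rw [S.form_comm] at h2
  simp [h1, h2]

theorem prU_eq (u : S.U) (w : S.Wt) (y : S.Ut) : S.prU (u + w + y) = u := by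
  apply S.uIso.injective
  refine LinearMap.ext fun x => ?_
  rw [uIso_apply, uIso_apply, form_prU, prUt_eq]
  have h2 := S.form_Ut_Wt x w
  rw [S.form_comm] at h2
  simp [h2]

theorem prWt_eq (u : S.U) (w : S.Wt) (y : S.Ut) : S.prWt (u + w + y) = w := by
  apply Subtype.ext
  have := S.pr_add (u + w + y)
  rw [prUt_eq, prU_eq] at this
  simpa using this

theorem Wt_le_Uperp {x : V} (hx : x ∈ S.Wt) : x ∈ S.Uperp :=
  fun u hu => hx u (Submodule.mem_sup_left hu)

/-- The natural map `W̃ → W`. -/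
def wtToW : S.Wt →ₗ[ℚ] S.W :=
  S.mkW ∘ₗ Submodule.inclusion (p := S.Wt) (p' := S.Uperp) (fun _ hx => S.Wt_le_Uperp hx)

theorem wtToW_bijective : Function.Bijective S.wtToW := by
  constructor
  · rw [← LinearMap.ker_eq_bot, LinearMap.ker_eq_bot']
    intro w hw
    have hw' : (w : V) ∈ S.U := (S.mkW_eq_zero _).1 hw
    have h1 := S.prWt_eq 0 w 0
    have h2 := S.prWt_eq ⟨w, hw'⟩ 0 0
    simp only [ZeroMemClass.coe_zero, zero_add, add_zero] at h1 h2
    rw [← h1, h2]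
  · intro x
    obtain ⟨x, rfl⟩ := S.mkW_surjective x
    have hx : S.prUt x = 0 := by
      apply S.utIso.injective
      refine LinearMap.ext fun u => ?_
      rw [utIso_apply, form_prUt, S.form_comm, x.2 u u.2]
      simp
    refine ⟨S.prWt x, ?_⟩
    rw [eq_comm, ← sub_eq_zero, wtToW, LinearMap.comp_apply, ← map_sub, mkW_eq_zero]
    have h := S.pr_add x
    rw [hx] at h
    have : (x : V) - S.prWt x = S.prU x := by
      rw [sub_eq_iff_eq_add]
      simpa using h.symm
    change (x : V) - S.prWt x ∈ S.U
    rw [this]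
    exact (S.prU x).2

/-- The isomorphism `W̃ ≅ W`. -/
def wtIso : S.Wt ≃ₗ[ℚ] S.W := LinearEquiv.ofBijective _ S.wtToW_bijective

/-- The map `α : Ũ → U` with `(ũ, ṽ) = 2 (α ũ, ṽ)`. -/
def alpha : S.Ut →ₗ[ℚ] S.U :=
  (1 / 2 : ℚ) • (S.uIso.symm.toLinearMap ∘ₗ S.toDualUt ∘ₗ S.Ut.subtype)

theorem form_alpha (x y : S.Ut) : S.form (S.alpha x) y = 1 / 2 * S.form x y := by
  have : S.uIso (S.alpha x) y = 1 / 2 * S.form x y := by simp [alpha]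
  exact this

/-- `α` is the unique symmetric map `Ũ → U` for which `{ũ - α ũ}` is isotropic. -/
theorem eq_alpha_iff (β : S.Ut →ₗ[ℚ] S.U) :
    β = S.alpha ↔ (∀ x y : S.Ut, S.form (β x) y = S.form (β y) x) ∧
      ∀ x y : S.Ut, S.form ((x : V) - β x) ((y : V) - β y) = 0 := by
  have key : ∀ x y : S.Ut, S.form ((x : V) - β x) ((y : V) - β y) =
      S.form x y - S.form (β x) y - S.form (β y) x := by
    intro x y
    simp only [map_sub, LinearMap.sub_apply, S.isotropic _ (β x).2 _ (β y).2,
      S.form_comm x (β y)]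
    ring
  constructor
  · rintro rfl
    have hs : ∀ x y : S.Ut, S.form (S.alpha x) y = S.form (S.alpha y) x := by
      intro x y
      rw [form_alpha, form_alpha, S.form_comm]
    refine ⟨hs, fun x y => ?_⟩
    rw [key, hs y x, form_alpha]
    ring
  · rintro ⟨hs, hi⟩
    refine LinearMap.ext fun x => S.uIso.injective (LinearMap.ext fun y => ?_)
    rw [uIso_apply, uIso_apply, form_alpha]
    have := hi x y
    rw [key, hs y x] at this
    linarith

/-! ### The element attached to a quadruple of coordinates -/

section coordinates

variable [FiniteDimensional ℚ V]

/-- The dual `ψ* : U* → W` of `ψ : W → U`, using `W* ≅ W`. -/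
def psiStar (ψ : S.W →ₗ[ℚ] S.U) : Module.Dual ℚ S.U →ₗ[ℚ] S.W :=
  (LinearMap.BilinForm.toDual S.formW S.formW_nondeg).symm.toLinearMap ∘ₗ ψ.dualMap

/-- `γ` transported to `W̃`. -/
def gammaTilde (γ : bilinOrthogonalGroup S.formW) : S.Wt →ₗ[ℚ] S.Wt :=
  S.wtIso.symm.toLinearMap ∘ₗ (γ : S.W ≃ₗ[ℚ] S.W).toLinearMap ∘ₗ S.wtIso.toLinearMap

/-- `ψ` transported to a map `W̃ → U`. -/
def psiTilde (ψ : S.W →ₗ[ℚ] S.U) : S.Wt →ₗ[ℚ] S.U := ψ ∘ₗ S.wtIso.toLinearMap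

/-- `ψ*` transported to a map `Ũ → W̃`. -/
def psiStarTilde (ψ : S.W →ₗ[ℚ] S.U) : S.Ut →ₗ[ℚ] S.Wt :=
  S.wtIso.symm.toLinearMap ∘ₗ S.psiStar ψ ∘ₗ S.utIso.toLinearMap

/-- A map `η : U* → U` transported to a map `Ũ → U`. -/
def etaTilde (η : Module.Dual ℚ S.U →ₗ[ℚ] S.U) : S.Ut →ₗ[ℚ] S.U := η ∘ₗ S.utIso.toLinearMap

/-- The dual `M*` transported to `Ũ`. -/
def mStarTilde (M : S.U ≃ₗ[ℚ] S.U) : S.Ut ≃ₗ[ℚ] S.Ut :=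
  S.utIso.trans (M.dualMap.trans S.utIso.symm)

/-- The inverse `M^{-*}` of the dual, transported to `Ũ`. -/
def mInvStarTilde (M : S.U ≃ₗ[ℚ] S.U) : S.Ut →ₗ[ℚ] S.Ut := (S.mStarTilde M).symm.toLinearMap

/-- The `U`-component of the image of `ũ ∈ Ũ`. -/
def eltUtU (M : S.U ≃ₗ[ℚ] S.U) (ψ : S.W →ₗ[ℚ] S.U) (η : homAs S.U) : S.Ut →ₗ[ℚ] S.U :=
  M.toLinearMap ∘ₗ S.alpha - S.alpha ∘ₗ S.mInvStarTilde M
    - (1 / 2 : ℚ) • (S.psiTilde ψ ∘ₗ S.psiStarTilde ψ ∘ₗ S.mInvStarTilde M)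
    - S.etaTilde η ∘ₗ S.mInvStarTilde M

/-- The endomorphism of `V = U ⊕ W̃ ⊕ Ũ` with coordinates `(M, γ, ψ, η)`: it sends `u ∈ U` to `M u`,
`w ∈ W̃` to `γ̃ w - ψ̃ γ̃ w`, and `ũ ∈ Ũ` to the sum of `M^{-*} ũ ∈ Ũ`, `ψ* M^{-*} ũ ∈ W̃` and the
element `eltUtU ũ` of `U`. -/
def eltMap (M : S.U ≃ₗ[ℚ] S.U) (γ : bilinOrthogonalGroup S.formW) (ψ : S.W →ₗ[ℚ] S.U)
    (η : homAs S.U) : V →ₗ[ℚ] V :=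
  (S.U.subtype ∘ₗ M.toLinearMap) ∘ₗ S.prU
    + (S.Wt.subtype ∘ₗ S.gammaTilde γ - S.U.subtype ∘ₗ S.psiTilde ψ ∘ₗ S.gammaTilde γ) ∘ₗ S.prWt
    + (S.Ut.subtype ∘ₗ S.mInvStarTilde M + S.Wt.subtype ∘ₗ S.psiStarTilde ψ ∘ₗ S.mInvStarTilde M
        + S.U.subtype ∘ₗ S.eltUtU M ψ η) ∘ₗ S.prUt

theorem eltMap_injective (M : S.U ≃ₗ[ℚ] S.U) (γ : bilinOrthogonalGroup S.formW)
    (ψ : S.W →ₗ[ℚ] S.U) (η : homAs S.U) : Function.Injective (S.eltMap M γ ψ η) := by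
  rw [← LinearMap.ker_eq_bot, LinearMap.ker_eq_bot']
  intro v hv
  have hdec : S.eltMap M γ ψ η v =
      ((M (S.prU v) - S.psiTilde ψ (S.gammaTilde γ (S.prWt v)) +
          S.eltUtU M ψ η (S.prUt v) : S.U) : V)
        + ((S.gammaTilde γ (S.prWt v) + S.psiStarTilde ψ (S.mInvStarTilde M (S.prUt v)) : S.Wt) : V)
        + (S.mInvStarTilde M (S.prUt v) : S.Ut) := by
    simp [eltMap]
    abel
  rw [hdec] at hv
  have e1 := S.prUt_eq (M (S.prU v) - S.psiTilde ψ (S.gammaTilde γ (S.prWt v)) +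
    S.eltUtU M ψ η (S.prUt v)) (S.gammaTilde γ (S.prWt v) +
    S.psiStarTilde ψ (S.mInvStarTilde M (S.prUt v))) (S.mInvStarTilde M (S.prUt v))
  have e2 := S.prWt_eq (M (S.prU v) - S.psiTilde ψ (S.gammaTilde γ (S.prWt v)) +
    S.eltUtU M ψ η (S.prUt v)) (S.gammaTilde γ (S.prWt v) +
    S.psiStarTilde ψ (S.mInvStarTilde M (S.prUt v))) (S.mInvStarTilde M (S.prUt v))
  have e3 := S.prU_eq (M (S.prU v) - S.psiTilde ψ (S.gammaTilde γ (S.prWt v)) +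
    S.eltUtU M ψ η (S.prUt v)) (S.gammaTilde γ (S.prWt v) +
    S.psiStarTilde ψ (S.mInvStarTilde M (S.prUt v))) (S.mInvStarTilde M (S.prUt v))
  rw [hv, map_zero] at e1 e2 e3
  have h1 : S.prUt v = 0 := by
    have : (S.mStarTilde M).symm (S.prUt v) = 0 := e1.symm
    simpa using this
  rw [h1] at e2 e3
  simp only [map_zero, add_zero] at e2 e3
  have h2 : S.prWt v = 0 := by
    have : S.wtIso.symm ((γ : S.W ≃ₗ[ℚ] S.W) (S.wtIso (S.prWt v))) = 0 := e2.symm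
    simpa using this
  rw [h2] at e3
  simp only [map_zero, sub_zero] at e3
  have h3 : S.prU v = 0 := by simpa using e3.symm
  rw [← S.pr_add v, h1, h2, h3]
  simp

/-- The element `A` of `GL(V)` with coordinates `(M, γ, ψ, η)`. -/
def elt (M : S.U ≃ₗ[ℚ] S.U) (γ : bilinOrthogonalGroup S.formW) (ψ : S.W →ₗ[ℚ] S.U)
    (η : homAs S.U) : V ≃ₗ[ℚ] V :=
  LinearEquiv.ofInjectiveEndo (S.eltMap M γ ψ η) (S.eltMap_injective M γ ψ η)

theorem elt_apply (M : S.U ≃ₗ[ℚ] S.U) (γ : bilinOrthogonalGroup S.formW) (ψ : S.W →ₗ[ℚ] S.U)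
    (η : homAs S.U) (u : S.U) (w : S.Wt) (y : S.Ut) :
    S.elt M γ ψ η u = M u ∧
    S.elt M γ ψ η w = S.gammaTilde γ w - S.psiTilde ψ (S.gammaTilde γ w) ∧
    S.elt M γ ψ η y = S.mInvStarTilde M y + S.psiStarTilde ψ (S.mInvStarTilde M y)
      + (M (S.alpha y) - S.alpha (S.mInvStarTilde M y)
        - (1 / 2 : ℚ) • S.psiTilde ψ (S.psiStarTilde ψ (S.mInvStarTilde M y))
        - S.etaTilde η (S.mInvStarTilde M y) : S.U) := by
  have a1 := S.prU_eq u 0 0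
  have a2 := S.prWt_eq u 0 0
  have a3 := S.prUt_eq u 0 0
  have b1 := S.prU_eq 0 w 0
  have b2 := S.prWt_eq 0 w 0
  have b3 := S.prUt_eq 0 w 0
  have c1 := S.prU_eq 0 0 y
  have c2 := S.prWt_eq 0 0 y
  have c3 := S.prUt_eq 0 0 y
  simp only [ZeroMemClass.coe_zero, zero_add, add_zero] at a1 a2 a3 b1 b2 b3 c1 c2 c3
  change S.eltMap M γ ψ η u = M u ∧ S.eltMap M γ ψ η w = _ ∧ S.eltMap M γ ψ η y = _
  refine ⟨?_, ?_, ?_⟩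
  · simp [eltMap, a1, a2, a3]
  · simp [eltMap, b1, b2, b3]
  · simp [eltMap, eltUtU, c1, c2, c3]

end coordinates

/-! ### The lattice `Λ` and the map `ι` -/

/-- `Λ = (U^⊥ ∩ L) / I`, as a subgroup of `W`. -/
def Lam : AddSubgroup S.W := (S.L.comap S.Uperp.subtype.toAddMonoidHom).map S.mkW.toAddMonoidHom

/-- `Λ*`. -/
def LamDual : AddSubgroup S.W := dualLattice S.formW S.Lam

/-- The discriminant group `Δ_Λ = Λ* / Λ`. -/
abbrev Delta : Type _ := S.LamDual ⧸ S.Lam.addSubgroupOf S.LamDual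

theorem form_integral {x y : V} (hx : x ∈ S.L) (hy : y ∈ S.L) : ∃ n : ℤ, S.form x y = n := by
  obtain ⟨a, ha⟩ := S.even x hx
  obtain ⟨b, hb⟩ := S.even y hy
  obtain ⟨c, hc⟩ := S.even (x + y) (add_mem hx hy)
  refine ⟨c - a - b, ?_⟩
  simp only [map_add, LinearMap.add_apply, ha, hb, S.form_comm y x] at hc
  push_cast
  linarith

theorem mem_Uperp_of_I {x : V} (h : ∀ u ∈ S.I, S.form x u = 0) : x ∈ S.Uperp := by
  intro u hu
  obtain ⟨k, hk, hku⟩ := S.exists_natCast_smul_mem u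
  have h1 := h ((k : ℚ) • ⟨u, hu⟩) hku
  have hk' : (k : ℚ) ≠ 0 := Nat.cast_ne_zero.2 hk
  change S.form u x = 0
  rw [S.form_comm]
  simpa [hk'] using h1

theorem sub_mem_Uperp {μ ν : V} (h : ∀ u ∈ S.I, S.form μ u = S.form ν u) : ν - μ ∈ S.Uperp :=
  S.mem_Uperp_of_I fun u hu => by simp [h u hu]

theorem mkW_mem_LamDual {μ ν : V} (hμ : μ ∈ S.It) (hν : ν ∈ S.L) (h : ν - μ ∈ S.Uperp) :
    S.mkW ⟨ν - μ, h⟩ ∈ S.LamDual := by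
  refine mem_dualLattice.2 ?_
  rintro _ ⟨x, hx, rfl⟩
  obtain ⟨a, ha⟩ := S.form_integral hν hx
  obtain ⟨b, hb⟩ := mem_dualLattice.1 (S.It_le hμ) x hx
  refine ⟨a - b, ?_⟩
  refine (S.formW_mk _ _).trans ?_
  have ha' : S.form ν x = a := ha
  simp [ha', hb]

theorem mkW_sub_mem_Lam {μ ν ν' : V} (hν : ν ∈ S.L) (hν' : ν' ∈ S.L) (h : ν - μ ∈ S.Uperp)
    (h' : ν' - μ ∈ S.Uperp) : S.mkW ⟨ν - μ, h⟩ - S.mkW ⟨ν' - μ, h'⟩ ∈ S.Lam := by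
  rw [← map_sub]
  refine ⟨_, ?_, rfl⟩
  change ν - μ - (ν' - μ) ∈ S.L
  rw [sub_sub_sub_cancel_right]
  exact sub_mem hν hν'

/-- The element `ν` of `L` that pairs with `I` as `μ ∈ Ĩ_L` does (some choice of it). -/
def liftL (μ : S.ItL) : V := μ.2.2.choose

theorem liftL_mem (μ : S.ItL) : S.liftL μ ∈ S.L := μ.2.2.choose_spec.1

theorem liftL_sub_mem (μ : S.ItL) : S.liftL μ - μ ∈ S.Uperp :=
  S.sub_mem_Uperp μ.2.2.choose_spec.2

/-- The homomorphism `ι : Ĩ_L → Δ_Λ`: if `ν ∈ L` pairs with `I` as `ũ ∈ Ĩ_L` does, then `ι ũ` is the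
class modulo `Λ` of the image of `ν - ũ ∈ U^⊥` in `W`. It does not depend on the choice of `ν`;
see `iota_eq_of_mem_L` for its description in the decomposition `V = U ⊕ W̃ ⊕ Ũ`. -/
def iota : S.ItL →+ S.Delta :=
  AddMonoidHom.mk'
    (fun μ => QuotientAddGroup.mk
      (⟨S.mkW ⟨S.liftL μ - μ, S.liftL_sub_mem μ⟩,
        S.mkW_mem_LamDual μ.2.1 (S.liftL_mem μ) (S.liftL_sub_mem μ)⟩ : S.LamDual))
    (by
      intro a b
      rw [← QuotientAddGroup.mk_add, QuotientAddGroup.eq]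
      rw [← neg_mem_iff, AddSubgroup.mem_addSubgroupOf]
      simp only [AddSubgroup.coe_neg, AddSubgroup.coe_add, neg_add_rev, neg_neg]
      rw [← map_neg S.mkW, ← map_neg S.mkW, ← map_add S.mkW, ← map_add S.mkW, ← neg_mem_iff,
        ← map_neg S.mkW]
      refine ⟨_, ?_, rfl⟩
      change -(-(S.liftL b - b) + -(S.liftL a - a) + (S.liftL (a + b) - (a + b))) ∈ S.L
      have : -(-(S.liftL b - b) + -(S.liftL a - a) + (S.liftL (a + b) - ((a : V) + b))) =
        S.liftL a + S.liftL b - S.liftL (a + b) := by abel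
      rw [this]
      exact sub_mem (add_mem (S.liftL_mem a) (S.liftL_mem b)) (S.liftL_mem _))

theorem iota_apply (μ : S.ItL) {ν : V} (hν : ν ∈ S.L) (h : ν - μ ∈ S.Uperp) :
    S.iota μ = QuotientAddGroup.mk
      (⟨S.mkW ⟨ν - μ, h⟩, S.mkW_mem_LamDual μ.2.1 hν h⟩ : S.LamDual) := by
  refine QuotientAddGroup.eq.2 ?_
  rw [AddSubgroup.mem_addSubgroupOf]
  simp only [AddSubgroup.coe_add, AddSubgroup.coe_neg]
  rw [add_comm, ← sub_eq_add_neg]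
  exact S.mkW_sub_mem_Lam hν (S.liftL_mem μ) h (S.liftL_sub_mem μ)

/-- If `u + w + ũ ∈ L` with `ũ ∈ Ĩ_L`, then `w ∈ Λ*` (inside `W̃ ≅ W`) and `ι ũ = w + Λ`. -/
theorem iota_eq_of_mem_L (u : S.U) (w : S.Wt) (y : S.ItL) (h : (u : V) + w + y ∈ S.L) :
    ∃ hw : S.wtIso w ∈ S.LamDual, S.iota y = QuotientAddGroup.mk (⟨S.wtIso w, hw⟩ : S.LamDual) := by
  have h1 : (u : V) + w + y - y ∈ S.Uperp := by
    rw [add_sub_cancel_right]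
    exact add_mem (fun x hx => S.isotropic x hx u u.2) (S.Wt_le_Uperp w.2)
  have h2 : S.mkW ⟨(u : V) + w + y - y, h1⟩ = S.wtIso w := by
    refine sub_eq_zero.1 ?_
    change S.mkW _ - S.mkW _ = 0
    rw [← map_sub, mkW_eq_zero]
    change (u : V) + w + y - y - w ∈ S.U
    have : (u : V) + w + y - y - w = u := by abel
    rw [this]
    exact u.2
  have h3 := S.mkW_mem_LamDual y.2.1 h h1
  rw [h2] at h3
  refine ⟨h3, (S.iota_apply y h h1).trans ?_⟩
  congr 1
  exact Subtype.ext h2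

/-- The projection `ℚ → ℚ/ℤ`. -/
def toQZ : ℚ →+ AddCircle (1 : ℚ) := QuotientAddGroup.mk' _

theorem toQZ_eq_zero (q : ℚ) : toQZ q = 0 ↔ ∃ n : ℤ, q = n := by
  refine (QuotientAddGroup.eq_zero_iff q).trans ?_
  rw [AddSubgroup.mem_zmultiples_iff]
  exact exists_congr fun n => by simp [eq_comm]

/-- The pairing `(x, y) + ℤ` between `x ∈ Λ*` and the class of `y` in `Δ_Λ`. -/
def discAux (x : S.LamDual) : CharacterModule S.Delta :=
  QuotientAddGroup.lift _
    (toQZ.comp ((S.formW x).toAddMonoidHom.comp S.LamDual.subtype))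
    (by
      intro y hy
      exact (toQZ_eq_zero _).2 (mem_dualLattice.1 x.2 y hy))

/-- The homomorphism from `Δ_Λ` to its `ℚ/ℤ`-dual given by the `ℚ/ℤ`-valued bilinear form. -/
def discToChar : S.Delta →+ CharacterModule S.Delta :=
  QuotientAddGroup.lift _
    (AddMonoidHom.mk' S.discAux (by
      intro a b
      refine CharacterModule.ext _ fun y => ?_
      induction y using QuotientAddGroup.induction_on with
      | H y =>
        change toQZ (S.formW (a + b : S.LamDual) y) = toQZ (S.formW a y) + toQZ (S.formW b y)
        simp))
    (by
      intro x hx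
      refine CharacterModule.ext _ fun y => ?_
      induction y using QuotientAddGroup.induction_on with
      | H y =>
        change toQZ (S.formW x y) = 0
        rw [toQZ_eq_zero, S.formW_comm]
        exact mem_dualLattice.1 y.2 x hx)

/-- The homomorphism from `U` to the `ℚ/ℤ`-dual of `Ĩ_L` given by the pairing. -/
def charMap : S.U →+ CharacterModule S.ItL :=
  AddMonoidHom.mk'
    (fun u => (toQZ.comp ((S.form u).toAddMonoidHom.comp S.ItL.subtype) :
      S.ItL →+ AddCircle (1 : ℚ)))
    (by
      intro a b
      refine CharacterModule.ext _ fun y => ?_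
      change toQZ (S.form (a + b : S.U) y) = toQZ (S.form a y) + toQZ (S.form b y)
      simp)

theorem charMap_apply (u : S.U) (y : S.ItL) : S.charMap u y = toQZ (S.form u y) := rfl

theorem charMap_eq_zero (u : S.U) : S.charMap u = 0 ↔ u ∈ S.ILdual := by
  constructor
  · intro h
    refine mem_dualLattice.2 fun x hx => ?_
    obtain ⟨n, b, c, hb, hc, hbc, hU, hUt⟩ := S.exists_dualBasis_rat
    have hint : ∀ i, ∃ m : ℤ, S.form x (b i) = m := fun i => S.form_integral hx (hb i)
    choose m hm using hint
    have hy : ∑ i, m i • c i ∈ S.It :=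
      AddSubgroup.sum_mem _ fun i _ => AddSubgroup.zsmul_mem _ (hc i) _
    have hyv : ∀ v : S.U, S.form (∑ i, m i • c i) v = S.form x v := by
      intro v
      conv_rhs => rw [hU v]
      rw [S.form_comm]
      simp [← Int.cast_smul_eq_zsmul ℚ, hm, mul_comm]
    have hyL : ∑ i, m i • c i ∈ S.ItL := ⟨hy, x, hx, fun v _ => hyv v⟩
    have h1 : toQZ (S.form u (∑ i, m i • c i)) = 0 := DFunLike.congr_fun h ⟨_, hyL⟩
    obtain ⟨k, hk⟩ := (toQZ_eq_zero _).1 h1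
    refine ⟨k, ?_⟩
    change S.form u x = k
    rw [S.form_comm, ← hyv, S.form_comm, hk]
  · intro h
    refine CharacterModule.ext _ fun y => ?_
    change toQZ (S.form u y) = 0
    obtain ⟨hy, ν, hν, hyν⟩ := y.2
    obtain ⟨k, hk⟩ := mem_dualLattice.1 h ν hν
    have h0 : ν - y ∈ S.Uperp := S.sub_mem_Uperp hyν
    have h1 : S.form u (ν - y) = 0 := h0 u u.2
    refine (toQZ_eq_zero _).2 ⟨k, ?_⟩
    have hk' : S.form u ν = k := hk
    rw [map_sub] at h1
    linarith

theorem charMap_surjective : Function.Surjective S.charMap := by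
  intro χ
  obtain ⟨n, b, c, hb, hc, hbc, hI, hIt⟩ := S.exists_dualBasis
  have hle : S.ItL ≤ S.It := fun _ hx => hx.1
  obtain ⟨χ', hχ'⟩ := CharacterModule.dual_surjective_of_injective
    (AddSubgroup.inclusion hle).toIntLinearMap (AddSubgroup.inclusion_injective hle) χ
  have hq : ∀ i, ∃ q : ℚ, toQZ q = χ' ⟨c i, hc i⟩ := fun i =>
    QuotientAddGroup.mk'_surjective _ _
  choose q hq using hq
  refine ⟨∑ i, q i • b i, CharacterModule.ext _ fun y => ?_⟩
  obtain ⟨m, hm⟩ := hIt y y.2.1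
  have hy : AddSubgroup.inclusion hle y = ∑ i, m i • (⟨c i, hc i⟩ : S.It) := by
    apply Subtype.ext
    simpa [AddSubgroup.val_finsetSum] using hm
  rw [← hχ', CharacterModule.dual_apply]
  change toQZ (S.form (∑ i, q i • b i : S.U) y) = χ' (AddSubgroup.inclusion hle y)
  have h1 : S.form (∑ i, q i • b i : S.U) y = ∑ i, m i • q i := by
    rw [hm]
    simp [← Int.cast_smul_eq_zsmul ℚ, hbc, LinearMap.sum_apply]
  rw [h1, hy, map_sum, map_sum]
  refine Finset.sum_congr rfl fun i _ => ?_
  rw [map_zsmul, map_zsmul, hq]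

/-- The isomorphism of `U / I_{L*}` with the `ℚ/ℤ`-dual of `Ĩ_L`. -/
def charEquiv : (S.U ⧸ S.ILdual) ≃+ CharacterModule S.ItL :=
  AddEquiv.ofBijective
    (QuotientAddGroup.lift S.ILdual S.charMap fun u hu => (S.charMap_eq_zero u).2 hu)
    (by
      constructor
      · rw [injective_iff_map_eq_zero]
        intro x hx
        induction x using QuotientAddGroup.induction_on with
        | H u => exact (QuotientAddGroup.eq_zero_iff u).2 ((S.charMap_eq_zero u).1 hx)
      · intro χ
        obtain ⟨u, hu⟩ := S.charMap_surjective χ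
        exact ⟨QuotientAddGroup.mk u, hu⟩)

/-- The `ℚ/ℤ`-dual `ι* : Δ_Λ → U / I_{L*}` of `ι`, where `Δ_Λ` and `U / I_{L*}` are identified with
the `ℚ/ℤ`-duals of `Δ_Λ` and of `Ĩ_L` through the bilinear forms. -/
def iotaStar : S.Delta →+ S.U ⧸ S.ILdual :=
  S.charEquiv.symm.toAddMonoidHom.comp
    ((CharacterModule.dual S.iota.toIntLinearMap).toAddMonoidHom.comp S.discToChar)

/-! ### The groups and the conditions -/

/-- `SL(I_{L*}, I)`. -/
def SLI : Set (S.U ≃ₗ[ℚ] S.U) := congruenceSL S.ILdual S.I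

/-- The parabolic subgroup `P_U`, the stabilizer of `U` in `O(V)`. -/
def parabolic : Subgroup (V ≃ₗ[ℚ] V) := bilinParabolic S.form S.U

/-- `P_U^0`: the elements of `P_U` in the identity component of the stabilizer of `U_ℝ` in
`O(V_ℝ)`. -/
def parabolicZero : Set (V ≃ₗ[ℚ] V) :=
  {A | A ∈ S.parabolic ∧ A.baseChange ℚ ℝ V V ∈ identityComponent
    (bilinParabolic (LinearMap.BilinForm.baseChange ℝ S.form) (S.U.baseChange ℝ))}

/-- `Γ_L`. -/
def GammaL : Set (V ≃ₗ[ℚ] V) := discriminantKernel S.form S.L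

/-- `Γ_{L,I} = P_U^0 ∩ Γ_L`. -/
def GammaLI : Set (V ≃ₗ[ℚ] V) := S.parabolicZero ∩ S.GammaL

/-- `Γ_Λ`. -/
def GammaLam : Set (S.W ≃ₗ[ℚ] S.W) := discriminantKernel S.formW S.Lam

/-- The map `Id - M : U / I_{L*} → U / I` for `M ∈ SL(I_{L*}, I)`. -/
def oneSub (M : S.U ≃ₗ[ℚ] S.U) (hM : M ∈ S.SLI) : S.U ⧸ S.ILdual →+ S.U ⧸ S.I :=
  QuotientAddGroup.map S.ILdual S.I
    ((LinearMap.id - M.toLinearMap : S.U →ₗ[ℚ] S.U) : S.U →+ S.U) (fun u hu => by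
      change u - M u ∈ S.I
      exact hM.2.2 u hu)

/-- The map `Δ_Λ → U / I` induced by `ψ : W → U` with `ψ(Λ) ⊆ I`. -/
def psiDelta (ψ : S.W →ₗ[ℚ] S.U) (hψ : ∀ x ∈ S.Lam, ψ x ∈ S.I) : S.Delta →+ S.U ⧸ S.I :=
  QuotientAddGroup.map (S.Lam.addSubgroupOf S.LamDual) S.I
    (ψ.toAddMonoidHom.comp S.LamDual.subtype) (fun x hx => hψ x hx)

/-- `ψ(Λ) ⊆ I`, and the induced map `Δ_Λ → U / I` is `(Id - M) ∘ ι*`. -/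
def CondPsi (M : S.U ≃ₗ[ℚ] S.U) (hM : M ∈ S.SLI) (ψ : S.W →ₗ[ℚ] S.U) : Prop :=
  ∃ hψ : ∀ x ∈ S.Lam, ψ x ∈ S.I, S.psiDelta ψ hψ = (S.oneSub M hM).comp S.iotaStar

/-- `η̃ = (Id - M) α (Id - M*) + M α - α M* - ψ ψ* / 2 - κ̃` for some `κ ∈ Hom(I*, I)`. -/
def CondEta [FiniteDimensional ℚ V] (M : S.U ≃ₗ[ℚ] S.U) (ψ : S.W →ₗ[ℚ] S.U) (η : homAs S.U) :
    Prop :=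
  ∃ κ ∈ homDual S.I,
    S.etaTilde η =
      (LinearMap.id - M.toLinearMap) ∘ₗ S.alpha ∘ₗ (LinearMap.id - (S.mStarTilde M).toLinearMap)
        + M.toLinearMap ∘ₗ S.alpha - S.alpha ∘ₗ (S.mStarTilde M).toLinearMap
        - (1 / 2 : ℚ) • (S.psiTilde ψ ∘ₗ S.psiStarTilde ψ) - S.etaTilde κ

end IsotropicDatum

end

/-! Coordinates. An isometry preserving `U` preserves `U^⊥`, so it is block triangular for `V = U ⊕
W̃ ⊕ Ũ`. Its blocks on `U` and on `U^⊥/U` are `M` and `γ`; the block on `Ũ` is then forced by the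
pairing of `U` with `Ũ`. The block from `W̃` to `U` is free and gives `ψ`, and orthogonality of the
images of `W̃` and `Ũ` forces the block from `Ũ` to `W̃`. The isometry condition on `Ũ` itself fixes
the symmetric part of the last block, from `Ũ` to `U`; its antisymmetric part is `η`
(`elt_mem_parabolic`, `exists_elt_eq`, `elt_injective`).

Lattice conditions. For an isometry, acting trivially on `L*/L` means `(A - 1)L* ⊆ L`. Unimodularity
of the pairing and `Ĩ ⊆ L*` split `L*` as `(U^⊥ ∩ L*) ⊕ Ĩ`. On the first summand the test gives
triviality of `γ` on `Δ_Λ`, the congruence for `M` and the condition on `ψ`; here `ι*` enters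
because `u + w ∈ L*` says exactly that `u` represents `-ι* w` (`mem_Ldual_iff`). On the second
summand, `form_elt_mStarTilde_sub` computes the pairing of `(A - 1)M* z` with `u + w + y` as `(κ̃ z,
y) + (ψ w + u - M u, z)`. The second term is integral by the condition on `ψ`, so what remains is
`κ̃(Ĩ) ⊆ I`, which is the condition on `η`. The result is `elt_sub_mem_L_iff`.

Identity components. On `P_U^0` the determinant of `M` is positive by connectedness, and a unit of
`ℤ` because `M` preserves `I`; so it is 1. Conversely, `SL(U)` is generated by transvections, which
lift to unipotent elements of `P_U`, and `γ` lifts through `W̃`; the product of the lifts differs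
from `A` by a unipotent element (`mem_parabolicZero`). The Cayley transform joins every unipotent
element to 1 by a polynomial path inside the real parabolic subgroup
(`mem_identityComponent_of_unipotent`).

Existence. `Λ*` is free, so a homomorphism to `U/I` lifts to `ψ`. For `η` one must make a symmetric
form integral by adding an antisymmetric one, which only requires integrality on the diagonal
(`exists_antisymm_add_mem_I`); this is where evenness of `L` is decisive (`exists_condEta`). -/

noncomputable section

/-! ### Lattices in rational quadratic spaces -/

section lattice

variable {E : Type*} [AddCommGroup E] [Module ℚ E]

/-- A finitely generated torsion-free group is free, and a `ℤ`-basis stays independent over `ℚ`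
after clearing denominators. -/
theorem AddSubgroup.exists_basis_of_fg (Λ : AddSubgroup E) (hfg : Λ.FG)
    (hspan : Submodule.span ℚ (Λ : Set E) = ⊤) :
    ∃ (n : ℕ) (b : Module.Basis (Fin n) ℚ E), ∀ x, x ∈ Λ ↔ ∀ i, ∃ m : ℤ, b.repr x i = m := by
  have h1 : Module.Finite ℤ Λ := Module.Finite.iff_addGroup_fg.2
    ((AddGroup.fg_iff_addSubgroup_fg _).2 hfg)
  have h3 : Module.IsTorsionFree ℤ E := Module.IsTorsionFree.trans_faithfulSMul ℤ ℚ E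
  have h4 : Module.IsTorsionFree ℤ Λ :=
    Function.Injective.moduleIsTorsionFree (fun x : Λ => (x : E)) Subtype.val_injective
      (fun _ _ => rfl)
  let c := Module.finBasis ℤ Λ
  have hc1 : LinearIndependent ℤ (fun i => (c i : E)) :=
    c.linearIndependent.map' (Λ.subtype.toIntLinearMap)
      (LinearMap.ker_eq_bot.2 Subtype.val_injective)
  have hc2 : LinearIndependent ℚ (fun i => (c i : E)) :=
    (LinearIndependent.iff_fractionRing ℤ ℚ).1 hc1
  have hsum : ∀ x : Λ, (x : E) = ∑ i, ((c.repr x i : ℤ) : ℚ) • (c i : E) := by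
    intro x
    have h := congrArg Subtype.val (c.sum_repr x)
    rw [AddSubgroup.val_finsetSum] at h
    simpa [Int.cast_smul_eq_zsmul] using h.symm
  have hc3 : ⊤ ≤ Submodule.span ℚ (Set.range fun i => (c i : E)) := by
    rw [← hspan, Submodule.span_le]
    intro x hx
    have h := hsum ⟨x, hx⟩
    change x = _ at h
    rw [h]
    exact sum_mem fun i _ => Submodule.smul_mem _ _ (Submodule.subset_span ⟨i, rfl⟩)
  refine ⟨_, Module.Basis.mk hc2 hc3, fun x => ⟨fun hx i => ⟨c.repr ⟨x, hx⟩ i, ?_⟩, fun h => ?_⟩⟩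
  · have h := hsum ⟨x, hx⟩
    have h' : x = ∑ i, ((c.repr ⟨x, hx⟩ i : ℤ) : ℚ) • Module.Basis.mk hc2 hc3 i := by
      simpa using h
    conv_lhs => rw [h']
    rw [map_sum, Finsupp.finsetSum_apply]
    simp_rw [map_smul, Module.Basis.repr_self]
    simp [Finsupp.single_apply]
  · choose m hm using h
    rw [← (Module.Basis.mk hc2 hc3).sum_repr x]
    refine Λ.sum_mem fun i _ => ?_
    rw [hm, Int.cast_smul_eq_zsmul, Module.Basis.mk_apply]
    exact Λ.zsmul_mem (c i).2 _

theorem exists_basis_dualLattice {B : LinearMap.BilinForm ℚ E} (hB : B.Nondegenerate)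
    (Λ : AddSubgroup E) (hfg : Λ.FG)
    (hspan : Submodule.span ℚ (Λ : Set E) = ⊤) :
    ∃ (n : ℕ) (b c : Module.Basis (Fin n) ℚ E), (∀ i j, B (c i) (b j) = if i = j then 1 else 0) ∧
      (∀ x, x ∈ Λ ↔ ∀ i, ∃ m : ℤ, b.repr x i = m) ∧
      ∀ x, x ∈ dualLattice B Λ ↔ ∀ i, ∃ m : ℤ, c.repr x i = m := by
  obtain ⟨n, b, hb⟩ := Λ.exists_basis_of_fg hfg hspan
  have hbc := LinearMap.BilinForm.apply_dualBasis_left hB b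
  refine ⟨n, b, LinearMap.BilinForm.dualBasis B hB b, ?_, hb, fun x => ?_⟩
  · intro i j
    rw [hbc]
    simp [eq_comm]
  · have hbm : ∀ i, b i ∈ Λ := fun i => (hb _).2 fun j => by
      rw [b.repr_self, Finsupp.single_apply]
      split_ifs
      · exact ⟨1, by simp⟩
      · exact ⟨0, by simp⟩
    simp only [LinearMap.BilinForm.dualBasis_repr_apply]
    rw [mem_dualLattice]
    refine ⟨fun h i => h _ (hbm i), fun h y hy => ?_⟩
    choose m hm using h
    choose k hk using (hb y).1 hy
    refine ⟨∑ i, k i * m i, ?_⟩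
    conv_lhs => rw [← b.sum_repr y]
    simp [hm, hk]

/-- This is `Λ** ⊆ Λ`: the coordinates of `x` in a basis of `Λ` are its pairings with the dual
basis, which lies in `Λ*`. -/
theorem mem_of_forall_mem_dualLattice {B : LinearMap.BilinForm ℚ E} (hB : B.Nondegenerate)
    (hs : B.IsSymm) {Λ : AddSubgroup E} (hfg : Λ.FG)
    (hspan : Submodule.span ℚ (Λ : Set E) = ⊤) {x : E}
    (h : ∀ y ∈ dualLattice B Λ, ∃ n : ℤ, B x y = n) : x ∈ Λ := by
  obtain ⟨n, b, c, hcb, hb, hc⟩ := exists_basis_dualLattice hB Λ hfg hspan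
  refine (hb x).2 fun i => ?_
  have hci : c i ∈ dualLattice B Λ := (hc _).2 fun j => by
    rw [c.repr_self, Finsupp.single_apply]
    split_ifs
    · exact ⟨1, by simp⟩
    · exact ⟨0, by simp⟩
  obtain ⟨m, hm⟩ := h _ hci
  refine ⟨m, ?_⟩
  rw [← hm]
  have : B x (c i) = B (c i) x := by simpa using hs.eq x (c i)
  rw [this]
  conv_rhs => rw [← b.sum_repr x]
  rw [map_sum]
  simp_rw [map_smul, hcb]
  simp

/-- Makes the stability of `Λ` redundant in the discriminant kernel. If `A x ∈ Λ` and `y ∈ Λ*`, then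
`(x - A x, y) = (A x, A y - y)` is integral, so `x - A x ∈ Λ** = Λ`. -/
theorem mem_iff_of_forall_sub_mem {B : LinearMap.BilinForm ℚ E} (hB : B.Nondegenerate)
    (hs : B.IsSymm) {Λ : AddSubgroup E} (hfg : Λ.FG)
    (hspan : Submodule.span ℚ (Λ : Set E) = ⊤) (hle : Λ ≤ dualLattice B Λ) {A : E ≃ₗ[ℚ] E}
    (hA : A ∈ bilinOrthogonalGroup B)
    (h : ∀ x ∈ dualLattice B Λ, A x - x ∈ Λ) (x : E) : A x ∈ Λ ↔ x ∈ Λ := by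
  refine ⟨fun hx => ?_, fun hx => ?_⟩
  · have hx' : x - A x ∈ Λ := by
      refine mem_of_forall_mem_dualLattice hB hs hfg hspan fun y hy => ?_
      obtain ⟨m, hm⟩ := mem_dualLattice.1 (hle hx) _ (h y hy)
      refine ⟨m, ?_⟩
      rw [← hm, map_sub, map_sub, LinearMap.sub_apply, hA x y]
    simpa using Λ.add_mem hx' hx
  · simpa using Λ.add_mem (h x (hle hx)) hx

end lattice


/-! ### The Levi quotient of a parabolic subgroup -/

section levi

variable {K E F : Type*} [Field K] [AddCommGroup E] [Module K E] [AddCommGroup F] [Module K F]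

theorem bilinParabolic_le (B : LinearMap.BilinForm K E) (X : Submodule K E) :
    bilinParabolic B X ≤ bilinOrthogonalGroup B := fun _ h => h.1

theorem bilinParabolic_orthogonal {B : LinearMap.BilinForm K E} {X : Submodule K E}
    {A : E ≃ₗ[K] E} (hA : A ∈ bilinParabolic B X) {x : E} (hx : ∀ u ∈ X, B u x = 0) :
    ∀ u ∈ X, B u (A x) = 0 := by
  intro u hu
  have h := hA.1 (A.symm u) x
  rw [A.apply_symm_apply] at h
  rw [h]
  refine hx _ ((hA.2 _).1 ?_)
  rwa [A.apply_symm_apply]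

/-- `F`, with the form `BF`, is a complement of the isotropic subspace `X` in `X^⊥`, with inclusion
`i` and with the orthogonal projection `p` of the whole space. -/
structure IsLeviComplement (B : LinearMap.BilinForm K E) (X : Submodule K E)
    (BF : LinearMap.BilinForm K F) (i : F →ₗ[K] E) (p : E →ₗ[K] F) : Prop where
  isotropic : ∀ u ∈ X, ∀ v ∈ X, B u v = 0
  adjoint_left : ∀ w x, B (i w) x = BF w (p x)
  adjoint_right : ∀ x w, B x (i w) = BF (p x) w
  proj_eq_zero : ∀ u ∈ X, p u = 0
  proj_incl : ∀ w, p (i w) = w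
  sub_mem : ∀ x, (∀ u ∈ X, B u x = 0) → x - i (p x) ∈ X

namespace IsLeviComplement

variable {B : LinearMap.BilinForm K E} {X : Submodule K E} {BF : LinearMap.BilinForm K F}
  {i : F →ₗ[K] E} {p : E →ₗ[K] F}

theorem left_orthogonal (h : IsLeviComplement B X BF i p) {u : E} (hu : u ∈ X) (w : F) :
    B u (i w) = 0 := by
  rw [h.adjoint_right, h.proj_eq_zero u hu, map_zero, LinearMap.zero_apply]

theorem right_orthogonal (h : IsLeviComplement B X BF i p) (w : F) {u : E} (hu : u ∈ X) :
    B (i w) u = 0 := by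
  rw [h.adjoint_left, h.proj_eq_zero u hu, map_zero]

theorem isometry (h : IsLeviComplement B X BF i p) (w w' : F) : B (i w) (i w') = BF w w' := by
  rw [h.adjoint_left, h.proj_incl]

theorem map_sub_mem (h : IsLeviComplement B X BF i p) {A : E ≃ₗ[K] E}
    (hA : A ∈ bilinParabolic B X) (w : F) : A (i w) - i (p (A (i w))) ∈ X :=
  h.sub_mem _ (bilinParabolic_orthogonal hA fun _ hu => h.left_orthogonal hu w)

theorem form_map (h : IsLeviComplement B X BF i p) {A : E ≃ₗ[K] E}
    (hA : A ∈ bilinParabolic B X) (w w' : F) : BF (p (A (i w))) (p (A (i w'))) = BF w w' := by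
  have h1 := h.map_sub_mem hA w
  have h2 := h.map_sub_mem hA w'
  rw [← h.isometry w w', ← hA.1, ← h.isometry]
  conv_rhs => rw [← sub_add_cancel (A (i w)) (i (p (A (i w)))),
    ← sub_add_cancel (A (i w')) (i (p (A (i w'))))]
  simp only [map_add, LinearMap.add_apply]
  rw [h.isotropic _ h1 _ h2, h.left_orthogonal h1, h.right_orthogonal _ h2]
  simp

/-- The error `A' (i w) - i (p (A' (i w)))` lies in `X`, which `A` preserves and `p` kills. Hence
compression to `F` is multiplicative on the parabolic subgroup, though not on the whole orthogonal
group. -/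
theorem map_mul (h : IsLeviComplement B X BF i p) {A A' : E ≃ₗ[K] E}
    (hA : A ∈ bilinParabolic B X) (hA' : A' ∈ bilinParabolic B X) (w : F) :
    p (A (A' (i w))) = p (A (i (p (A' (i w))))) := by
  rw [← sub_eq_zero, ← map_sub, ← map_sub]
  exact h.proj_eq_zero _ ((hA.2 _).2 (h.map_sub_mem hA' w))

/-- The automorphism of `F ≅ X^⊥ / X` induced by an element of the parabolic subgroup. -/
def quot (h : IsLeviComplement B X BF i p) (A : bilinParabolic B X) : F ≃ₗ[K] F :=
  LinearEquiv.ofLinearMap (p ∘ₗ (A : E ≃ₗ[K] E).toLinearMap ∘ₗ i)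
    (p ∘ₗ ((A⁻¹ : bilinParabolic B X) : E ≃ₗ[K] E).toLinearMap ∘ₗ i)
    (LinearMap.ext fun w => by
      refine (h.map_mul A.2 (A⁻¹).2 w).symm.trans ?_
      change p ((A : E ≃ₗ[K] E) ((A : E ≃ₗ[K] E).symm (i w))) = w
      rw [LinearEquiv.apply_symm_apply, h.proj_incl])
    (LinearMap.ext fun w => by
      refine (h.map_mul (A⁻¹).2 A.2 w).symm.trans ?_
      change p ((A : E ≃ₗ[K] E).symm ((A : E ≃ₗ[K] E) (i w))) = w
      rw [LinearEquiv.symm_apply_apply, h.proj_incl])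

theorem quot_apply (h : IsLeviComplement B X BF i p) (A : bilinParabolic B X) (w : F) :
    h.quot A w = p ((A : E ≃ₗ[K] E) (i w)) := rfl

theorem quot_mem (h : IsLeviComplement B X BF i p) (A : bilinParabolic B X) :
    h.quot A ∈ bilinOrthogonalGroup BF := fun w w' => h.form_map A.2 w w'

end IsLeviComplement

/-- The restriction of an element of the parabolic subgroup to the isotropic subspace. -/
def parabolicRestrict {B : LinearMap.BilinForm K E} {X : Submodule K E} (A : bilinParabolic B X) :
    X ≃ₗ[K] X :=
  LinearEquiv.ofLinearMap
    ((A : E ≃ₗ[K] E).toLinearMap.restrict fun x hx => (A.2.2 x).2 hx)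
    (((A⁻¹ : bilinParabolic B X) : E ≃ₗ[K] E).toLinearMap.restrict fun x hx => ((A⁻¹).2.2 x).2 hx)
    (LinearMap.ext fun x => Subtype.ext ((A : E ≃ₗ[K] E).apply_symm_apply x))
    (LinearMap.ext fun x => Subtype.ext ((A : E ≃ₗ[K] E).symm_apply_apply x))

end levi

namespace IsotropicDatum

variable {V : Type*} [AddCommGroup V] [Module ℚ V] (S : IsotropicDatum V)

/-! ### The form in the decomposition `V = U ⊕ W̃ ⊕ Ũ` -/

theorem form_add_add (u u' : S.U) (w w' : S.Wt) (y y' : S.Ut) :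
    S.form (u + w + y) (u' + w' + y') =
      S.form u y' + S.form u' y + S.form w w' + S.form y y' := by
  have h1 := S.isotropic u u.2 u' u'.2
  have h2 := S.form_U_Wt u w'
  have h3 := S.form_U_Wt u' w
  have h4 := S.form_Ut_Wt y w'
  have h5 := S.form_Ut_Wt y' w
  rw [S.form_comm] at h3 h5
  have h6 := S.form_comm y u'
  simp only [map_add, LinearMap.add_apply]
  linarith

theorem exists_decomp (v : V) : ∃ (u : S.U) (w : S.Wt) (y : S.Ut), v = u + w + y :=
  ⟨S.prU v, S.prWt v, S.prUt v, (S.pr_add v).symm⟩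

theorem decomp_ext {u u' : S.U} {w w' : S.Wt} {y y' : S.Ut}
    (h : (u : V) + w + y = u' + w' + y') : u = u' ∧ w = w' ∧ y = y' := by
  refine ⟨?_, ?_, ?_⟩
  · rw [← S.prU_eq u w y, h, S.prU_eq]
  · rw [← S.prWt_eq u w y, h, S.prWt_eq]
  · rw [← S.prUt_eq u w y, h, S.prUt_eq]

theorem Ut_ext {y y' : S.Ut} (h : ∀ u : S.U, S.form y u = S.form y' u) : y = y' :=
  S.utIso.injective (LinearMap.ext h)

theorem formW_wtIso (w w' : S.Wt) : S.formW (S.wtIso w) (S.wtIso w') = S.form w w' :=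
  S.formW_mk _ _

theorem Wt_ext [FiniteDimensional ℚ V] {w w' : S.Wt} (h : ∀ x : S.Wt, S.form w x = S.form w' x) :
    w = w' := by
  refine S.wtIso.injective (sub_eq_zero.1 (S.formW_nondeg.1 _ fun x => ?_))
  obtain ⟨x, rfl⟩ := S.wtIso.surjective x
  rw [map_sub, LinearMap.sub_apply, formW_wtIso, formW_wtIso, h, sub_self]

theorem form_mStarTilde (M : S.U ≃ₗ[ℚ] S.U) (y : S.Ut) (u : S.U) :
    S.form u (S.mStarTilde M y) = S.form (M u) y := by
  rw [S.form_comm, S.form_comm (M u : V), ← utIso_apply, ← utIso_apply]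
  simp [mStarTilde]

theorem form_mInvStarTilde (M : S.U ≃ₗ[ℚ] S.U) (y : S.Ut) (u : S.U) :
    S.form (M u) (S.mInvStarTilde M y) = S.form u y := by
  rw [← form_mStarTilde]
  simp [mInvStarTilde]

@[simp] theorem mInvStarTilde_mStarTilde (M : S.U ≃ₗ[ℚ] S.U) (y : S.Ut) :
    S.mInvStarTilde M (S.mStarTilde M y) = y := by simp [mInvStarTilde]

@[simp] theorem mStarTilde_mInvStarTilde (M : S.U ≃ₗ[ℚ] S.U) (y : S.Ut) :
    S.mStarTilde M (S.mInvStarTilde M y) = y := by simp [mInvStarTilde]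

theorem form_gammaTilde (γ : bilinOrthogonalGroup S.formW) (w w' : S.Wt) :
    S.form (S.gammaTilde γ w) (S.gammaTilde γ w') = S.form w w' := by
  rw [← formW_wtIso, ← formW_wtIso]
  simpa [gammaTilde] using γ.2 (S.wtIso w) (S.wtIso w')

theorem gammaTilde_surjective (γ : bilinOrthogonalGroup S.formW) :
    Function.Surjective (S.gammaTilde γ) := fun w =>
  ⟨S.wtIso.symm ((γ : S.W ≃ₗ[ℚ] S.W).symm (S.wtIso w)), by simp [gammaTilde]⟩

theorem form_psiStarTilde [FiniteDimensional ℚ V] (ψ : S.W →ₗ[ℚ] S.U) (y : S.Ut) (w : S.Wt) :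
    S.form (S.psiTilde ψ w) y = S.form (S.psiStarTilde ψ y) w := by
  rw [eq_comm, S.form_comm _ (y : V), ← formW_wtIso, ← utIso_apply]
  simp [psiStarTilde, psiStar, psiTilde]

theorem form_etaTilde_neg (η : homAs S.U) (y y' : S.Ut) :
    S.form (S.etaTilde η y) y' = -S.form (S.etaTilde η y') y := by
  rw [S.form_comm, S.form_comm _ (y : V), ← utIso_apply, ← utIso_apply]
  exact η.2 _ _

/-! ### Coordinates on the parabolic subgroup -/

/-- The element with coordinates `(M, γ, ψ, η)`, in the decomposition `V = U ⊕ W̃ ⊕ Ũ`. -/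
theorem elt_decomp [FiniteDimensional ℚ V] (M : S.U ≃ₗ[ℚ] S.U) (γ : bilinOrthogonalGroup S.formW)
    (ψ : S.W →ₗ[ℚ] S.U)
    (η : homAs S.U) (u : S.U) (w : S.Wt) (y : S.Ut) :
    S.elt M γ ψ η (u + w + y) =
      ((M u - S.psiTilde ψ (S.gammaTilde γ w) + (M (S.alpha y) - S.alpha (S.mInvStarTilde M y)
        - (1 / 2 : ℚ) • S.psiTilde ψ (S.psiStarTilde ψ (S.mInvStarTilde M y))
        - S.etaTilde η (S.mInvStarTilde M y)) : S.U) : V)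
      + ((S.gammaTilde γ w + S.psiStarTilde ψ (S.mInvStarTilde M y) : S.Wt) : V)
      + (S.mInvStarTilde M y : S.Ut) := by
  obtain ⟨h1, h2, h3⟩ := S.elt_apply M γ ψ η u w y
  rw [map_add, map_add, h1, h2, h3]
  push_cast
  abel

theorem elt_mem_parabolic [FiniteDimensional ℚ V] (M : S.U ≃ₗ[ℚ] S.U)
    (γ : bilinOrthogonalGroup S.formW)
    (ψ : S.W →ₗ[ℚ] S.U) (η : homAs S.U) : S.elt M γ ψ η ∈ S.parabolic := by
  have hM : ∀ u : S.U, S.elt M γ ψ η u = M u := fun u => (S.elt_apply M γ ψ η u 0 0).1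
  refine ⟨fun x x' => ?_, fun x => ⟨fun hx => ?_, fun hx => ?_⟩⟩
  · obtain ⟨u, w, y, rfl⟩ := S.exists_decomp x
    obtain ⟨u', w', y', rfl⟩ := S.exists_decomp x'
    rw [elt_decomp, elt_decomp, form_add_add, form_add_add]
    -- Writing the `Ũ`-components as `M* z` removes every `M^{-*}`. The isometry identity is then
    -- linear in the adjunction relations for `M`, `ψ`, `α` and `η`: the `α` terms account for the
    -- form on `Ũ`, the terms in `ψ ψ* / 2` for the form on `W̃`, and `η` drops out by antisymmetry.
    obtain ⟨z, rfl⟩ := (S.mStarTilde M).surjective y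
    obtain ⟨z', rfl⟩ := (S.mStarTilde M).surjective y'
    rw [mInvStarTilde_mStarTilde, mInvStarTilde_mStarTilde]
    have e1 := S.form_mStarTilde M z u'
    have e2 := S.form_mStarTilde M z' u
    have c1 := S.form_comm (S.mStarTilde M z) (S.mStarTilde M z')
    have c2 := S.form_comm z z'
    have c3 := S.form_comm (S.psiStarTilde ψ z) (S.psiStarTilde ψ z')
    have c4 := S.form_comm (S.gammaTilde γ w) (S.psiStarTilde ψ z')
    have e3 := S.form_mStarTilde M z (S.alpha (S.mStarTilde M z'))
    have e4 := S.form_mStarTilde M z' (S.alpha (S.mStarTilde M z))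
    have f1 := S.form_gammaTilde γ w w'
    have f2 := S.form_psiStarTilde ψ z (S.gammaTilde γ w')
    have f3 := S.form_psiStarTilde ψ z' (S.gammaTilde γ w)
    have f4 := S.form_psiStarTilde ψ z (S.psiStarTilde ψ z')
    have f5 := S.form_psiStarTilde ψ z' (S.psiStarTilde ψ z)
    have g1 := S.form_alpha (S.mStarTilde M z) (S.mStarTilde M z')
    have g2 := S.form_alpha (S.mStarTilde M z') (S.mStarTilde M z)
    have g3 := S.form_alpha z z'
    have g4 := S.form_alpha z' z
    have k1 := S.form_etaTilde_neg η z z'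
    simp only [Submodule.coe_add, Submodule.coe_sub, Submodule.coe_smul, map_add, map_sub,
      map_smul, LinearMap.add_apply, LinearMap.sub_apply, LinearMap.smul_apply, smul_eq_mul]
    linarith
  · obtain ⟨u, hu⟩ := M.surjective ⟨_, hx⟩
    have h := hM u
    rw [hu] at h
    rw [← (S.elt M γ ψ η).injective h]
    exact u.2
  · rw [hM ⟨x, hx⟩]
    exact (M _).2

theorem prUt_eq_zero {x : V} (h : ∀ u ∈ S.U, S.form u x = 0) : S.prUt x = 0 :=
  S.Ut_ext fun u => by
    rw [form_prUt, S.form_comm, h u u.2]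
    simp

theorem form_Wt_wtIso (w : S.Wt) (x : V) :
    S.form (S.wtIso.symm (S.wtIso w)) x = S.formW (S.wtIso w) (S.wtIso (S.prWt x)) := by
  obtain ⟨u, v, y, rfl⟩ := S.exists_decomp x
  rw [formW_wtIso, prWt_eq, LinearEquiv.symm_apply_apply]
  have := S.form_add_add 0 u w v 0 y
  simpa using this

/-- `W` as the complement `W̃` of `U` in `U^⊥`. -/
theorem isLeviComplement : IsLeviComplement S.form S.U S.formW
    (S.Wt.subtype ∘ₗ S.wtIso.symm.toLinearMap) (S.wtIso.toLinearMap ∘ₗ S.prWt) where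
  isotropic := S.isotropic
  adjoint_left w x := by
    obtain ⟨w, rfl⟩ := S.wtIso.surjective w
    exact S.form_Wt_wtIso w x
  adjoint_right x w := by
    obtain ⟨w, rfl⟩ := S.wtIso.surjective w
    rw [S.form_comm, S.formW_comm]
    exact S.form_Wt_wtIso w x
  proj_eq_zero u hu := by
    have := S.prWt_eq ⟨u, hu⟩ 0 0
    simp only [ZeroMemClass.coe_zero, add_zero] at this
    simp [this]
  proj_incl w := by
    have := S.prWt_eq 0 (S.wtIso.symm w) 0
    simp only [ZeroMemClass.coe_zero, add_zero, zero_add] at this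
    simp [this]
  sub_mem x hx := by
    have h := S.pr_add x
    rw [S.prUt_eq_zero hx] at h
    have h' : x - S.prWt x = S.prU x := by
      rw [sub_eq_iff_eq_add]
      simpa using h.symm
    simp [h']

/-- `M`, `γ` and `ψ` are read off from `A` on `U` and on `W̃`. The `Ũ`- and `W̃`-components of `A`
on `Ũ` are then forced by pairing with `A U` and `A W̃`, and `η` is whatever is left in the
`U`-component. -/
theorem exists_elt_eq [FiniteDimensional ℚ V] {A : V ≃ₗ[ℚ] V} (hA : A ∈ S.parabolic) :
    ∃ (M : S.U ≃ₗ[ℚ] S.U) (γ : bilinOrthogonalGroup S.formW) (ψ : S.W →ₗ[ℚ] S.U)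
      (η : homAs S.U), S.elt M γ ψ η = A := by
  let M := parabolicRestrict ⟨A, hA⟩
  let γ : bilinOrthogonalGroup S.formW :=
    ⟨S.isLeviComplement.quot ⟨A, hA⟩, S.isLeviComplement.quot_mem _⟩
  let ψ : S.W →ₗ[ℚ] S.U := -(S.prU ∘ₗ A.toLinearMap ∘ₗ S.Wt.subtype ∘ₗ S.wtIso.symm.toLinearMap
    ∘ₗ (γ : S.W ≃ₗ[ℚ] S.W).symm.toLinearMap)
  have hM : ∀ u : S.U, A u = M u := fun u => rfl
  have hw : ∀ w : S.Wt, A w = S.gammaTilde γ w - S.psiTilde ψ (S.gammaTilde γ w) := by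
    intro w
    have h1 : S.prUt (A w) = 0 :=
      S.prUt_eq_zero (bilinParabolic_orthogonal hA fun u hu => S.form_U_Wt ⟨u, hu⟩ w)
    have h2 := S.pr_add (A w)
    have h3 : S.gammaTilde γ w = S.prWt (A w) := by
      simp [gammaTilde, γ, IsLeviComplement.quot_apply]
    have h4 : S.psiTilde ψ (S.gammaTilde γ w) = -S.prU (A w) := by
      simp [gammaTilde, psiTilde, ψ]
    rw [h1] at h2
    rw [h4, h3, Submodule.coe_neg, sub_neg_eq_add, add_comm]
    simpa using h2.symm
  have hy : ∀ y : S.Ut, S.prUt (A y) = S.mInvStarTilde M y := fun y => S.Ut_ext fun u => by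
    obtain ⟨u, rfl⟩ := M.surjective u
    rw [form_prUt, S.form_comm _ (M u : V), S.form_comm _ (M u : V), form_mInvStarTilde, ← hM]
    exact hA.1 u y
  have hyw : ∀ y : S.Ut, S.prWt (A y) = S.psiStarTilde ψ (S.mInvStarTilde M y) :=
    fun y => S.Wt_ext fun w => by
      obtain ⟨w, rfl⟩ := S.gammaTilde_surjective γ w
      have h := hA.1 y w
      rw [hw, ← S.pr_add (A y), hy, S.form_Ut_Wt] at h
      have h' := S.form_add_add (S.prU (A y)) (-S.psiTilde ψ (S.gammaTilde γ w))
        (S.prWt (A y)) (S.gammaTilde γ w) (S.mInvStarTilde M y) 0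
      rw [← form_psiStarTilde]
      simp only [Submodule.coe_neg, ZeroMemClass.coe_zero, map_zero, add_zero, map_neg,
        LinearMap.neg_apply, zero_add] at h'
      rw [neg_add_eq_sub, h] at h'
      linarith
  -- The formula for `A (M* z)` solved for `η̃ z`. Its antisymmetry is the isometry condition on
  -- `Ũ`.
  let θ : S.Ut →ₗ[ℚ] S.U := (M.toLinearMap ∘ₗ S.alpha ∘ₗ (S.mStarTilde M).toLinearMap - S.alpha
    - (1 / 2 : ℚ) • (S.psiTilde ψ ∘ₗ S.psiStarTilde ψ)
    - S.prU ∘ₗ A.toLinearMap ∘ₗ S.Ut.subtype ∘ₗ (S.mStarTilde M).toLinearMap)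
  have hA' : ∀ z : S.Ut, A (S.mStarTilde M z) = ((M (S.alpha (S.mStarTilde M z)) - S.alpha z
      - (1 / 2 : ℚ) • S.psiTilde ψ (S.psiStarTilde ψ z) - θ z : S.U) : V) + S.psiStarTilde ψ z
      + z := by
    intro z
    have h := S.pr_add (A (S.mStarTilde M z))
    rw [hyw, hy, mInvStarTilde_mStarTilde] at h
    conv_lhs => rw [← h]
    simp [θ]
  have hθ : ∀ z z' : S.Ut, S.form (θ z) z' = -S.form (θ z') z := by
    intro z z'
    have h := hA.1 (S.mStarTilde M z) (S.mStarTilde M z')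
    rw [hA', hA', form_add_add] at h
    have c1 := S.form_comm (S.mStarTilde M z) (S.mStarTilde M z')
    have c2 := S.form_comm z z'
    have c3 := S.form_comm (S.psiStarTilde ψ z) (S.psiStarTilde ψ z')
    have e3 := S.form_mStarTilde M z (S.alpha (S.mStarTilde M z'))
    have e4 := S.form_mStarTilde M z' (S.alpha (S.mStarTilde M z))
    have f4 := S.form_psiStarTilde ψ z (S.psiStarTilde ψ z')
    have f5 := S.form_psiStarTilde ψ z' (S.psiStarTilde ψ z)
    have g1 := S.form_alpha (S.mStarTilde M z) (S.mStarTilde M z')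
    have g2 := S.form_alpha (S.mStarTilde M z') (S.mStarTilde M z)
    have g3 := S.form_alpha z z'
    have g4 := S.form_alpha z' z
    simp only [Submodule.coe_sub, Submodule.coe_smul, map_sub, map_smul, LinearMap.sub_apply,
      LinearMap.smul_apply, smul_eq_mul] at h
    linarith
  let η : homAs S.U := ⟨θ ∘ₗ S.utIso.symm.toLinearMap, by
    intro f g
    obtain ⟨z, rfl⟩ := S.utIso.surjective f
    obtain ⟨z', rfl⟩ := S.utIso.surjective g
    simp only [LinearMap.comp_apply, LinearEquiv.coe_coe, LinearEquiv.symm_apply_apply,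
      utIso_apply]
    rw [S.form_comm, hθ, S.form_comm]⟩
  refine ⟨M, γ, ψ, η, LinearEquiv.ext fun v => ?_⟩
  obtain ⟨u, w, y, rfl⟩ := S.exists_decomp v
  obtain ⟨z, rfl⟩ := (S.mStarTilde M).surjective y
  have hη : S.etaTilde η z = θ z := by simp [etaTilde, η]
  rw [elt_decomp, map_add, map_add, hA', hw, hM, mInvStarTilde_mStarTilde, hη]
  push_cast
  abel

theorem psiTilde_injective : Function.Injective (S.psiTilde) := by
  intro a b h
  refine LinearMap.ext fun x => ?_
  obtain ⟨x, rfl⟩ := S.wtIso.surjective x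
  exact LinearMap.congr_fun h x

theorem etaTilde_injective : Function.Injective (S.etaTilde) := by
  intro a b h
  refine LinearMap.ext fun x => ?_
  obtain ⟨x, rfl⟩ := S.utIso.surjective x
  exact LinearMap.congr_fun h x

theorem elt_injective [FiniteDimensional ℚ V] {M M' : S.U ≃ₗ[ℚ] S.U}
    {γ γ' : bilinOrthogonalGroup S.formW}
    {ψ ψ' : S.W →ₗ[ℚ] S.U} {η η' : homAs S.U} (h : S.elt M γ ψ η = S.elt M' γ' ψ' η') :
    M = M' ∧ γ = γ' ∧ ψ = ψ' ∧ η = η' := by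
  have key := fun u w y => (S.elt_decomp M γ ψ η u w y).symm.trans
    ((LinearEquiv.congr_fun h _).trans (S.elt_decomp M' γ' ψ' η' u w y))
  have key' := fun u w y => S.decomp_ext (key u w y)
  have hM : M = M' := LinearEquiv.ext fun u => by simpa using (key' u 0 0).1
  have hg : ∀ w, S.gammaTilde γ w = S.gammaTilde γ' w := fun w => by simpa using (key' 0 w 0).2.1
  have hγ : γ = γ' := Subtype.ext (LinearEquiv.ext fun w => by
    have := hg (S.wtIso.symm w)
    simpa [gammaTilde] using this)
  subst hM hγ
  have hψ : ψ = ψ' := S.psiTilde_injective (LinearMap.ext fun w => by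
    obtain ⟨w, rfl⟩ := S.gammaTilde_surjective γ w
    simpa using (key' 0 w 0).1)
  subst hψ
  refine ⟨rfl, rfl, rfl, Subtype.ext (S.etaTilde_injective (LinearMap.ext fun z => ?_))⟩
  simpa using (key' 0 0 (S.mStarTilde M z)).1

theorem bijOn_elt [FiniteDimensional ℚ V] : Set.BijOn
    (fun p : (S.U ≃ₗ[ℚ] S.U) × bilinOrthogonalGroup S.formW × (S.W →ₗ[ℚ] S.U) × homAs S.U =>
      S.elt p.1 p.2.1 p.2.2.1 p.2.2.2) Set.univ (S.parabolic : Set (V ≃ₗ[ℚ] V)) := by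
  refine ⟨fun p _ => S.elt_mem_parabolic _ _ _ _, ?_, fun A hA => ?_⟩
  · rintro ⟨M, γ, ψ, η⟩ _ ⟨M', γ', ψ', η'⟩ _ h
    obtain ⟨rfl, rfl, rfl, rfl⟩ := S.elt_injective h
    rfl
  · obtain ⟨M, γ, ψ, η, h⟩ := S.exists_elt_eq hA
    exact ⟨(M, γ, ψ, η), trivial, h⟩

end IsotropicDatum


namespace IsotropicDatum

variable {V : Type*} [AddCommGroup V] [Module ℚ V] (S : IsotropicDatum V)

/-! ### The lattices `L`, `L*` in the decomposition `V = U ⊕ W̃ ⊕ Ũ` -/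

theorem mem_It_of_integral {y : V} (hy : y ∈ S.Ut) (h : ∀ u ∈ S.I, ∃ m : ℤ, S.form u y = m) :
    y ∈ S.It := by
  obtain ⟨n, b, c, hb, hc, hbc, hU, hUt⟩ := S.exists_dualBasis_rat
  rw [hUt y hy]
  refine AddSubgroup.sum_mem _ fun i _ => ?_
  obtain ⟨m, hm⟩ := h _ (hb i)
  rw [hm, Int.cast_smul_eq_zsmul]
  exact AddSubgroup.zsmul_mem _ (hc i) _

theorem mem_I_of_integral {u : S.U} (h : ∀ y ∈ S.It, ∃ m : ℤ, S.form u y = m) : u ∈ S.I := by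
  obtain ⟨n, b, c, hb, hc, hbc, hU, hUt⟩ := S.exists_dualBasis_rat
  rw [hU u]
  refine AddSubgroup.sum_mem _ fun i _ => ?_
  obtain ⟨m, hm⟩ := h _ (hc i)
  rw [hm, Int.cast_smul_eq_zsmul]
  exact AddSubgroup.zsmul_mem _ (hb i) _

theorem form_integral_of_mem_I {u : S.U} (hu : u ∈ S.I) {y : V} (hy : y ∈ S.It) :
    ∃ m : ℤ, S.form u y = m := S.unimodular.1 u (S.I_le u hu) y hy

theorem L_le_Ldual : S.L ≤ S.Ldual := fun _ hx =>
  mem_dualLattice.2 fun _ hy => S.form_integral hx hy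

theorem form_integral_of_mem_Ldual {x y : V} (hx : x ∈ S.L) (hy : y ∈ S.Ldual) :
    ∃ m : ℤ, S.form x y = m := by
  rw [S.form_comm]
  exact mem_dualLattice.1 hy x hx

theorem mem_L_of_integral [FiniteDimensional ℚ V] {x : V}
    (h : ∀ y ∈ S.Ldual, ∃ m : ℤ, S.form x y = m) : x ∈ S.L :=
  mem_of_forall_mem_dualLattice S.nondeg S.symm S.fg S.span_eq_top h

/-- Since `Ĩ ⊆ L*` is orthogonal to `W̃`, an element `u + w` of `L` has `u` integral on `Ĩ`, so `u ∈
I`. Thus `U^⊥ ∩ L` is the direct sum of `I` and `W̃ ∩ L`, and the latter is identified with `Λ`. -/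
theorem add_mem_L_iff {u : S.U} {w : S.Wt} :
    (u : V) + w ∈ S.L ↔ u ∈ S.I ∧ S.wtIso w ∈ S.Lam := by
  have hI : ∀ (u : S.U) (w : S.Wt), (u : V) + w ∈ S.L → u ∈ S.I := fun u w h =>
    S.mem_I_of_integral fun y hy => by
      obtain ⟨m, hm⟩ := S.form_integral_of_mem_Ldual h (S.It_le hy)
      refine ⟨m, ?_⟩
      have := S.form_Ut_Wt ⟨y, S.It_le_Ut hy⟩ w
      rw [← hm, map_add, LinearMap.add_apply, S.form_comm w]
      simp [this]
  constructor
  · intro h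
    refine ⟨hI u w h, ⟨⟨(u : V) + w, add_mem (fun x hx => S.isotropic x hx u u.2)
      (S.Wt_le_Uperp w.2)⟩, h, sub_eq_zero.1 ?_⟩⟩
    refine (map_sub S.mkW _ _).symm.trans ((S.mkW_eq_zero _).2 ?_)
    simp
  · rintro ⟨hu, x, hx, hxw⟩
    have h1 : S.mkW (x - ⟨w, S.Wt_le_Uperp w.2⟩) = 0 := by
      rw [map_sub]
      exact sub_eq_zero.2 hxw
    rw [mkW_eq_zero] at h1
    have h2 : ((⟨_, h1⟩ : S.U) : V) + w ∈ S.L := by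
      change (x : V) - w + w ∈ S.L
      rw [sub_add_cancel]
      exact hx
    have h3 := sub_mem h2 (hI _ _ h2)
    have h4 := add_mem (show (u : V) ∈ S.L from hu) h3
    simpa using h4

theorem Wt_mem_L_iff {w : S.Wt} : (w : V) ∈ S.L ↔ S.wtIso w ∈ S.Lam := by
  have := S.add_mem_L_iff (u := 0) (w := w)
  simpa [S.I.zero_mem] using this

theorem Lam_fg : S.Lam.FG := by
  have h1 : Module.Finite ℤ S.L := Module.Finite.iff_addGroup_fg.2
    ((AddGroup.fg_iff_addSubgroup_fg _).2 S.fg)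
  have h3 : Module.Finite ℤ (S.L.comap S.Uperp.subtype.toAddMonoidHom) :=
    Module.Finite.of_injective (N := S.L)
      (AddMonoidHom.toIntLinearMap
        (AddMonoidHom.mk' (fun x => ⟨(x.1 : V), x.2⟩) fun _ _ => rfl))
      (fun x y h => Subtype.ext (Subtype.ext (congrArg (fun z : S.L => (z : V)) h)))
  have h4 : Module.Finite ℤ S.Lam :=
    Module.Finite.of_surjective (S.mkW.toAddMonoidHom.addSubgroupMap _).toIntLinearMap
      (S.mkW.toAddMonoidHom.addSubgroupMap_surjective _)
  exact (AddGroup.fg_iff_addSubgroup_fg _).1 (Module.Finite.iff_addGroup_fg.1 h4)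

theorem span_Lam : Submodule.span ℚ (S.Lam : Set S.W) = ⊤ := by
  refine eq_top_iff.2 fun x _ => ?_
  obtain ⟨x, rfl⟩ := S.mkW_surjective x
  obtain ⟨k, hk, hkx⟩ := S.exists_natCast_smul_mem x
  have h : S.mkW ((k : ℚ) • x) ∈ Submodule.span ℚ (S.Lam : Set S.W) :=
    Submodule.subset_span ⟨_, hkx, rfl⟩
  rw [map_smul] at h
  exact (Submodule.smul_mem_iff _ (Nat.cast_ne_zero.2 hk)).1 h

theorem formW_isSymm : S.formW.IsSymm := ⟨S.formW_comm⟩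

theorem Lam_le_LamDual : S.Lam ≤ S.LamDual := by
  rintro _ ⟨x, hx, rfl⟩
  refine mem_dualLattice.2 ?_
  rintro _ ⟨y, hy, rfl⟩
  obtain ⟨m, hm⟩ := S.form_integral hx hy
  exact ⟨m, (S.formW_mk _ _).trans hm⟩

theorem mem_ItL_of_mem_L {u : S.U} {w : S.Wt} {y : S.Ut} (h : (u : V) + w + y ∈ S.L) :
    (y : V) ∈ S.ItL := by
  have h1 : ∀ x : S.U, S.form x ((u : V) + w + y) = S.form x y := fun x => by
    simp [S.isotropic x x.2 u u.2, S.form_U_Wt]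
  refine ⟨S.mem_It_of_integral y.2 fun x hx => ?_, _, h, fun x _ => ?_⟩
  · rw [← h1]
    exact S.form_integral hx h
  · rw [S.form_comm, S.form_comm _ (x : V), h1]

theorem exists_mem_L_of_mem_ItL (y : S.ItL) : ∃ (u : S.U) (w : S.Wt), (u : V) + w + y ∈ S.L := by
  obtain ⟨u, w, z, h⟩ := S.exists_decomp (S.liftL y)
  have hz : z = ⟨(y : V), S.It_le_Ut y.2.1⟩ := S.Ut_ext fun x => by
    have h1 := S.liftL_sub_mem y x x.2
    change S.form x _ = 0 at h1
    rw [h] at h1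
    simp only [map_sub, map_add, S.isotropic x x.2 u u.2, S.form_U_Wt] at h1
    rw [S.form_comm, S.form_comm _ (x : V)]
    change S.form x z = S.form x y
    linarith
  subst hz
  exact ⟨u, w, h ▸ S.liftL_mem y⟩

theorem toQZ_eq_neg_iff (q r : ℚ) : toQZ q = -toQZ r ↔ ∃ m : ℤ, q + r = m := by
  rw [eq_neg_iff_add_eq_zero, ← map_add, toQZ_eq_zero]

theorem charMap_iotaStar (x : S.LamDual) (y : S.ItL) :
    S.charEquiv (S.iotaStar (QuotientAddGroup.mk x)) y =
      S.discToChar (QuotientAddGroup.mk x) (S.iota y) := by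
  have : S.charEquiv (S.iotaStar (QuotientAddGroup.mk x)) =
    CharacterModule.dual S.iota.toIntLinearMap (S.discToChar (QuotientAddGroup.mk x)) :=
    S.charEquiv.apply_symm_apply _
  rw [this]
  rfl

/-- The pairing of `u + w` with `u' + w' + y' ∈ L` is `(u, y') + (w, w')`, and `w'` represents `ι
y'`. Since every `y' ∈ Ĩ_L` occurs, integrality on `L` says that `u` and `-ι* w` define the same
character of `Ĩ_L`. -/
theorem mem_Ldual_iff (u : S.U) (w : S.Wt) (hw : S.wtIso w ∈ S.LamDual) :
    (u : V) + w ∈ S.Ldual ↔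
      (QuotientAddGroup.mk u : S.U ⧸ S.ILdual) =
        -S.iotaStar (QuotientAddGroup.mk (⟨S.wtIso w, hw⟩ : S.LamDual)) := by
  have hform : ∀ (u' : S.U) (w' : S.Wt) (y' : S.Ut),
      S.form ((u : V) + w) (u' + w' + y') = S.form u y' + S.form w w' := by
    intro u' w' y'
    have := S.form_add_add u u' w w' 0 y'
    simpa using this
  have key : ∀ (u' : S.U) (w' : S.Wt) (y' : S.ItL), (u' : V) + w' + y' ∈ S.L →
      ((∃ m : ℤ, S.form ((u : V) + w) (u' + w' + y') = m) ↔
        S.charEquiv (QuotientAddGroup.mk u) y' =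
        (-S.charEquiv (S.iotaStar (QuotientAddGroup.mk (⟨S.wtIso w, hw⟩ : S.LamDual)))) y') := by
    intro u' w' y' h
    obtain ⟨hw', hi⟩ := S.iota_eq_of_mem_L u' w' y' h
    have h1 : (-S.charEquiv (S.iotaStar (QuotientAddGroup.mk (⟨S.wtIso w, hw⟩ : S.LamDual)))) y' =
        -toQZ (S.form w w') := by
      change -(S.charEquiv (S.iotaStar (QuotientAddGroup.mk (⟨S.wtIso w, hw⟩ : S.LamDual))) y') = _
      rw [charMap_iotaStar, hi, ← S.formW_wtIso]
      rfl
    have h2 : S.charEquiv (QuotientAddGroup.mk u) y' = toQZ (S.form u y') := rfl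
    have h3 := hform u' w' ⟨y', S.It_le_Ut y'.2.1⟩
    change S.form ((u : V) + w) (u' + w' + y') = S.form u y' + S.form w w' at h3
    rw [h1, h2, toQZ_eq_neg_iff, h3]
  rw [← S.charEquiv.injective.eq_iff, map_neg]
  constructor
  · intro h
    refine CharacterModule.ext _ fun y => ?_
    obtain ⟨u', w', h'⟩ := S.exists_mem_L_of_mem_ItL y
    exact (key u' w' y h').1 (mem_dualLattice.1 h _ h')
  · intro h
    refine mem_dualLattice.2 fun x hx => ?_
    obtain ⟨u', w', y', rfl⟩ := S.exists_decomp x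
    exact (key u' w' ⟨y', S.mem_ItL_of_mem_L hx⟩ hx).2 (DFunLike.congr_fun h _)

theorem exists_add_mem_Ldual (w : S.Wt) (hw : S.wtIso w ∈ S.LamDual) :
    ∃ u : S.U, (u : V) + w ∈ S.Ldual := by
  obtain ⟨u, hu⟩ := QuotientAddGroup.mk_surjective
    (-S.iotaStar (QuotientAddGroup.mk (⟨S.wtIso w, hw⟩ : S.LamDual)))
  exact ⟨u, (S.mem_Ldual_iff u w hw).2 hu⟩

theorem mem_LamDual_of_add_mem_Ldual {u : S.U} {w : S.Wt} (h : (u : V) + w ∈ S.Ldual) :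
    S.wtIso w ∈ S.LamDual := by
  refine mem_dualLattice.2 fun x hx => ?_
  obtain ⟨x, rfl⟩ := S.wtIso.surjective x
  obtain ⟨m, hm⟩ := mem_dualLattice.1 h x (S.Wt_mem_L_iff.2 hx)
  refine ⟨m, ?_⟩
  rw [formW_wtIso, ← hm]
  simp [S.form_U_Wt]

/-- Pairing with `I` sees only `y`, so `y` is in `Ĩ` by unimodularity; as `Ĩ ⊆ L*`, it may be
subtracted. -/
theorem mem_It_and_add_mem_Ldual {u : S.U} {w : S.Wt} {y : S.Ut}
    (h : (u : V) + w + y ∈ S.Ldual) : (y : V) ∈ S.It ∧ (u : V) + w ∈ S.Ldual := by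
  have h1 : (y : V) ∈ S.It := S.mem_It_of_integral y.2 fun x hx => by
    obtain ⟨m, hm⟩ := mem_dualLattice.1 h x hx
    refine ⟨m, ?_⟩
    rw [← hm, S.form_comm _ (x : V)]
    simp [S.isotropic x x.2 u u.2, S.form_U_Wt]
  refine ⟨h1, ?_⟩
  have := sub_mem h (S.It_le h1)
  simpa using this

/-! ### The discriminant kernel in coordinates -/

/-- The map `(Id - M) α (Id - M*) + M α - α M* - ψ ψ* / 2 - η` from `Ũ` to `U`. -/
def kappaTilde [FiniteDimensional ℚ V] (M : S.U ≃ₗ[ℚ] S.U) (ψ : S.W →ₗ[ℚ] S.U)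
    (η : Module.Dual ℚ S.U →ₗ[ℚ] S.U) : S.Ut →ₗ[ℚ] S.U :=
  (LinearMap.id - M.toLinearMap) ∘ₗ S.alpha ∘ₗ (LinearMap.id - (S.mStarTilde M).toLinearMap)
    + M.toLinearMap ∘ₗ S.alpha - S.alpha ∘ₗ (S.mStarTilde M).toLinearMap
    - (1 / 2 : ℚ) • (S.psiTilde ψ ∘ₗ S.psiStarTilde ψ) - S.etaTilde η

theorem elt_mStarTilde_sub [FiniteDimensional ℚ V] (M : S.U ≃ₗ[ℚ] S.U)
    (γ : bilinOrthogonalGroup S.formW) (ψ : S.W →ₗ[ℚ] S.U) (η : homAs S.U) (z : S.Ut) :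
    S.elt M γ ψ η (S.mStarTilde M z) - S.mStarTilde M z =
      ((S.kappaTilde M ψ η z - (2 : ℚ) • S.alpha (z - S.mStarTilde M z) : S.U) : V)
        + S.psiStarTilde ψ z + ((z - S.mStarTilde M z : S.Ut) : V) := by
  have h := S.elt_decomp M γ ψ η 0 0 (S.mStarTilde M z)
  simp only [ZeroMemClass.coe_zero, zero_add, map_zero, sub_zero, mInvStarTilde_mStarTilde] at h
  rw [h]
  have h2 : S.kappaTilde M ψ η z - (2 : ℚ) • S.alpha (z - S.mStarTilde M z) =
      M (S.alpha (S.mStarTilde M z)) - S.alpha z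
        - (1 / 2 : ℚ) • S.psiTilde ψ (S.psiStarTilde ψ z) - S.etaTilde η z := by
    simp only [kappaTilde, LinearMap.sub_apply, LinearMap.add_apply, LinearMap.comp_apply,
      LinearMap.id_apply, LinearEquiv.coe_coe, LinearMap.smul_apply, map_sub]
    module
  rw [h2]
  push_cast
  abel

/-- The key identity. The term `-2α(z - M* z)` in the `U`-component cancels the pairing of `z - M*
z` with `y`, because `(ũ, y) = 2(α ũ, y)`; the rest is moved onto `z` by adjunction. The form of
`kappaTilde` is chosen to make this happen. -/
theorem form_elt_mStarTilde_sub [FiniteDimensional ℚ V] (M : S.U ≃ₗ[ℚ] S.U)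
    (γ : bilinOrthogonalGroup S.formW) (ψ : S.W →ₗ[ℚ] S.U) (η : homAs S.U) (z : S.Ut)
    (u : S.U) (w : S.Wt) (y : S.Ut) :
    S.form (S.elt M γ ψ η (S.mStarTilde M z) - S.mStarTilde M z) (u + w + y) =
      S.form (S.kappaTilde M ψ η z) y + S.form (S.psiTilde ψ w + (u - M u) : S.U) z := by
  rw [elt_mStarTilde_sub, form_add_add, ← form_psiStarTilde]
  have h1 := S.form_alpha z y
  have h2 := S.form_alpha (S.mStarTilde M z) y
  have h3 := S.form_mStarTilde M z u
  simp only [Submodule.coe_add, Submodule.coe_sub, Submodule.coe_smul, map_add, map_sub,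
    map_smul, LinearMap.add_apply, LinearMap.sub_apply, LinearMap.smul_apply, smul_eq_mul]
  linarith

theorem mStarTilde_mem_It {M : S.U ≃ₗ[ℚ] S.U} (hM : ∀ u, M u ∈ S.I ↔ u ∈ S.I) (y : S.Ut) :
    (S.mStarTilde M y : V) ∈ S.It ↔ (y : V) ∈ S.It := by
  constructor
  · intro h
    refine S.mem_It_of_integral y.2 fun u hu => ?_
    obtain ⟨u, rfl⟩ := M.surjective u
    rw [← form_mStarTilde]
    exact S.form_integral_of_mem_I ((hM u).1 hu) h
  · intro h
    refine S.mem_It_of_integral (S.mStarTilde M y).2 fun u hu => ?_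
    rw [form_mStarTilde]
    exact S.form_integral_of_mem_I ((hM u).2 hu) h

/-- `L*` is generated by its elements `u + w` in `U^⊥` and by `Ĩ`, so the test is made on each
separately: by components on the former, by the key identity and `L** = L` on the latter. -/
theorem elt_sub_mem_L_iff [FiniteDimensional ℚ V] (M : S.U ≃ₗ[ℚ] S.U)
    (γ : bilinOrthogonalGroup S.formW) (ψ : S.W →ₗ[ℚ] S.U) (η : homAs S.U) :
    (∀ x ∈ S.Ldual, S.elt M γ ψ η x - x ∈ S.L) ↔
      (∀ x ∈ S.LamDual, (γ : S.W ≃ₗ[ℚ] S.W) x - x ∈ S.Lam) ∧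
      ((∀ u, M u ∈ S.I ↔ u ∈ S.I) ∧ ∀ u ∈ S.ILdual, u - M u ∈ S.I) ∧
      ((∀ x ∈ S.Lam, ψ x ∈ S.I) ∧ ∀ (u : S.U) (w : S.Wt), (u : V) + w ∈ S.Ldual →
        S.psiTilde ψ w + (u - M u) ∈ S.I) ∧
      ∀ y : S.Ut, (y : V) ∈ S.It → S.kappaTilde M ψ η y ∈ S.I := by
  have hM : ∀ u : S.U, S.elt M γ ψ η u = M u := fun u => (S.elt_apply M γ ψ η u 0 0).1
  have hw : ∀ (u : S.U) (w : S.Wt), S.elt M γ ψ η (u + w) - (u + w) =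
      ((M u - u - S.psiTilde ψ (S.gammaTilde γ w) : S.U) : V) +
        (S.gammaTilde γ w - w : S.Wt) := by
    intro u w
    have := S.elt_decomp M γ ψ η u w 0
    simp only [ZeroMemClass.coe_zero, add_zero, map_zero, sub_zero, smul_zero] at this
    rw [this]
    push_cast
    abel
  have hγw : ∀ w, S.wtIso (S.gammaTilde γ w) = (γ : S.W ≃ₗ[ℚ] S.W) (S.wtIso w) := fun w => by
    simp [gammaTilde]
  have hγ : (∀ x ∈ S.LamDual, (γ : S.W ≃ₗ[ℚ] S.W) x - x ∈ S.Lam) →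
      ∀ x, (γ : S.W ≃ₗ[ℚ] S.W) x ∈ S.Lam ↔ x ∈ S.Lam :=
    mem_iff_of_forall_sub_mem S.formW_nondeg S.formW_isSymm S.Lam_fg S.span_Lam
      S.Lam_le_LamDual γ.2
  constructor
  · intro h
    have h1 : ∀ (u : S.U) (w : S.Wt), (u : V) + w ∈ S.Ldual →
        M u - u - S.psiTilde ψ (S.gammaTilde γ w) ∈ S.I ∧
          (γ : S.W ≃ₗ[ℚ] S.W) (S.wtIso w) - S.wtIso w ∈ S.Lam := by
      intro u w huw
      have h' := h _ huw
      rw [hw, add_mem_L_iff, map_sub, hγw] at h'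
      exact h'
    have h2 : ∀ x ∈ S.LamDual, (γ : S.W ≃ₗ[ℚ] S.W) x - x ∈ S.Lam := by
      intro x hx
      obtain ⟨w, rfl⟩ := S.wtIso.surjective x
      obtain ⟨u, hu⟩ := S.exists_add_mem_Ldual w hx
      exact (h1 u w hu).2
    have h3 : ∀ u, M u ∈ S.I ↔ u ∈ S.I := by
      intro u
      have := mem_iff_of_forall_sub_mem S.nondeg S.symm S.fg S.span_eq_top S.L_le_Ldual
        (S.elt_mem_parabolic M γ ψ η).1 h u
      rw [hM] at this
      exact this
    have h4 : ∀ x ∈ S.Lam, ψ x ∈ S.I := by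
      intro x hx
      -- The test on `U^⊥ ∩ L*` controls `ψ ∘ γ` rather than `ψ`. As `γ` permutes `Λ`, every element
      -- of `Λ` is `γ` of one, and the lift of that one to `W̃` lies in `L`, so `u = 0` is allowed.
      obtain ⟨x, rfl⟩ := (γ : S.W ≃ₗ[ℚ] S.W).surjective x
      obtain ⟨w, rfl⟩ := S.wtIso.surjective x
      have h5 := S.Wt_mem_L_iff.2 ((hγ h2 _).1 hx)
      have h6 := (h1 0 w (by simpa using S.L_le_Ldual h5)).1
      rw [map_zero, zero_sub, neg_zero, zero_sub, neg_mem_iff, psiTilde, LinearMap.comp_apply,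
        LinearEquiv.coe_coe, hγw] at h6
      exact h6
    refine ⟨h2, ⟨h3, fun u hu => ?_⟩, ⟨h4, fun u w huw => ?_⟩, fun y hy => ?_⟩
    · have h5 := (h1 u 0 (by rw [ZeroMemClass.coe_zero, add_zero]; exact hu)).1
      rw [map_zero, map_zero, sub_zero] at h5
      rw [← neg_mem_iff, neg_sub]
      exact h5
    · obtain ⟨h5, h6⟩ := h1 u w huw
      -- `ψ γ w` and `ψ w` differ by an element of `ψ(Λ) ⊆ I`, so `γ` disappears from the condition.
      have h7 := h4 _ h6
      rw [← hγw, ← map_sub] at h7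
      have h8 := neg_mem (add_mem h5 h7)
      convert h8 using 1
      simp only [psiTilde, LinearMap.comp_apply, LinearEquiv.coe_coe, map_sub]
      abel
    · refine S.mem_I_of_integral fun z hz => ?_
      -- Pairing with `z ∈ Ĩ ⊆ L*` sets `u = w = 0` in the key identity and isolates `(κ̃ y, z)`.
      obtain ⟨m, hm⟩ := S.form_integral_of_mem_Ldual
        (h _ (S.It_le ((S.mStarTilde_mem_It h3 y).2 hy))) (S.It_le hz)
      have h5 := S.form_elt_mStarTilde_sub M γ ψ η y 0 0 ⟨z, S.It_le_Ut hz⟩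
      simp only [ZeroMemClass.coe_zero, zero_add, map_zero, sub_zero, LinearMap.zero_apply,
        add_zero] at h5
      exact ⟨m, h5.symm.trans hm⟩
  · rintro ⟨h1, ⟨h2, h3⟩, ⟨h4, h5⟩, h6⟩ x hx
    obtain ⟨u, w, y, rfl⟩ := S.exists_decomp x
    obtain ⟨hy, huw⟩ := S.mem_It_and_add_mem_Ldual hx
    have h7 : S.elt M γ ψ η (u + w) - (u + w) ∈ S.L := by
      have h8 := h1 _ (S.mem_LamDual_of_add_mem_Ldual huw)
      rw [hw, add_mem_L_iff, map_sub, hγw]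
      refine ⟨?_, h8⟩
      have h9 := h4 _ h8
      rw [← hγw, ← map_sub] at h9
      have h10 := neg_mem (add_mem (h5 u w huw) h9)
      convert h10 using 1
      simp only [psiTilde, LinearMap.comp_apply, LinearEquiv.coe_coe, map_sub]
      abel
    have h8 : S.elt M γ ψ η y - y ∈ S.L := by
      obtain ⟨z, rfl⟩ := (S.mStarTilde M).surjective y
      have hz := (S.mStarTilde_mem_It h2 z).1 hy
      refine S.mem_L_of_integral fun v hv => ?_
      obtain ⟨u', w', y', rfl⟩ := S.exists_decomp v
      obtain ⟨hy', huw'⟩ := S.mem_It_and_add_mem_Ldual hv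
      rw [form_elt_mStarTilde_sub]
      obtain ⟨m, hm⟩ := S.form_integral_of_mem_I (h6 z hz) hy'
      obtain ⟨m', hm'⟩ := S.form_integral_of_mem_I (h5 u' w' huw') hz
      exact ⟨m + m', by rw [hm, hm']; push_cast; rfl⟩
    have := add_mem h7 h8
    rw [map_add]
    convert this using 1
    abel

/-- Eliminates `ι*`: whenever `u + w ∈ L*`, the vector `-u` represents `ι* w`, and every class in
`Δ_Λ` has a representative `w` with such a `u`. -/
theorem condPsi_iff (M : S.U ≃ₗ[ℚ] S.U) (hM : M ∈ S.SLI) (ψ : S.W →ₗ[ℚ] S.U) :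
    S.CondPsi M hM ψ ↔ (∀ x ∈ S.Lam, ψ x ∈ S.I) ∧
      ∀ (u : S.U) (w : S.Wt), (u : V) + w ∈ S.Ldual → S.psiTilde ψ w + (u - M u) ∈ S.I := by
  refine (exists_congr fun hψ => ?_).trans exists_prop
  have key : ∀ (u : S.U) (w : S.Wt) (huw : (u : V) + w ∈ S.Ldual) (hw : S.wtIso w ∈ S.LamDual),
      S.psiDelta ψ hψ (QuotientAddGroup.mk (⟨S.wtIso w, hw⟩ : S.LamDual)) =
        ((S.oneSub M hM).comp S.iotaStar) (QuotientAddGroup.mk (⟨S.wtIso w, hw⟩ : S.LamDual)) ↔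
      S.psiTilde ψ w + (u - M u) ∈ S.I := by
    intro u w huw hw
    have h1 := (S.mem_Ldual_iff u w hw).1 huw
    have h2 : ((S.oneSub M hM).comp S.iotaStar)
        (QuotientAddGroup.mk (⟨S.wtIso w, hw⟩ : S.LamDual)) =
        QuotientAddGroup.mk (-(u - M u)) := by
      rw [AddMonoidHom.comp_apply, ← neg_eq_iff_eq_neg.2 h1, map_neg]
      rfl
    have h3 : S.psiDelta ψ hψ (QuotientAddGroup.mk (⟨S.wtIso w, hw⟩ : S.LamDual)) =
      QuotientAddGroup.mk (S.psiTilde ψ w) := rfl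
    rw [h2, h3, QuotientAddGroup.eq, ← neg_mem_iff]
    simp [add_comm]
  constructor
  · intro h u w huw
    exact (key u w huw (S.mem_LamDual_of_add_mem_Ldual huw)).1 (DFunLike.congr_fun h _)
  · intro h
    refine AddMonoidHom.ext fun x => ?_
    induction x using QuotientAddGroup.induction_on with
    | H x =>
      obtain ⟨x, hx⟩ := x
      obtain ⟨w, rfl⟩ := S.wtIso.surjective x
      obtain ⟨u, hu⟩ := S.exists_add_mem_Ldual w hx
      exact (key u w hu hx).2 (h u w hu)

theorem mem_homDual_iff (κ : Module.Dual ℚ S.U →ₗ[ℚ] S.U) :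
    κ ∈ homDual S.I ↔ ∀ y : S.Ut, (y : V) ∈ S.It → S.etaTilde κ y ∈ S.I := by
  constructor
  · intro h y hy
    refine h _ fun u hu => ?_
    rw [LinearEquiv.coe_coe, utIso_apply, S.form_comm]
    exact S.form_integral_of_mem_I hu hy
  · intro h f hf
    obtain ⟨y, rfl⟩ := S.utIso.surjective f
    refine h y (S.mem_It_of_integral y.2 fun u hu => ?_)
    rw [S.form_comm]
    exact hf u hu

theorem condEta_iff [FiniteDimensional ℚ V] (M : S.U ≃ₗ[ℚ] S.U) (ψ : S.W →ₗ[ℚ] S.U)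
    (η : homAs S.U) :
    S.CondEta M ψ η ↔ ∀ y : S.Ut, (y : V) ∈ S.It → S.kappaTilde M ψ η y ∈ S.I := by
  constructor
  · rintro ⟨κ, hκ, h⟩
    have : S.kappaTilde M ψ η = S.etaTilde κ := by
      rw [kappaTilde, h, sub_sub_cancel]
    rw [this]
    exact (S.mem_homDual_iff κ).1 hκ
  · intro h
    have h1 : S.etaTilde (S.kappaTilde M ψ η ∘ₗ S.utIso.symm.toLinearMap) = S.kappaTilde M ψ η :=
      LinearMap.ext fun y => by simp [etaTilde]
    refine ⟨S.kappaTilde M ψ η ∘ₗ S.utIso.symm.toLinearMap, ?_, ?_⟩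
    · rwa [mem_homDual_iff, h1]
    · rw [h1, kappaTilde, sub_sub_cancel]

end IsotropicDatum


namespace IsotropicDatum

variable {V : Type*} [AddCommGroup V] [Module ℚ V] (S : IsotropicDatum V)

/-! ### Existence of `ψ` and `η` -/

/-- The prescribed map, composed with `Λ* → Δ_Λ`, is lifted to `U` on a `ℤ`-basis of the free group
`Λ*`, and the lift is extended linearly. It sends `Λ` to `I` because `Λ` dies in `Δ_Λ`. -/
theorem exists_condPsi [FiniteDimensional ℚ V] (M : S.U ≃ₗ[ℚ] S.U) (hM : M ∈ S.SLI) :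
    ∃ ψ : S.W →ₗ[ℚ] S.U, S.CondPsi M hM ψ := by
  obtain ⟨n, b, c, -, -, hc⟩ := exists_basis_dualLattice S.formW_nondeg S.Lam S.Lam_fg S.span_Lam
  have hci : ∀ i, c i ∈ S.LamDual := fun i => (hc _).2 fun j => by
    rw [c.repr_self, Finsupp.single_apply]
    split_ifs
    · exact ⟨1, by simp⟩
    · exact ⟨0, by simp⟩
  let F : S.LamDual →+ S.U ⧸ S.I := ((S.oneSub M hM).comp S.iotaStar).comp (QuotientAddGroup.mk' _)
  choose q hq using fun i => QuotientAddGroup.mk_surjective (F ⟨c i, hci i⟩)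
  let ψ : S.W →ₗ[ℚ] S.U := c.constr ℚ q
  have hψ : ∀ x : S.LamDual, (QuotientAddGroup.mk (ψ x) : S.U ⧸ S.I) = F x := by
    intro x
    choose m hm using (hc x).1 x.2
    have hx : x = ∑ i, m i • (⟨c i, hci i⟩ : S.LamDual) := by
      apply Subtype.ext
      rw [AddSubgroup.val_finsetSum]
      conv_lhs => rw [← c.sum_repr x]
      exact Finset.sum_congr rfl fun i _ => by
        rw [hm, Int.cast_smul_eq_zsmul, AddSubgroup.coe_zsmul]
    let G : S.LamDual →+ S.U ⧸ S.I :=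
      (QuotientAddGroup.mk' S.I).comp (ψ.toAddMonoidHom.comp S.LamDual.subtype)
    change G x = F x
    rw [hx, map_sum, map_sum]
    refine Finset.sum_congr rfl fun i _ => ?_
    rw [map_zsmul, map_zsmul, ← hq]
    congr 1
    change QuotientAddGroup.mk (c.constr ℚ q (c i)) = _
    rw [Module.Basis.constr_basis]
  refine ⟨ψ, fun x hx => ?_, AddMonoidHom.ext fun x => ?_⟩
  · rw [← QuotientAddGroup.eq_zero_iff, hψ ⟨x, S.Lam_le_LamDual hx⟩]
    have : (QuotientAddGroup.mk' (S.Lam.addSubgroupOf S.LamDual)) ⟨x, S.Lam_le_LamDual hx⟩ = 0 :=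
      (QuotientAddGroup.eq_zero_iff _).2 hx
    rw [AddMonoidHom.comp_apply, this, map_zero]
  · induction x using QuotientAddGroup.induction_on with
    | H x => exact hψ x

/-- A symmetric map `σ : Ũ → U` which is integral on the diagonal of `Ĩ` becomes integral after
adding an antisymmetric map. -/
theorem exists_antisymm_add_mem_I {σ : S.Ut →ₗ[ℚ] S.U}
    (hs : ∀ y z : S.Ut, S.form (σ y) z = S.form (σ z) y)
    (hd : ∀ y : S.Ut, (y : V) ∈ S.It → ∃ m : ℤ, S.form (σ y) y = m) :
    ∃ τ : S.Ut →ₗ[ℚ] S.U, (∀ y z : S.Ut, S.form (τ y) z = -S.form (τ z) y) ∧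
      ∀ y : S.Ut, (y : V) ∈ S.It → σ y + τ y ∈ S.I := by
  obtain ⟨n, b, c, hb, hc, hbc, hU, hUt⟩ := S.exists_dualBasis_rat
  let c' : Fin n → S.Ut := fun i => ⟨c i, S.It_le_Ut (hc i)⟩
  -- The matrix of `τ` copies that of `σ` above the diagonal and is its negative below. So the sum
  -- vanishes below the diagonal, keeps the integral diagonal, and has entries `2 σ_ij` above it,
  -- which are integral by polarizing `(σ y, y)`.
  let t : Fin n → Fin n → ℚ := fun i j =>
    if i < j then S.form (σ (c' j)) (c i) else if j < i then -S.form (σ (c' j)) (c i) else 0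
  have ht : ∀ i j, t i j = -t j i := by
    intro i j
    have h := hs (c' i) (c' j)
    change S.form (σ (c' i)) (c j) = S.form (σ (c' j)) (c i) at h
    rcases lt_trichotomy i j with hij | rfl | hij
    · simp [t, hij, hij.not_gt, h]
    · simp [t]
    · simp [t, hij, hij.not_gt, h]
  let τ : S.Ut →ₗ[ℚ] S.U :=
    ∑ j, ∑ i, t i j • ((S.form (b j)) ∘ₗ S.Ut.subtype).smulRight (b i)
  have hτ : ∀ y, τ y = ∑ j, ∑ i, t i j • S.form (b j) y • b i := by
    intro y
    simp [τ, LinearMap.sum_apply]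
  have hτf : ∀ (y : S.Ut) (z : V), S.form (τ y) z =
      ∑ j, ∑ i, t i j * (S.form (b j) y * S.form (b i) z) := by
    intro y z
    rw [hτ]
    simp [LinearMap.sum_apply]
  refine ⟨τ, fun y z => ?_, fun y hy => ?_⟩
  · rw [hτf, hτf, Finset.sum_comm, ← Finset.sum_neg_distrib]
    refine Finset.sum_congr rfl fun i _ => ?_
    rw [← Finset.sum_neg_distrib]
    refine Finset.sum_congr rfl fun j _ => ?_
    rw [ht]
    ring
  · have hc' : ∀ i j, S.form (τ (c' j)) (c i) = t i j := by
      intro i j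
      rw [hτf, Finset.sum_eq_single j, Finset.sum_eq_single i]
      · simp [c', hbc]
      · intro k _ hk
        simp [hbc, hk]
      · simp
      · intro k _ hk
        simp [c', hbc, hk]
      · simp
    have hint : ∀ i j, ∃ m : ℤ, S.form (σ (c' j) + τ (c' j) : S.U) (c i) = m := by
      intro i j
      have h : S.form (σ (c' j) + τ (c' j) : S.U) (c i) = S.form (σ (c' j)) (c i) + t i j := by
        rw [← hc']
        simp
      have h2 := hs (c' i) (c' j)
      change S.form (σ (c' i)) (c j) = S.form (σ (c' j)) (c i) at h2
      obtain ⟨m1, hm1⟩ := hd (c' i) (hc i)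
      obtain ⟨m2, hm2⟩ := hd (c' j) (hc j)
      obtain ⟨m3, hm3⟩ := hd (c' i + c' j) (add_mem (hc i) (hc j))
      change S.form (σ (c' i)) (c i) = _ at hm1
      change S.form (σ (c' j)) (c j) = _ at hm2
      rw [map_add] at hm3
      change S.form (σ (c' i) + σ (c' j) : V) (c i + c j) = _ at hm3
      simp only [map_add, LinearMap.add_apply] at hm3
      rw [h]
      rcases lt_trichotomy i j with hij | rfl | hij
      · refine ⟨m3 - m1 - m2, ?_⟩
        simp only [t, hij, if_true]
        push_cast
        linarith
      · exact ⟨m1, by simp [t, hm1]⟩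
      · exact ⟨0, by simp [t, hij, hij.not_gt]⟩
    have hI : ∀ j, σ (c' j) + τ (c' j) ∈ S.I := by
      intro j
      rw [hU (σ (c' j) + τ (c' j))]
      refine AddSubgroup.sum_mem _ fun i _ => ?_
      obtain ⟨m, hm⟩ := hint i j
      rw [hm, Int.cast_smul_eq_zsmul]
      exact AddSubgroup.zsmul_mem _ (hb i) _
    have hy' : y = ∑ i, S.form (b i) y • c' i := by
      apply Subtype.ext
      simpa [c'] using hUt y y.2
    rw [← LinearMap.add_apply, hy', map_sum]
    refine AddSubgroup.sum_mem _ fun i _ => ?_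
    obtain ⟨m, hm⟩ := S.form_integral_of_mem_I (hb i) hy
    rw [map_smul, hm, Int.cast_smul_eq_zsmul]
    exact AddSubgroup.zsmul_mem _ (hI i) _

/-- The prescribed part of `κ̃` is a symmetric map `σ` plus the antisymmetric map `M α - α M*`. As
`η` is an arbitrary antisymmetric map, it suffices to make `σ` integral modulo antisymmetric maps,
that is, to show that `(σ y, y)` is integral on `Ĩ`. -/
theorem exists_condEta [FiniteDimensional ℚ V] (M : S.U ≃ₗ[ℚ] S.U) (hM : M ∈ S.SLI)
    (ψ : S.W →ₗ[ℚ] S.U) (hψ : S.CondPsi M hM ψ) : ∃ η : homAs S.U, S.CondEta M ψ η := by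
  obtain ⟨-, hψ⟩ := (S.condPsi_iff M hM ψ).1 hψ
  let σ : S.Ut →ₗ[ℚ] S.U :=
    (LinearMap.id - M.toLinearMap) ∘ₗ S.alpha ∘ₗ (LinearMap.id - (S.mStarTilde M).toLinearMap)
      - (1 / 2 : ℚ) • (S.psiTilde ψ ∘ₗ S.psiStarTilde ψ)
  have hσ : ∀ y z : S.Ut, S.form (σ y) z =
      1 / 2 * S.form (y - S.mStarTilde M y : S.Ut) (z - S.mStarTilde M z : S.Ut)
        - 1 / 2 * S.form (S.psiStarTilde ψ y) (S.psiStarTilde ψ z) := by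
    intro y z
    rw [← form_alpha]
    have h := S.form_mStarTilde M z (S.alpha (y - S.mStarTilde M y))
    have h' := S.form_psiStarTilde ψ y (S.psiStarTilde ψ z)
    have h'' := S.form_psiStarTilde ψ z (S.psiStarTilde ψ y)
    have c := S.form_comm (S.psiStarTilde ψ y) (S.psiStarTilde ψ z)
    have e : σ y = S.alpha (y - S.mStarTilde M y) - M (S.alpha (y - S.mStarTilde M y)) -
      (1 / 2 : ℚ) • S.psiTilde ψ (S.psiStarTilde ψ y) := rfl
    rw [e]
    simp only [Submodule.coe_sub, Submodule.coe_smul, map_sub, map_smul, LinearMap.sub_apply,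
      LinearMap.smul_apply, smul_eq_mul] at h ⊢
    linarith
  have hd : ∀ y : S.Ut, (y : V) ∈ S.It → ∃ m : ℤ, S.form (σ y) y = m := by
    intro y hy
    -- This vector is `A (M* y) - M* y` with the `κ̃` term removed. Its pairing with `L*` is
    -- integral by the condition on `ψ`, so it lies in `L`; its norm is `-2(σ y, y)`, and evenness
    -- of `L` gives the diagonal.
    have hx : (((-2 : ℚ) • S.alpha (y - S.mStarTilde M y) : S.U) : V) + S.psiStarTilde ψ y +
        ((y - S.mStarTilde M y : S.Ut) : V) ∈ S.L := by
      refine S.mem_L_of_integral fun v hv => ?_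
      obtain ⟨u', w', y', rfl⟩ := S.exists_decomp v
      obtain ⟨hy', huw'⟩ := S.mem_It_and_add_mem_Ldual hv
      obtain ⟨m, hm⟩ := S.form_integral_of_mem_I (hψ u' w' huw') hy
      refine ⟨m, ?_⟩
      rw [← hm, form_add_add, ← form_psiStarTilde]
      have h1 := S.form_alpha (y - S.mStarTilde M y) y'
      have h2 := S.form_mStarTilde M y u'
      simp only [Submodule.coe_add, Submodule.coe_sub, Submodule.coe_smul, map_add, map_sub,
        map_smul, LinearMap.add_apply, LinearMap.sub_apply, LinearMap.smul_apply,
        smul_eq_mul] at h1 ⊢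
      linarith
    obtain ⟨m, hm⟩ := S.even _ hx
    refine ⟨-m, ?_⟩
    rw [form_add_add, Submodule.coe_smul, map_smul, LinearMap.smul_apply, form_alpha,
      smul_eq_mul] at hm
    rw [hσ, Int.cast_neg]
    linarith
  obtain ⟨τ, hτ, hτI⟩ := S.exists_antisymm_add_mem_I (σ := σ) (fun y z => by
    rw [hσ, hσ, S.form_comm, S.form_comm (S.psiStarTilde ψ y : V)]) hd
  let θ : S.Ut →ₗ[ℚ] S.U :=
    M.toLinearMap ∘ₗ S.alpha - S.alpha ∘ₗ (S.mStarTilde M).toLinearMap - τ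
  have hθ : ∀ y z : S.Ut, S.form (θ y) z = -S.form (θ z) y := by
    intro y z
    have h1 := S.form_mStarTilde M z (S.alpha y)
    have h2 := S.form_mStarTilde M y (S.alpha z)
    rw [form_alpha, S.form_comm] at h1 h2
    have h3 := S.form_alpha (S.mStarTilde M z) y
    have h4 := S.form_alpha (S.mStarTilde M y) z
    have h5 := hτ y z
    have e : ∀ y, θ y = M (S.alpha y) - S.alpha (S.mStarTilde M y) - τ y := fun _ => rfl
    rw [e, e]
    simp only [Submodule.coe_sub, map_sub, LinearMap.sub_apply]
    linarith
  let η : homAs S.U := ⟨θ ∘ₗ S.utIso.symm.toLinearMap, by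
    intro f g
    obtain ⟨z, rfl⟩ := S.utIso.surjective f
    obtain ⟨z', rfl⟩ := S.utIso.surjective g
    simp only [LinearMap.comp_apply, LinearEquiv.coe_coe, LinearEquiv.symm_apply_apply,
      utIso_apply]
    rw [S.form_comm, hθ, S.form_comm]⟩
  refine ⟨η, (S.condEta_iff M ψ η).2 fun y hy => ?_⟩
  have hη : S.etaTilde η y = M (S.alpha y) - S.alpha (S.mStarTilde M y) - τ y := by
    simp [etaTilde, η, θ]
  have : S.kappaTilde M ψ η y = σ y + τ y := by
    simp only [kappaTilde, LinearMap.sub_apply, LinearMap.add_apply, hη, σ]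
    simp only [LinearMap.comp_apply, LinearMap.sub_apply, LinearEquiv.coe_coe]
    abel
  rw [this]
  exact hτI y hy

/-- `kappaTilde` is affine in `η` with linear part `-η̃`, so two solutions differ by an integral
map, and antisymmetry is automatic. -/
theorem condEta_iff_sub_mem [FiniteDimensional ℚ V] {M : S.U ≃ₗ[ℚ] S.U} {ψ : S.W →ₗ[ℚ] S.U}
    {η : homAs S.U} (h : S.CondEta M ψ η) (η' : homAs S.U) :
    S.CondEta M ψ η' ↔ ((η' : Module.Dual ℚ S.U →ₗ[ℚ] S.U) - η) ∈ homAsDual S.I := by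
  have h1 : ((η' : Module.Dual ℚ S.U →ₗ[ℚ] S.U) - η) ∈ homAsDual S.I ↔
      ((η' : Module.Dual ℚ S.U →ₗ[ℚ] S.U) - η) ∈ homDual S.I :=
    ⟨fun h => h.2, fun h => ⟨(homAs S.U).sub_mem η'.2 η.2, h⟩⟩
  rw [h1, mem_homDual_iff, condEta_iff]
  refine forall₂_congr fun y hy => ?_
  have h2 : S.kappaTilde M ψ η' y = S.kappaTilde M ψ η y -
      S.etaTilde ((η' : Module.Dual ℚ S.U →ₗ[ℚ] S.U) - η) y := by
    simp only [kappaTilde, etaTilde, LinearMap.sub_apply, LinearMap.comp_apply]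
    abel
  rw [h2]
  exact ⟨fun h' => by
    simpa using sub_mem ((S.condEta_iff M ψ η).1 h y hy) h',
    fun h' => sub_mem ((S.condEta_iff M ψ η).1 h y hy) h'⟩

end IsotropicDatum


/-! ### Generation of the special linear group by unipotent elements -/

/-- Whitehead's identity `diag(a, a⁻¹) = w(a) w(-1)` with `w(a) = e₁₂(a) e₂₁(-a⁻¹) e₁₂(a)`. -/
theorem Matrix.SpecialLinearGroup.diag2n_eq_prod_transvection {ι F : Type*} [Fintype ι]
    [DecidableEq ι] [Field F] {i j : ι} (hij : i ≠ j) (a : F) (ha : a ≠ 0) :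
    diag2n hij a ha = transvection hij a * transvection hij.symm (-a⁻¹) * transvection hij a *
      (transvection hij (-1) * transvection hij.symm 1 * transvection hij (-1)) := by
  have key : ∀ {i j : ι} (hij : i ≠ j) (b : F) (v : ι → F),
      (transvection hij b).1.mulVec v = v + Pi.single i (b * v j) := by
    intro i j hij b v
    rw [transvection_coe, Matrix.add_mulVec, Matrix.one_mulVec, Matrix.single_mulVec_eq]
    congr 1
    ext k
    simp [Pi.single_apply]
  refine Subtype.ext (Matrix.toLin'.injective (LinearMap.ext fun v => ?_))
  simp only [coe_mul, Matrix.toLin'_apply, ← Matrix.mulVec_mulVec, key, diag2n_coe]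
  ext k
  rw [Matrix.mulVec_diagonal]
  by_cases h1 : k = i
  · subst h1
    simp [hij, hij.symm]
    field_simp
    ring
  · by_cases h2 : k = j
    · subst h2
      simp [hij, hij.symm]
      field_simp
      ring
    · simp [h1, h2]

/-- The special linear group is generated by transvections, and a transvection `T` satisfies `(T -
1)² = 0`. -/
theorem LinearEquiv.induction_of_det_eq_one {K E : Type*} [Field K] [AddCommGroup E] [Module K E]
    [FiniteDimensional K E] {P : (E ≃ₗ[K] E) → Prop} (one : P 1)
    (mul : ∀ A A', P A → P A' → P (A * A'))
    (unipotent : ∀ A : E ≃ₗ[K] E, (∀ x, A (A x) - (2 : K) • A x + x = 0) → P A)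
    (A : E ≃ₗ[K] E) (hA : LinearMap.det (A : E →ₗ[K] E) = 1) : P A := by
  let b := Module.finBasis K E
  let e := Matrix.SpecialLinearGroup.toLin_equiv b
  let A' : SpecialLinearGroup K E := ⟨A, by
    rw [← Units.val_inj, LinearEquiv.coe_det, hA, Units.val_one]⟩
  have key : ∀ g, P (e g : SpecialLinearGroup K E).1 := by
    rcases subsingleton_or_nontrivial (Fin (Module.finrank K E)) with h | h
    · intro g
      rw [Subsingleton.elim g 1, map_one]
      exact one
    · have htr : ∀ (i j : Fin (Module.finrank K E)) (hij : i ≠ j) (a : K),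
          P (e (Matrix.SpecialLinearGroup.transvection hij a)).1 := by
        intro i j hij a
        refine unipotent _ fun x => ?_
        have h1 : ∀ x, (e (Matrix.SpecialLinearGroup.transvection hij a)).1 x =
            x + (a * b.repr x j) • b i := by
          intro x
          change Matrix.toLin b b (Matrix.SpecialLinearGroup.transvection hij a).1 x = _
          rw [Matrix.SpecialLinearGroup.transvection_coe, map_add, Matrix.toLin_one,
            LinearMap.add_apply, LinearMap.id_apply, Matrix.toLin_apply,
            Finset.sum_eq_single i]
          · rw [Matrix.single_mulVec_eq]
            simp
          · intro k _ hk
            rw [Matrix.single_mulVec_eq]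
            simp [hk]
          · simp
        rw [h1, h1]
        simp only [map_add, map_smul, Finsupp.add_apply, Finsupp.smul_apply, b.repr_self,
          Finsupp.single_apply, if_neg hij, smul_zero, add_zero]
        module
      have hmul : ∀ g g', P (e g).1 → P (e g').1 → P (e (g * g')).1 := by
        intro g g' h h'
        rw [map_mul]
        exact mul _ _ h h'
      intro g
      refine Matrix.SpecialLinearGroup.diagonal_transvection_induction'
        (fun g => P (e g).1) g (fun i j hij c hc => ?_) htr hmul
      rw [Matrix.SpecialLinearGroup.diag2n_eq_prod_transvection]
      exact hmul _ _ (hmul _ _ (hmul _ _ (htr _ _ _ _) (htr _ _ _ _)) (htr _ _ _ _))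
        (hmul _ _ (hmul _ _ (htr _ _ _ _) (htr _ _ _ _)) (htr _ _ _ _))
  have := key (e.symm A')
  rw [e.apply_symm_apply] at this
  exact this

/-! ### The identity component -/

section identityComponent

variable {E F : Type*} [AddCommGroup E] [Module ℝ E] [AddCommGroup F] [Module ℝ F]

theorem identityComponent_subset (G : Subgroup (E ≃ₗ[ℝ] E)) {A : E ≃ₗ[ℝ] E}
    (hA : A ∈ identityComponent G) : A ∈ G :=
  @connectedComponentIn_subset _ (generalLinearTopology E) _ _ A hA

theorem one_mem_identityComponent (G : Subgroup (E ≃ₗ[ℝ] E)) : 1 ∈ identityComponent G :=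
  @mem_connectedComponentIn _ (generalLinearTopology E) _ _ G.one_mem

theorem identityComponent_mono {G H : Subgroup (E ≃ₗ[ℝ] E)} (h : G ≤ H) :
    identityComponent G ⊆ identityComponent H :=
  @connectedComponentIn_mono _ (generalLinearTopology E) _ _ _ h

theorem mem_identityComponent_of_continuous {G : Subgroup (E ≃ₗ[ℝ] E)} (f : ℝ → E ≃ₗ[ℝ] E)
    (hf : @Continuous _ _ _ (moduleTopology ℝ (E →ₗ[ℝ] E)) fun t => (f t : E →ₗ[ℝ] E))
    (hG : ∀ t, f t ∈ G) (h0 : f 0 = 1) (t : ℝ) : f t ∈ identityComponent G := by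
  let := generalLinearTopology E
  let := moduleTopology ℝ (E →ₗ[ℝ] E)
  have hc : Continuous f := continuous_induced_rng.2 hf
  have h1 : IsPreconnected (Set.range f) := isPreconnected_range hc
  refine h1.subset_connectedComponentIn ⟨0, h0⟩ ?_ ⟨t, rfl⟩
  rintro _ ⟨t, rfl⟩
  exact hG t

/-- An affine formula for `φ` makes it continuous, and continuous images of connected sets are
connected; multiplicativity is not needed. The constant `c` is there for the lift from the Levi
quotient, which is the identity off `F`. -/
theorem map_mem_identityComponent {G : Subgroup (E ≃ₗ[ℝ] E)} {H : Subgroup (F ≃ₗ[ℝ] F)}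
    (φ : G → F ≃ₗ[ℝ] F) (hφ : ∀ A, φ A ∈ H) (h1 : φ 1 = 1) (T : (E →ₗ[ℝ] E) →ₗ[ℝ] F →ₗ[ℝ] F)
    (c : F →ₗ[ℝ] F)
    (hT : ∀ A : G, (φ A : F →ₗ[ℝ] F) = T (A : E ≃ₗ[ℝ] E) + c) {A : G}
    (hA : (A : E ≃ₗ[ℝ] E) ∈ identityComponent G) : φ A ∈ identityComponent H := by
  let tE := generalLinearTopology E
  let tF := generalLinearTopology F
  let tE' : TopologicalSpace (E →ₗ[ℝ] E) := moduleTopology ℝ (E →ₗ[ℝ] E)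
  let tF' : TopologicalSpace (F →ₗ[ℝ] F) := moduleTopology ℝ (F →ₗ[ℝ] F)
  have : IsModuleTopology ℝ (E →ₗ[ℝ] E) := ⟨rfl⟩
  have : IsModuleTopology ℝ (F →ₗ[ℝ] F) := ⟨rfl⟩
  have := IsModuleTopology.toContinuousAdd ℝ (F →ₗ[ℝ] F)
  have hT' : Continuous T := IsModuleTopology.continuous_of_linearMap T
  have hcoe : Continuous fun A : E ≃ₗ[ℝ] E => (A : E →ₗ[ℝ] E) := continuous_induced_dom
  have hc : Continuous φ := by
    refine continuous_induced_rng.2 ?_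
    have : (fun A : F ≃ₗ[ℝ] F => (A : F →ₗ[ℝ] F)) ∘ φ = fun A : G => T (A : E ≃ₗ[ℝ] E) + c :=
      funext hT
    rw [this]
    exact ((hT'.comp hcoe).comp continuous_subtype_val).add continuous_const
  have hG : identityComponent G = (Subtype.val : G → _) '' connectedComponent (1 : G) :=
    connectedComponentIn_eq_image G.one_mem
  rw [hG] at hA
  obtain ⟨A', hA', hAA⟩ := hA
  obtain rfl := Subtype.ext hAA
  have h2 : IsPreconnected (φ '' connectedComponent (1 : G)) :=
    isPreconnected_connectedComponent.image _ hc.continuousOn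
  refine h2.subset_connectedComponentIn ⟨1, mem_connectedComponent, h1⟩ ?_ ⟨_, hA', rfl⟩
  rintro _ ⟨B, -, rfl⟩
  exact hφ B

theorem mul_mem_identityComponent {G : Subgroup (E ≃ₗ[ℝ] E)} {A A' : E ≃ₗ[ℝ] E}
    (hA : A ∈ identityComponent G) (hA' : A' ∈ identityComponent G) :
    A * A' ∈ identityComponent G := by
  let := generalLinearTopology E
  let : TopologicalSpace (E →ₗ[ℝ] E) := moduleTopology ℝ (E →ₗ[ℝ] E)
  have : IsModuleTopology ℝ (E →ₗ[ℝ] E) := ⟨rfl⟩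
  have := IsModuleTopology.toContinuousAdd ℝ (E →ₗ[ℝ] E)
  have hcoe : Continuous fun A : E ≃ₗ[ℝ] E => (A : E →ₗ[ℝ] E) := continuous_induced_dom
  have hc : Continuous fun X : E ≃ₗ[ℝ] E => A * X := by
    refine continuous_induced_rng.2 ?_
    exact (IsModuleTopology.continuous_of_linearMap
      (LinearMap.mulLeft ℝ (A : Module.End ℝ E))).comp hcoe
  have h2 : IsPreconnected ((fun X => A * X) '' identityComponent G) :=
    isPreconnected_connectedComponentIn.image _ hc.continuousOn
  have h3 : (fun X => A * X) '' identityComponent G ⊆ connectedComponentIn (G : Set _) A := by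
    refine h2.subset_connectedComponentIn ⟨1, one_mem_identityComponent G, mul_one A⟩ ?_
    rintro _ ⟨X, hX, rfl⟩
    -- Left translation by `A` carries the component of 1 into that of `A`, and these coincide since
    -- `A` is in the former.
    exact G.mul_mem (identityComponent_subset G hA) (identityComponent_subset G hX)
  have h4 : identityComponent G = connectedComponentIn (G : Set _) A := connectedComponentIn_eq hA
  rw [h4]
  exact h3 ⟨A', hA', rfl⟩

theorem continuous_linearMap_det [FiniteDimensional ℝ F] :
    @Continuous _ _ (moduleTopology ℝ (F →ₗ[ℝ] F)) _
      fun f : F →ₗ[ℝ] F => LinearMap.det f := by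
  let : TopologicalSpace (F →ₗ[ℝ] F) := moduleTopology ℝ (F →ₗ[ℝ] F)
  have : IsModuleTopology ℝ (F →ₗ[ℝ] F) := ⟨rfl⟩
  let b := Module.finBasis ℝ F
  have h1 : Continuous (LinearMap.toMatrix b b) :=
    IsModuleTopology.continuous_of_linearMap (LinearMap.toMatrix b b).toLinearMap
  have h2 : (fun f : F →ₗ[ℝ] F => LinearMap.det f) = fun f => (LinearMap.toMatrix b b f).det :=
    funext fun f => (LinearMap.det_toMatrix b f).symm
  rw [h2]
  exact h1.matrix_det

/-- By the intermediate value theorem, a continuous function that is 1 at the identity and never 0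
stays positive on a connected set. -/
theorem det_pos_of_mem_identityComponent [FiniteDimensional ℝ F] {G : Subgroup (E ≃ₗ[ℝ] E)}
    (T : (E →ₗ[ℝ] E) →ₗ[ℝ] F →ₗ[ℝ] F) (h1 : T LinearMap.id = LinearMap.id)
    (hT : ∀ A ∈ G, LinearMap.det (T (A : E ≃ₗ[ℝ] E)) ≠ 0) {A : E ≃ₗ[ℝ] E}
    (hA : A ∈ identityComponent G) : 0 < LinearMap.det (T (A : E ≃ₗ[ℝ] E)) := by
  let := generalLinearTopology E
  let tE' : TopologicalSpace (E →ₗ[ℝ] E) := moduleTopology ℝ (E →ₗ[ℝ] E)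
  let tF' : TopologicalSpace (F →ₗ[ℝ] F) := moduleTopology ℝ (F →ₗ[ℝ] F)
  have : IsModuleTopology ℝ (E →ₗ[ℝ] E) := ⟨rfl⟩
  have : IsModuleTopology ℝ (F →ₗ[ℝ] F) := ⟨rfl⟩
  have := IsModuleTopology.toContinuousAdd ℝ (F →ₗ[ℝ] F)
  have hT' : Continuous T := IsModuleTopology.continuous_of_linearMap T
  have hcoe : Continuous fun A : E ≃ₗ[ℝ] E => (A : E →ₗ[ℝ] E) := continuous_induced_dom
  have hc : Continuous fun A : E ≃ₗ[ℝ] E => LinearMap.det (T (A : E ≃ₗ[ℝ] E)) :=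
    continuous_linearMap_det.comp (hT'.comp hcoe)
  by_contra hneg
  have h2 : IsPreconnected ((fun A : E ≃ₗ[ℝ] E => LinearMap.det (T (A : E ≃ₗ[ℝ] E))) ''
      identityComponent G) :=
    isPreconnected_connectedComponentIn.image _ hc.continuousOn
  have h3 : (1 : ℝ) ∈ (fun A : E ≃ₗ[ℝ] E => LinearMap.det (T (A : E ≃ₗ[ℝ] E))) ''
      identityComponent G :=
    ⟨1, one_mem_identityComponent G, by
      change LinearMap.det (T LinearMap.id) = 1
      rw [h1, LinearMap.det_id]⟩
  obtain ⟨A', hA', h0⟩ := h2.Icc_subset ⟨A, hA, rfl⟩ h3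
    (show (0 : ℝ) ∈ Set.Icc _ _ from ⟨not_lt.1 hneg, zero_le_one⟩)
  exact hT A' (identityComponent_subset G hA') h0

end identityComponent


/-! ### The Cayley transform of unipotent elements -/

section cayley

/-- The Cayley transform `(1 + x) / (1 - x)` of an element with `x ^ n = 0`. -/
def nilpotentCayley {R : Type*} [Ring R] (n : ℕ) (x : R) : R :=
  (1 + x) * ∑ k ∈ Finset.range n, x ^ k

theorem nilpotentCayley_mul_one_sub {R : Type*} [Ring R] {n : ℕ} {x : R} (hx : x ^ n = 0) :
    nilpotentCayley n x * (1 - x) = 1 + x := by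
  rw [nilpotentCayley, mul_assoc, geom_sum_mul_neg, hx, sub_zero, mul_one]

theorem nilpotentCayley_mul_neg {R : Type*} [Ring R] {n : ℕ} {x : R} (hx : x ^ n = 0) :
    nilpotentCayley n x * nilpotentCayley n (-x) = 1 := by
  have h1 : (∑ k ∈ Finset.range n, x ^ k) * (1 - x) = 1 := by
    rw [geom_sum_mul_neg, hx, sub_zero]
  have h2 : (1 - -x) * (∑ k ∈ Finset.range n, (-x) ^ k) = 1 := by
    rw [mul_neg_geom_sum, neg_pow, hx, mul_zero, sub_zero]
  rw [sub_neg_eq_add] at h2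
  calc _ = (1 + x) * (((∑ k ∈ Finset.range n, x ^ k) * (1 - x)) *
        ∑ k ∈ Finset.range n, (-x) ^ k) := by
        simp only [nilpotentCayley, sub_eq_add_neg, mul_assoc]
    _ = 1 := by rw [h1, one_mul, h2]

variable {K E : Type*} [Field K] [AddCommGroup E] [Module K E]

/-- As `1 - x` is onto, it suffices to compare `(a + x a, b + x b)` with `(a - x a, b - x b)`; the
cross terms vanish by skewness. -/
theorem nilpotentCayley_form {B : LinearMap.BilinForm K E} {n : ℕ} {x : Module.End K E}
    (hx : x ^ n = 0) (hskew : ∀ a b, B (x a) b = -B a (x b)) (a b : E) :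
    B (nilpotentCayley n x a) (nilpotentCayley n x b) = B a b := by
  have h1 : (1 - x) * (∑ k ∈ Finset.range n, x ^ k) = 1 := by
    rw [mul_neg_geom_sum, hx, sub_zero]
  have h2 : ∀ a, ∃ a', a = a' - x a' := fun a =>
    ⟨(∑ k ∈ Finset.range n, x ^ k) a, (LinearMap.congr_fun h1 a).symm⟩
  have h3 : ∀ a, nilpotentCayley n x (a - x a) = a + x a := fun a =>
    LinearMap.congr_fun (nilpotentCayley_mul_one_sub hx) a
  obtain ⟨a, rfl⟩ := h2 a
  obtain ⟨b, rfl⟩ := h2 b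
  rw [h3, h3]
  simp only [map_add, map_sub, LinearMap.add_apply, LinearMap.sub_apply, hskew a b]
  ring

theorem nilpotentCayley_mem {n : ℕ} {x : Module.End K E} {X : Submodule K E}
    (hX : ∀ a ∈ X, x a ∈ X) {a : E} (ha : a ∈ X) : nilpotentCayley n x a ∈ X := by
  have h1 : ∀ k : ℕ, (x ^ k) a ∈ X := by
    intro k
    induction k with
    | zero => exact ha
    | succ k ih =>
      rw [pow_succ']
      exact hX _ ih
  have h2 : (∑ k ∈ Finset.range n, x ^ k) a ∈ X := by
    rw [LinearMap.sum_apply]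
    exact sum_mem fun k _ => h1 k
  exact add_mem h2 (hX _ h2)

/-- The Cayley transform of a nilpotent skew map, as an automorphism. -/
def cayleyEquiv {n : ℕ} {x : Module.End K E} (hx : x ^ n = 0) : E ≃ₗ[K] E :=
  LinearEquiv.ofLinearMap (nilpotentCayley n x) (nilpotentCayley n (-x))
    (nilpotentCayley_mul_neg hx)
    (by
      have : (-x) ^ n = 0 := by rw [neg_pow, hx, mul_zero]
      have := nilpotentCayley_mul_neg this
      rw [neg_neg] at this
      exact this)

theorem cayleyEquiv_mem {B : LinearMap.BilinForm K E} {X : Submodule K E} {n : ℕ}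
    {x : Module.End K E} (hx : x ^ n = 0) (hskew : ∀ a b, B (x a) b = -B a (x b))
    (hX : ∀ a ∈ X, x a ∈ X) : cayleyEquiv hx ∈ bilinParabolic B X := by
  refine ⟨nilpotentCayley_form hx hskew, fun a => ⟨fun ha => ?_, nilpotentCayley_mem hX⟩⟩
  have h1 := nilpotentCayley_mem (n := n) (x := -x) (fun a ha => neg_mem (hX a ha)) ha
  have h2 := (cayleyEquiv hx).symm_apply_apply a
  exact h2 ▸ h1

/-- A unipotent element of a parabolic subgroup is the Cayley transform of a nilpotent skew map. -/
theorem exists_eq_nilpotentCayley [CharZero K] {B : LinearMap.BilinForm K E} {X : Submodule K E}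
    {A : E ≃ₗ[K] E} (hA : A ∈ bilinParabolic B X) {n : ℕ}
    (hn : ((A : Module.End K E) - 1) ^ n = 0) :
    ∃ x : Module.End K E, x ^ n = 0 ∧ (∀ a b, B (x a) b = -B a (x b)) ∧
      (∀ a ∈ X, x a ∈ X) ∧ (A : Module.End K E) = nilpotentCayley n x := by
  -- Inverse Cayley transform: with `Q = (1 + Y)⁻¹`, a finite geometric sum, `Y * Q` is `(A - 1)(A +
  -- 1)⁻¹`.
  let Y : Module.End K E := (1 / 2 : K) • ((A : Module.End K E) - 1)
  let Q : Module.End K E := ∑ k ∈ Finset.range n, (-Y) ^ k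
  have hY : Y ^ n = 0 := by rw [smul_pow, hn, smul_zero]
  have hY' : (-Y) ^ n = 0 := by rw [neg_pow, hY, mul_zero]
  have hQ1 : Q * (1 + Y) = 1 := by
    have := geom_sum_mul_neg (-Y) n
    rwa [hY', sub_zero, sub_neg_eq_add] at this
  have hQ2 : (1 + Y) * Q = 1 := by
    have := mul_neg_geom_sum (-Y) n
    rwa [hY', sub_zero, sub_neg_eq_add] at this
  have hc : Commute Y Q := Commute.sum_right _ _ _ fun k _ =>
    ((Commute.refl Y).neg_right).pow_right k
  have hAY : (A : Module.End K E) = 1 + (2 : K) • Y := by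
    simp only [Y, smul_smul]
    norm_num
  have hxn : (Y * Q) ^ n = 0 := by rw [hc.mul_pow, hY, zero_mul]
  have hYA : ∀ a, A a = a + (2 : K) • Y a := fun a => LinearMap.congr_fun hAY a
  have hxa : ∀ a, (Y * Q) (a + Y a) = Y a := fun a =>
    congrArg Y (LinearMap.congr_fun hQ1 a)
  have hQa : ∀ a, ∃ a', a = a' + Y a' := fun a => ⟨Q a, (LinearMap.congr_fun hQ2 a).symm⟩
  have hYX : ∀ a ∈ X, Y a ∈ X := fun a ha =>
    X.smul_mem _ (X.sub_mem ((hA.2 a).2 ha) ha)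
  refine ⟨Y * Q, hxn, fun a b => ?_, fun a ha => ?_, ?_⟩
  · obtain ⟨a, rfl⟩ := hQa a
    obtain ⟨b, rfl⟩ := hQa b
    rw [hxa, hxa]
    have h := hA.1 a b
    rw [hYA, hYA] at h
    simp only [map_add, map_smul, LinearMap.add_apply, LinearMap.smul_apply, smul_eq_mul] at h ⊢
    linear_combination (1 / 2 : K) * h
  · have hk : ∀ k : ℕ, ((-Y) ^ k) a ∈ X := by
      intro k
      induction k with
      | zero => exact ha
      | succ k ih =>
        rw [pow_succ']
        exact neg_mem (hYX _ ih)
    refine hYX _ ?_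
    rw [LinearMap.sum_apply]
    exact sum_mem fun k _ => hk k
  · have h1 : (1 - Y * Q) * (∑ k ∈ Finset.range n, (Y * Q) ^ k) = 1 := by
      rw [mul_neg_geom_sum, hxn, sub_zero]
    have h2 : 1 + Y * Q = (A : Module.End K E) * (1 - Y * Q) := by
      have h3 : 1 - Y * Q = Q := by
        rw [sub_eq_iff_eq_add, ← hQ2, add_mul, one_mul]
      have h4 : Q + Y * Q = 1 := by rw [← hQ2, add_mul, one_mul]
      rw [h3, hAY, add_mul, one_mul, two_smul, add_mul, ← add_assoc, h4]
    rw [nilpotentCayley, h2, mul_assoc, h1, mul_one]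

/-- Unipotent elements of a real parabolic subgroup lie in its identity component. -/
theorem mem_identityComponent_of_unipotent {E : Type*} [AddCommGroup E] [Module ℝ E]
    {B : LinearMap.BilinForm ℝ E} {X : Submodule ℝ E}
    {A : E ≃ₗ[ℝ] E} (hA : A ∈ bilinParabolic B X) {n : ℕ}
    (hn : ((A : Module.End ℝ E) - 1) ^ n = 0) : A ∈ identityComponent (bilinParabolic B X) := by
  obtain ⟨x, hx, hskew, hX, hAx⟩ := exists_eq_nilpotentCayley hA hn
  have ht : ∀ t : ℝ, (t • x) ^ n = 0 := fun t => by rw [smul_pow, hx, smul_zero]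
  -- The path from 1 to `A`. Being skew and preserving `X` are linear conditions on `x`, so each `t
  -- • x` satisfies them and the path stays in the parabolic subgroup.
  let f : ℝ → E ≃ₗ[ℝ] E := fun t => cayleyEquiv (ht t)
  have hf1 : f 1 = A := by
    refine LinearEquiv.toLinearMap_injective ?_
    change nilpotentCayley n ((1 : ℝ) • x) = _
    rw [one_smul, hAx]
  rw [← hf1]
  refine mem_identityComponent_of_continuous f ?_ (fun t => ?_) ?_ 1
  · let : TopologicalSpace (E →ₗ[ℝ] E) := moduleTopology ℝ (E →ₗ[ℝ] E)
    have : IsModuleTopology ℝ (E →ₗ[ℝ] E) := ⟨rfl⟩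
    have := IsModuleTopology.toContinuousAdd ℝ (E →ₗ[ℝ] E)
    have := IsModuleTopology.toContinuousSMul ℝ (E →ₗ[ℝ] E)
    have h : (fun t => (f t : E →ₗ[ℝ] E)) = fun t : ℝ =>
        ∑ k ∈ Finset.range n, (t ^ k • x ^ k + t ^ (k + 1) • x ^ (k + 1)) := by
      funext t
      change (1 + t • x) * ∑ k ∈ Finset.range n, (t • x) ^ k = _
      rw [Finset.mul_sum]
      refine Finset.sum_congr rfl fun k _ => ?_
      rw [add_mul, one_mul, ← pow_succ', smul_pow, smul_pow]
    rw [h]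
    refine continuous_finsetSum _ fun k _ => ?_
    exact ((continuous_pow k).smul continuous_const).add
      ((continuous_pow (k + 1)).smul continuous_const)
  · refine cayleyEquiv_mem (ht t) (fun a b => ?_) fun a ha => X.smul_mem _ (hX a ha)
    simp only [LinearMap.smul_apply, map_smul, hskew a b, smul_neg]
  · refine LinearEquiv.ext fun a => ?_
    have h2 := LinearMap.congr_fun (nilpotentCayley_mul_one_sub (ht 0)) a
    rw [zero_smul, sub_zero, add_zero, mul_one] at h2
    change nilpotentCayley n ((0 : ℝ) • x) a = a
    rw [zero_smul]
    exact h2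

end cayley

/-! ### Lifting from the Levi quotient -/

namespace IsLeviComplement

variable {K E F : Type*} [Field K] [AddCommGroup E] [Module K E] [AddCommGroup F] [Module K F]
  {B : LinearMap.BilinForm K E} {X : Submodule K E} {BF : LinearMap.BilinForm K F}
  {i : F →ₗ[K] E} {p : E →ₗ[K] F}

/-- The automorphism that acts as `γ` on `F` and trivially on its orthogonal complement. -/
def lift (h : IsLeviComplement B X BF i p) (γ : F ≃ₗ[K] F) : E ≃ₗ[K] E :=
  have key : ∀ γ γ' : F ≃ₗ[K] F, (∀ w, γ (γ' w) = w) →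
      (i ∘ₗ γ.toLinearMap ∘ₗ p + (LinearMap.id - i ∘ₗ p)) ∘ₗ
        (i ∘ₗ γ'.toLinearMap ∘ₗ p + (LinearMap.id - i ∘ₗ p)) = LinearMap.id := by
    intro γ γ' hγ
    ext x
    simp [h.proj_incl, hγ]
  LinearEquiv.ofLinearMap (i ∘ₗ γ.toLinearMap ∘ₗ p + (LinearMap.id - i ∘ₗ p))
    (i ∘ₗ γ.symm.toLinearMap ∘ₗ p + (LinearMap.id - i ∘ₗ p))
    (key γ γ.symm γ.apply_symm_apply) (key γ.symm γ γ.symm_apply_apply)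

theorem lift_coe (h : IsLeviComplement B X BF i p) (γ : F ≃ₗ[K] F) :
    (h.lift γ : E →ₗ[K] E) = i ∘ₗ γ.toLinearMap ∘ₗ p + (LinearMap.id - i ∘ₗ p) := rfl

theorem lift_apply (h : IsLeviComplement B X BF i p) (γ : F ≃ₗ[K] F) (x : E) :
    h.lift γ x = i (γ (p x)) + (x - i (p x)) := rfl

theorem lift_apply_of_mem (h : IsLeviComplement B X BF i p) (γ : F ≃ₗ[K] F) {x : E} (hx : x ∈ X) :
    h.lift γ x = x := by
  rw [lift_apply, h.proj_eq_zero x hx]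
  simp

theorem proj_lift_incl (h : IsLeviComplement B X BF i p) (γ : F ≃ₗ[K] F) (w : F) :
    p (h.lift γ (i w)) = γ w := by
  rw [lift_apply]
  simp [h.proj_incl]

theorem lift_mem (h : IsLeviComplement B X BF i p) {γ : F ≃ₗ[K] F}
    (hγ : γ ∈ bilinOrthogonalGroup BF) : h.lift γ ∈ bilinParabolic B X := by
  refine ⟨fun x y => ?_, fun x => ⟨fun hx => ?_, fun hx => ?_⟩⟩
  · rw [lift_apply, lift_apply]
    have h1 := hγ (p x) (p y)
    simp only [map_add, map_sub, LinearMap.add_apply, LinearMap.sub_apply, h.adjoint_left,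
      h.adjoint_right, h.proj_incl]
    rw [h1]
    ring
  · have h1 := h.lift_apply_of_mem γ hx
    rw [← (h.lift γ).injective h1]
    exact hx
  · rw [h.lift_apply_of_mem γ hx]
    exact hx

end IsLeviComplement


namespace IsLeviComplement

variable {E F : Type*} [AddCommGroup E] [Module ℝ E] [AddCommGroup F] [Module ℝ F]
  {B : LinearMap.BilinForm ℝ E} {X : Submodule ℝ E} {BF : LinearMap.BilinForm ℝ F}
  {i : F →ₗ[ℝ] E} {p : E →ₗ[ℝ] F}

theorem quot_mem_identityComponent (h : IsLeviComplement B X BF i p) {A : bilinParabolic B X}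
    (hA : (A : E ≃ₗ[ℝ] E) ∈ identityComponent (bilinParabolic B X)) :
    h.quot A ∈ identityComponent (bilinOrthogonalGroup BF) :=
  map_mem_identityComponent h.quot h.quot_mem (LinearEquiv.ext fun w => h.proj_incl w)
    ((LinearMap.llcomp ℝ F E F p) ∘ₗ (LinearMap.lcomp ℝ E i)) 0
    (fun A => by rw [add_zero]; rfl) hA

theorem lift_mem_identityComponent (h : IsLeviComplement B X BF i p) {γ : F ≃ₗ[ℝ] F}
    (hγ : γ ∈ identityComponent (bilinOrthogonalGroup BF)) :
    h.lift γ ∈ identityComponent (bilinParabolic B X) :=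
  map_mem_identityComponent (fun γ : bilinOrthogonalGroup BF => h.lift γ)
    (fun γ => h.lift_mem γ.2) (LinearEquiv.ext fun x => by
      rw [h.lift_apply]
      exact add_sub_cancel (i (p x)) x)
    ((LinearMap.llcomp ℝ E F E i) ∘ₗ (LinearMap.lcomp ℝ F p)) (LinearMap.id - i ∘ₗ p)
    (fun γ => h.lift_coe γ) (A := ⟨γ, identityComponent_subset _ hγ⟩) hγ

end IsLeviComplement

/-! ### Extension of scalars -/

theorem baseChange_mem_bilinParabolic {E : Type*} [AddCommGroup E] [Module ℚ E]
    {B : LinearMap.BilinForm ℚ E} {X : Submodule ℚ E} {A : E ≃ₗ[ℚ] E}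
    (hA : A ∈ bilinParabolic B X) :
    A.baseChange ℚ ℝ E E ∈
      bilinParabolic (LinearMap.BilinForm.baseChange ℝ B) (X.baseChange ℝ) := by
  have hO : ∀ x y : ℝ ⊗[ℚ] E, LinearMap.BilinForm.baseChange ℝ B (A.baseChange ℚ ℝ E E x)
      (A.baseChange ℚ ℝ E E y) = LinearMap.BilinForm.baseChange ℝ B x y := by
    intro x y
    induction x using TensorProduct.induction_on with
    | zero => simp
    | add x x' hx hx' => simp only [map_add, LinearMap.add_apply, hx, hx']
    | tmul a x =>
      induction y using TensorProduct.induction_on with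
      | zero => simp
      | add y y' hy hy' => simp only [map_add, hy, hy']
      | tmul b y => simp [hA.1 x y]
  have hX : ∀ {A : E ≃ₗ[ℚ] E}, A ∈ bilinParabolic B X → ∀ x ∈ X.baseChange ℝ,
      A.baseChange ℚ ℝ E E x ∈ X.baseChange ℝ := by
    rintro A hA _ ⟨x, rfl⟩
    induction x using TensorProduct.induction_on with
    | zero => simp
    | add x x' hx hx' =>
      rw [map_add, map_add]
      exact add_mem hx hx'
    | tmul a x =>
      rw [LinearMap.baseChange_tmul, LinearEquiv.baseChange_tmul]
      exact Submodule.tmul_mem_baseChange_of_mem _ ((hA.2 x).2 x.2)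
  refine ⟨hO, fun x => ⟨fun hx => ?_, hX hA x⟩⟩
  have h := hX (inv_mem hA) _ hx
  rw [LinearEquiv.baseChange_inv] at h
  have h2 : (A.baseChange ℚ ℝ E E)⁻¹ (A.baseChange ℚ ℝ E E x) = x :=
    (A.baseChange ℚ ℝ E E).symm_apply_apply x
  rwa [h2] at h

/-- All axioms but the last are linear identities and pass to pure tensors. The last concerns real
vectors orthogonal to `X`, which need not be visibly built from rational ones, so it is left as a
hypothesis. -/
theorem IsLeviComplement.baseChange {E F : Type*} [AddCommGroup E] [Module ℚ E]
    [AddCommGroup F] [Module ℚ F]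
    {B : LinearMap.BilinForm ℚ E} {X : Submodule ℚ E} {BF : LinearMap.BilinForm ℚ F}
    {i : F →ₗ[ℚ] E} {p : E →ₗ[ℚ] F} (h : IsLeviComplement B X BF i p)
    (hsub : ∀ x : ℝ ⊗[ℚ] E, (∀ u ∈ X.baseChange ℝ, LinearMap.BilinForm.baseChange ℝ B u x = 0) →
      x - i.baseChange ℝ (p.baseChange ℝ x) ∈ X.baseChange ℝ) :
    IsLeviComplement (LinearMap.BilinForm.baseChange ℝ B) (X.baseChange ℝ)
      (LinearMap.BilinForm.baseChange ℝ BF) (i.baseChange ℝ) (p.baseChange ℝ) where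
  isotropic := by
    rintro _ ⟨x, rfl⟩ _ ⟨y, rfl⟩
    induction x using TensorProduct.induction_on with
    | zero => simp
    | add x x' hx hx' => simp only [map_add, LinearMap.add_apply, hx, hx', add_zero]
    | tmul a x =>
      induction y using TensorProduct.induction_on with
      | zero => simp
      | add y y' hy hy' => simp only [map_add, hy, hy', add_zero]
      | tmul b y => simp [h.isotropic x x.2 y y.2]
  adjoint_left w x := by
    induction x using TensorProduct.induction_on with
    | zero => simp
    | add x x' hx hx' => simp only [map_add, hx, hx']
    | tmul a x =>
      induction w using TensorProduct.induction_on with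
      | zero => simp
      | add y y' hy hy' => simp only [map_add, LinearMap.add_apply, hy, hy']
      | tmul b y => simp [h.adjoint_left]
  adjoint_right x w := by
    induction x using TensorProduct.induction_on with
    | zero => simp
    | add x x' hx hx' => simp only [map_add, LinearMap.add_apply, hx, hx']
    | tmul a x =>
      induction w using TensorProduct.induction_on with
      | zero => simp
      | add y y' hy hy' => simp only [map_add, hy, hy']
      | tmul b y => simp [h.adjoint_right]
  proj_eq_zero := by
    rintro _ ⟨x, rfl⟩
    induction x using TensorProduct.induction_on with
    | zero => simp
    | add x x' hx hx' => simp only [map_add, hx, hx', add_zero]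
    | tmul a x => simp [h.proj_eq_zero x x.2]
  proj_incl w := by
    induction w using TensorProduct.induction_on with
    | zero => simp
    | add x x' hx hx' => simp only [map_add, hx, hx']
    | tmul a x => simp [h.proj_incl]
  sub_mem := hsub

theorem IsLeviComplement.baseChange_lift {E F : Type*} [AddCommGroup E] [Module ℚ E]
    [AddCommGroup F] [Module ℚ F]
    {B : LinearMap.BilinForm ℚ E} {X : Submodule ℚ E} {BF : LinearMap.BilinForm ℚ F}
    {i : F →ₗ[ℚ] E} {p : E →ₗ[ℚ] F} (h : IsLeviComplement B X BF i p)
    (h' : IsLeviComplement (LinearMap.BilinForm.baseChange ℝ B) (X.baseChange ℝ)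
      (LinearMap.BilinForm.baseChange ℝ BF) (i.baseChange ℝ) (p.baseChange ℝ))
    (γ : F ≃ₗ[ℚ] F) :
    (h.lift γ).baseChange ℚ ℝ E E = h'.lift (γ.baseChange ℚ ℝ F F) := by
  refine LinearEquiv.ext fun x => ?_
  induction x using TensorProduct.induction_on with
  | zero => simp
  | add x x' hx hx' => rw [map_add, map_add, hx, hx']
  | tmul a x => simp [IsLeviComplement.lift_apply, TensorProduct.tmul_add, TensorProduct.tmul_sub]

/-! ### Unipotent elements of the parabolic subgroup -/

/-- The elements of a parabolic subgroup that are unipotent on the isotropic subspace (with square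
zero) and trivial on the Levi quotient are unipotent. -/
theorem IsLeviComplement.sub_one_pow_eq_zero {K E F : Type*} [Field K] [AddCommGroup E] [Module K E]
    [AddCommGroup F] [Module K F]
    {B : LinearMap.BilinForm K E} {X : Submodule K E} {BF : LinearMap.BilinForm K F}
    {i : F →ₗ[K] E} {p : E →ₗ[K] F} (h : IsLeviComplement B X BF i p) {A : E ≃ₗ[K] E}
    (hA : A ∈ bilinParabolic B X) (hX : ∀ x ∈ X, A (A x) - (2 : K) • A x + x = 0)
    (hF : ∀ w, p (A (i w)) = w) : ((A : Module.End K E) - 1) ^ 5 = 0 := by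
  -- The exponent 5 counts steps down the filtration `E ⊇ X^⊥ ⊇ X ⊇ 0`: two applications of `A - 1`
  -- reach `X^⊥` (the action modulo `X^⊥` is dual to that on `X`), one more reaches `X`, and two
  -- more reach 0.
  have h1 : ∀ x, ∀ u ∈ X, B u (((A : Module.End K E) - 1) (((A : Module.End K E) - 1) x)) = 0 := by
    intro x u hu
    have hsymm : ∀ u ∈ X, A.symm u ∈ X := fun u hu =>
      (hA.2 _).1 (by rwa [LinearEquiv.apply_symm_apply])
    obtain ⟨u, rfl⟩ := A.surjective u
    obtain ⟨u, rfl⟩ := A.surjective u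
    have hu' : u ∈ X := (hA.2 _).1 ((hA.2 _).1 hu)
    have e1 := hA.1 (A u) (A x)
    have e2 := hA.1 u x
    have e3 := hA.1 (A u) x
    have e4 := congrArg (fun z => B z x) (hX u hu')
    simp only [map_add, map_sub, map_smul, LinearMap.add_apply, LinearMap.sub_apply,
      LinearMap.smul_apply, smul_eq_mul, map_zero, LinearMap.zero_apply] at e4
    simp only [LinearMap.sub_apply, Module.End.one_apply, LinearEquiv.coe_coe, map_sub]
    linear_combination e1 + e2 - 2 * e3 + e4
  have h2 : ∀ x, (∀ u ∈ X, B u x = 0) → ((A : Module.End K E) - 1) x ∈ X := by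
    intro x hx
    have e1 := h.sub_mem x hx
    have e2 := h.map_sub_mem hA (p x)
    rw [hF] at e2
    have e3 := X.add_mem (X.sub_mem ((hA.2 _).2 e1) e1) e2
    convert e3 using 1
    simp only [LinearMap.sub_apply, Module.End.one_apply, LinearEquiv.coe_coe, map_sub]
    abel
  have h3 : ∀ x ∈ X, ((A : Module.End K E) - 1) (((A : Module.End K E) - 1) x) = 0 := by
    intro x hx
    rw [← hX x hx]
    simp only [LinearMap.sub_apply, Module.End.one_apply, LinearEquiv.coe_coe, map_sub]
    module
  refine LinearMap.ext fun x => ?_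
  simp only [pow_succ', pow_zero, mul_one, Module.End.mul_apply]
  exact h3 _ (h2 _ (h1 x))

namespace IsotropicDatum

variable {V : Type*} [AddCommGroup V] [Module ℚ V] (S : IsotropicDatum V)

theorem sub_mem_baseChange_U (x : ℝ ⊗[ℚ] V)
    (hx : ∀ u ∈ S.U.baseChange ℝ, LinearMap.BilinForm.baseChange ℝ S.form u x = 0) :
    x - (S.Wt.subtype ∘ₗ S.wtIso.symm.toLinearMap).baseChange ℝ
      ((S.wtIso.toLinearMap ∘ₗ S.prWt).baseChange ℝ x) ∈ S.U.baseChange ℝ := by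
  obtain ⟨n, b, c, hb, hc, hbc, hU, hUt⟩ := S.exists_dualBasis_rat
  -- Expanding the `Ũ`-component in the dual bases gives a formula linear in `x`, which extends to
  -- real scalars; orthogonality to `U_ℝ` then kills each coefficient.
  have h1 : ∀ x : ℝ ⊗[ℚ] V, x - (S.Wt.subtype ∘ₗ S.wtIso.symm.toLinearMap).baseChange ℝ
      ((S.wtIso.toLinearMap ∘ₗ S.prWt).baseChange ℝ x) = S.U.subtype.baseChange ℝ
        (S.prU.baseChange ℝ x) +
      ∑ i, LinearMap.BilinForm.baseChange ℝ S.form (1 ⊗ₜ (b i : V)) x • (1 : ℝ) ⊗ₜ[ℚ] c i := by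
    intro x
    induction x using TensorProduct.induction_on with
    | zero => simp
    | add x x' hx hx' =>
      simp only [map_add, add_smul, Finset.sum_add_distrib]
      rw [add_sub_add_comm, hx, hx']
      abel
    | tmul a x =>
      have e : (x : V) - S.prWt x = S.prU x + ∑ i, S.form (b i) x • c i := by
        have e1 := S.pr_add x
        have e2 := hUt _ (S.prUt x).2
        have e3 : ∀ i, S.form (b i) (S.prUt x) = S.form (b i) x := fun i => by
          rw [S.form_comm, form_prUt, S.form_comm]
        simp only [e3] at e2
        rw [← e2, sub_eq_iff_eq_add]
        conv_lhs => rw [← e1]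
        abel
      have e' := congrArg (fun v => a ⊗ₜ[ℚ] v) e
      simp only [TensorProduct.tmul_sub, TensorProduct.tmul_add, TensorProduct.tmul_sum] at e'
      simp only [LinearMap.baseChange_tmul, LinearMap.comp_apply, LinearEquiv.coe_coe,
        LinearEquiv.symm_apply_apply, Submodule.subtype_apply]
      rw [e']
      congr 1
      refine Finset.sum_congr rfl fun i _ => ?_
      rw [LinearMap.BilinForm.baseChange_tmul, TensorProduct.smul_tmul', TensorProduct.tmul_smul,
        TensorProduct.smul_tmul']
      simp [mul_comm]
  rw [h1, Finset.sum_eq_zero, add_zero]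
  · exact ⟨_, rfl⟩
  · intro i _
    rw [hx _ (Submodule.tmul_mem_baseChange_of_mem _ (b i).2), zero_smul]

theorem isLeviComplement_real [FiniteDimensional ℚ V] :
    IsLeviComplement (LinearMap.BilinForm.baseChange ℝ S.form) (S.U.baseChange ℝ)
      (LinearMap.BilinForm.baseChange ℝ S.formW)
      ((S.Wt.subtype ∘ₗ S.wtIso.symm.toLinearMap).baseChange ℝ)
      ((S.wtIso.toLinearMap ∘ₗ S.prWt).baseChange ℝ) :=
  S.isLeviComplement.baseChange S.sub_mem_baseChange_U

/-! ### The identity component of the real parabolic subgroup -/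

theorem elt_quot [FiniteDimensional ℚ V] (M : S.U ≃ₗ[ℚ] S.U) (γ : bilinOrthogonalGroup S.formW)
    (ψ : S.W →ₗ[ℚ] S.U)
    (η : homAs S.U) (w : S.W) :
    S.wtIso (S.prWt (S.elt M γ ψ η (S.wtIso.symm w))) = (γ : S.W ≃ₗ[ℚ] S.W) w := by
  have h := S.elt_decomp M γ ψ η 0 (S.wtIso.symm w) 0
  simp only [ZeroMemClass.coe_zero, add_zero, zero_add] at h
  rw [h, prWt_eq]
  simp [gammaTilde]

theorem quot_mem_identityComponent [FiniteDimensional ℚ V] {A : V ≃ₗ[ℚ] V}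
    (hA : A ∈ S.parabolicZero) {γ : S.W ≃ₗ[ℚ] S.W}
    (hγ : ∀ w, S.wtIso (S.prWt (A (S.wtIso.symm w))) = γ w) :
    γ.baseChange ℚ ℝ S.W S.W ∈
      identityComponent (bilinOrthogonalGroup (LinearMap.BilinForm.baseChange ℝ S.formW)) := by
  have h := S.isLeviComplement_real
  have hA' := baseChange_mem_bilinParabolic hA.1
  have key := h.quot_mem_identityComponent (A := ⟨_, hA'⟩) hA.2
  have e : h.quot ⟨_, hA'⟩ = γ.baseChange ℚ ℝ S.W S.W := by
    refine LinearEquiv.ext fun w => ?_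
    rw [h.quot_apply]
    induction w using TensorProduct.induction_on with
    | zero => simp
    | add x x' hx hx' => simp only [map_add, hx, hx']
    | tmul a x => simp [hγ]
  rwa [e] at key

theorem lift_mem_parabolicZero [FiniteDimensional ℚ V] {γ : S.W ≃ₗ[ℚ] S.W}
    (hγ : γ ∈ bilinOrthogonalGroup S.formW)
    (hγ' : γ.baseChange ℚ ℝ S.W S.W ∈
      identityComponent (bilinOrthogonalGroup (LinearMap.BilinForm.baseChange ℝ S.formW))) :
    S.isLeviComplement.lift γ ∈ S.parabolicZero := by
  have h := S.isLeviComplement_real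
  refine ⟨S.isLeviComplement.lift_mem hγ, ?_⟩
  rw [S.isLeviComplement.baseChange_lift h]
  exact h.lift_mem_identityComponent hγ'

theorem mem_parabolicZero_of_unipotent {A : V ≃ₗ[ℚ] V} (hA : A ∈ S.parabolic)
    (hU : ∀ x ∈ S.U, A (A x) - (2 : ℚ) • A x + x = 0)
    (hW : ∀ w, S.wtIso (S.prWt (A (S.wtIso.symm w))) = w) : A ∈ S.parabolicZero := by
  have h := S.isLeviComplement.sub_one_pow_eq_zero hA hU hW
  refine ⟨hA, mem_identityComponent_of_unipotent (baseChange_mem_bilinParabolic hA) (n := 5) ?_⟩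
  have h' := congrArg (LinearMap.baseChange ℝ) h
  rw [LinearMap.baseChange_pow, LinearMap.baseChange_sub, LinearMap.baseChange_one,
    LinearMap.baseChange_zero] at h'
  exact h'

theorem mul_mem_parabolicZero {A A' : V ≃ₗ[ℚ] V} (hA : A ∈ S.parabolicZero)
    (hA' : A' ∈ S.parabolicZero) : A * A' ∈ S.parabolicZero := by
  refine ⟨mul_mem hA.1 hA'.1, ?_⟩
  rw [LinearEquiv.baseChange_mul]
  exact mul_mem_identityComponent hA.2 hA'.2

theorem exists_mem_parabolicZero [FiniteDimensional ℚ V] (M : S.U ≃ₗ[ℚ] S.U)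
    (hM : LinearMap.det (M : S.U →ₗ[ℚ] S.U) = 1) :
    ∃ A ∈ S.parabolicZero, (∀ u : S.U, A u = M u) ∧
      ∀ w, S.wtIso (S.prWt (A (S.wtIso.symm w))) = w := by
  refine LinearEquiv.induction_of_det_eq_one (P := fun M => ∃ A ∈ S.parabolicZero,
    (∀ u : S.U, A u = M u) ∧ ∀ w, S.wtIso (S.prWt (A (S.wtIso.symm w))) = w) ?_ ?_ ?_ M hM
  · refine ⟨1, ⟨one_mem _, ?_⟩, fun _ => rfl, fun w => S.isLeviComplement.proj_incl w⟩
    rw [LinearEquiv.baseChange_one]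
    exact one_mem_identityComponent _
  · rintro M M' ⟨A, hA, hAM, hAw⟩ ⟨A', hA', hAM', hAw'⟩
    refine ⟨A * A', S.mul_mem_parabolicZero hA hA', fun u => ?_, fun w => ?_⟩
    · rw [LinearEquiv.mul_apply, hAM', hAM]
      rfl
    · have := S.isLeviComplement.map_mul hA.1 hA'.1 w
      simp only [LinearMap.comp_apply, LinearEquiv.coe_coe, Submodule.subtype_apply] at this
      rw [LinearEquiv.mul_apply, this, hAw, hAw']
  · intro T hT
    -- A unipotent `T` is lifted by the coordinates `(T, 1, 0, 0)`; the lift is itself unipotent.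
    have hM : ∀ u : S.U, S.elt T 1 0 0 u = T u := fun u => (S.elt_apply T 1 0 0 u 0 0).1
    refine ⟨S.elt T 1 0 0, S.mem_parabolicZero_of_unipotent (S.elt_mem_parabolic _ _ _ _)
      (fun x hx => ?_) (fun w => S.elt_quot T 1 0 0 w), hM, fun w => S.elt_quot T 1 0 0 w⟩
    have e := congrArg Subtype.val (hT ⟨x, hx⟩)
    rw [hM ⟨x, hx⟩, hM]
    exact e

theorem mem_parabolicZero [FiniteDimensional ℚ V] {A : V ≃ₗ[ℚ] V} (hA : A ∈ S.parabolic)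
    {M : S.U ≃ₗ[ℚ] S.U}
    (hM : LinearMap.det (M : S.U →ₗ[ℚ] S.U) = 1) (hAM : ∀ u : S.U, A u = M u)
    {γ : S.W ≃ₗ[ℚ] S.W} (hγ : γ ∈ bilinOrthogonalGroup S.formW)
    (hγ' : γ.baseChange ℚ ℝ S.W S.W ∈
      identityComponent (bilinOrthogonalGroup (LinearMap.BilinForm.baseChange ℝ S.formW)))
    (hAγ : ∀ w, S.wtIso (S.prWt (A (S.wtIso.symm w))) = γ w) : A ∈ S.parabolicZero := by
  obtain ⟨A₁, hA₁, hM₁, hγ₁⟩ := S.exists_mem_parabolicZero M hM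
  have hA₂ := S.lift_mem_parabolicZero hγ hγ'
  -- `Y` lies in `P_U^0` and has the same `M` and `γ` as `A`, so `Y⁻¹ * A` is trivial on `U` and on
  -- `W`, hence unipotent.
  let Y := A₁ * S.isLeviComplement.lift γ
  have hY : Y ∈ S.parabolicZero := S.mul_mem_parabolicZero hA₁ hA₂
  have hYM : ∀ u : S.U, Y u = M u := fun u => by
    change A₁ (S.isLeviComplement.lift γ u) = M u
    rw [S.isLeviComplement.lift_apply_of_mem γ u.2, hM₁]
  have hYγ : ∀ w, S.wtIso (S.prWt (Y (S.wtIso.symm w))) = γ w := fun w => by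
    have h1 := S.isLeviComplement.map_mul hA₁.1 hA₂.1 w
    have h2 := S.isLeviComplement.proj_lift_incl γ w
    simp only [LinearMap.comp_apply, LinearEquiv.coe_coe, Submodule.subtype_apply] at h1 h2
    change S.wtIso (S.prWt (A₁ (S.isLeviComplement.lift γ (S.wtIso.symm w)))) = γ w
    rw [h1, h2, hγ₁]
  have hYA : Y⁻¹ * A ∈ S.parabolicZero := by
    have hpar : Y⁻¹ * A ∈ S.parabolic := mul_mem (inv_mem hY.1) hA
    have hone : ∀ x ∈ S.U, (Y⁻¹ * A) x = x := fun x hx => by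
      change Y.symm (A x) = x
      rw [LinearEquiv.symm_apply_eq, hYM ⟨x, hx⟩, hAM ⟨x, hx⟩]
    refine S.mem_parabolicZero_of_unipotent hpar (fun x hx => ?_) fun w => ?_
    · rw [hone x hx, hone x hx]
      module
    · refine γ.injective ?_
      have h1 := S.isLeviComplement.map_mul hY.1 hpar w
      simp only [LinearMap.comp_apply, LinearEquiv.coe_coe, Submodule.subtype_apply] at h1
      rw [← hYγ, ← h1, ← LinearEquiv.mul_apply, mul_inv_cancel_left, hAγ]
  have := S.mul_mem_parabolicZero hY hYA
  rwa [mul_inv_cancel_left] at this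

theorem det_pos_of_mem_parabolicZero [FiniteDimensional ℚ V] {A : V ≃ₗ[ℚ] V}
    (hA : A ∈ S.parabolicZero)
    {M : S.U ≃ₗ[ℚ] S.U} (hAM : ∀ u : S.U, A u = M u) :
    0 < LinearMap.det (M : S.U →ₗ[ℚ] S.U) := by
  let j := S.U.subtype.baseChange ℝ
  let q := S.prU.baseChange ℝ
  have hqj : ∀ x, q (j x) = x := by
    intro x
    induction x using TensorProduct.induction_on with
    | zero => simp
    | add x x' hx hx' => simp only [map_add, hx, hx']
    | tmul a x =>
      have := S.prU_eq x 0 0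
      simp only [ZeroMemClass.coe_zero, add_zero] at this
      simp [q, j, this]
  have hjq : ∀ x ∈ S.U.baseChange ℝ, j (q x) = x := by
    rintro _ ⟨x, rfl⟩
    exact congrArg j (hqj x)
  -- Compression to `U_ℝ`. On elements preserving `U_ℝ` it is restriction, hence invertible with
  -- nonzero determinant.
  let T : (ℝ ⊗[ℚ] V →ₗ[ℝ] ℝ ⊗[ℚ] V) →ₗ[ℝ] ℝ ⊗[ℚ] S.U →ₗ[ℝ] ℝ ⊗[ℚ] S.U :=
    (LinearMap.llcomp ℝ _ _ _ q) ∘ₗ (LinearMap.lcomp ℝ _ j)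
  have hT : ∀ f x, T f x = q (f (j x)) := fun _ _ => rfl
  have hpos := det_pos_of_mem_identityComponent T (LinearMap.ext hqj) (fun A hA => by
    have h1 : T A ∘ₗ T (A⁻¹ : ℝ ⊗[ℚ] V ≃ₗ[ℝ] ℝ ⊗[ℚ] V) = LinearMap.id := LinearMap.ext fun x => by
      rw [LinearMap.comp_apply, hT, hT, hjq]
      · have : A (A⁻¹ (j x)) = j x := A.apply_symm_apply _
        exact (congrArg q this).trans (hqj x)
      · exact ((inv_mem hA).2 _).2 ⟨x, rfl⟩
    have h2 := congrArg LinearMap.det h1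
    rw [LinearMap.det_comp, LinearMap.det_id] at h2
    exact left_ne_zero_of_mul_eq_one h2) hA.2
  have hTM : T (A.baseChange ℚ ℝ V V) = LinearMap.baseChange ℝ (M : S.U →ₗ[ℚ] S.U) := by
    refine LinearMap.ext fun x => ?_
    rw [hT]
    induction x using TensorProduct.induction_on with
    | zero => simp
    | add x x' hx hx' => simp only [map_add, hx, hx']
    | tmul a x =>
      have := S.prU_eq (M x) 0 0
      simp only [ZeroMemClass.coe_zero, add_zero] at this
      simp [q, j, hAM, this]
  rw [hTM, LinearMap.det_baseChange] at hpos
  simpa using hpos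

/-- `M` and its inverse both have integral matrices in a basis of `I`, so the determinant is `±1`.
-/
theorem det_eq_one_of_pos {M : S.U ≃ₗ[ℚ] S.U} (hM : ∀ u, M u ∈ S.I ↔ u ∈ S.I)
    (hpos : 0 < LinearMap.det (M : S.U →ₗ[ℚ] S.U)) :
    LinearMap.det (M : S.U →ₗ[ℚ] S.U) = 1 := by
  obtain ⟨n, b, c, hb, hc, hbc, hU, hUt⟩ := S.exists_dualBasis_rat
  have hint : ∀ f : S.U →ₗ[ℚ] S.U, (∀ u ∈ S.I, f u ∈ S.I) → ∃ m : ℤ, LinearMap.det f = m := by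
    intro f hf
    have hli : LinearIndependent ℚ b := by
      rw [Fintype.linearIndependent_iff]
      intro g hg i
      have := congrArg (fun u : S.U => S.form u (c i)) hg
      simpa [LinearMap.sum_apply, hbc] using this
    let e := Module.Basis.mk hli (fun u _ => by
      rw [hU u]
      exact sum_mem fun i _ => Submodule.smul_mem _ _ (Submodule.subset_span ⟨i, rfl⟩))
    have he : ∀ i, e i = b i := fun i => Module.Basis.mk_apply _ _ i
    have hrepr : ∀ u i, e.repr u i = S.form u (c i) := by
      intro u i
      have h1 : u = ∑ i, S.form u (c i) • e i := by
        simp only [he]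
        exact hU u
      conv_lhs => rw [h1]
      rw [map_sum, Finsupp.finsetSum_apply]
      simp_rw [map_smul, Module.Basis.repr_self]
      simp [Finsupp.single_apply]
    have hent : ∀ i j, ∃ m : ℤ, LinearMap.toMatrix e e f i j = m := by
      intro i j
      rw [LinearMap.toMatrix_apply, hrepr]
      refine S.form_integral_of_mem_I (hf _ ?_) (hc i)
      rw [he]
      exact hb j
    choose m hm using hent
    refine ⟨(Matrix.of m).det, ?_⟩
    have h2 : LinearMap.toMatrix e e f = (Matrix.of m).map (Int.castRingHom ℚ) := by
      ext i j
      exact hm i j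
    rw [← LinearMap.det_toMatrix e, h2, ← RingHom.mapMatrix_apply, ← RingHom.map_det]
    rfl
  obtain ⟨m, hm⟩ := hint M fun u hu => (hM u).2 hu
  obtain ⟨m', hm'⟩ := hint M.symm fun u hu => (hM _).1 (by
    rw [LinearEquiv.coe_coe, LinearEquiv.apply_symm_apply]
    exact hu)
  have h1 : LinearMap.det (M : S.U →ₗ[ℚ] S.U) * LinearMap.det (M.symm : S.U →ₗ[ℚ] S.U) = 1 := by
    rw [← LinearMap.det_comp, LinearEquiv.comp_symm, LinearMap.det_id]
  rw [hm] at hpos h1 ⊢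
  rw [hm'] at h1
  have h2 : m * m' = 1 := by exact_mod_cast h1
  have h3 : 0 < m := by exact_mod_cast hpos
  rcases Int.eq_one_or_neg_one_of_mul_eq_one h2 with h4 | h4
  · rw [h4, Int.cast_one]
  · omega

/-- The elements of `Γ_{L,I}` in coordinates. -/
theorem elt_mem_GammaLI_iff [FiniteDimensional ℚ V] (M : S.U ≃ₗ[ℚ] S.U)
    (γ : bilinOrthogonalGroup S.formW)
    (ψ : S.W →ₗ[ℚ] S.U) (η : homAs S.U) :
    S.elt M γ ψ η ∈ S.GammaLI ↔ (γ : S.W ≃ₗ[ℚ] S.W) ∈ S.GammaLam ∧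
      ∃ hM : M ∈ S.SLI, S.CondPsi M hM ψ ∧ S.CondEta M ψ η := by
  have hAM : ∀ u : S.U, S.elt M γ ψ η u = M u := fun u => (S.elt_apply M γ ψ η u 0 0).1
  have hAγ := S.elt_quot M γ ψ η
  have hpar := S.elt_mem_parabolic M γ ψ η
  constructor
  · rintro ⟨h0, -, -, hL, -⟩
    obtain ⟨h1, ⟨h2, h3⟩, h4, h5⟩ := (S.elt_sub_mem_L_iff M γ ψ η).1 hL
    have hM : M ∈ S.SLI :=
      ⟨h2, S.det_eq_one_of_pos h2 (S.det_pos_of_mem_parabolicZero h0 hAM), h3⟩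
    exact ⟨⟨γ.2, mem_iff_of_forall_sub_mem S.formW_nondeg S.formW_isSymm S.Lam_fg S.span_Lam
      S.Lam_le_LamDual γ.2 h1, h1, S.quot_mem_identityComponent h0 hAγ⟩, hM,
      (S.condPsi_iff M hM ψ).2 h4, (S.condEta_iff M ψ η).2 h5⟩
  · rintro ⟨⟨-, -, h1, hγ⟩, hM, h4, h5⟩
    have hL := (S.elt_sub_mem_L_iff M γ ψ η).2 ⟨h1, ⟨hM.1, hM.2.2⟩,
      (S.condPsi_iff M hM ψ).1 h4, (S.condEta_iff M ψ η).1 h5⟩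
    have h0 := S.mem_parabolicZero hpar hM.2.1 hAM γ.2 hγ hAγ
    exact ⟨h0, hpar.1, mem_iff_of_forall_sub_mem S.nondeg S.symm S.fg S.span_eq_top
      -- Membership in `SO⁺(V_ℝ)` is free: the identity component of the real parabolic subgroup
      -- lies in that of the orthogonal group.
      S.L_le_Ldual hpar.1 hL, hL, identityComponent_mono (bilinParabolic_le _ _) h0.2⟩

end IsotropicDatum

end

theorem proposition3p2 {V : Type*} [AddCommGroup V] [Module ℚ V] [FiniteDimensional ℚ V]
    (S : IsotropicDatum V) :
    -- the coordinates: quadruples `(M, γ, ψ, η)` correspond bijectively to elements of `P_U`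
    Set.BijOn
      (fun p : (S.U ≃ₗ[ℚ] S.U) × bilinOrthogonalGroup S.formW × (S.W →ₗ[ℚ] S.U) × homAs S.U =>
        S.elt p.1 p.2.1 p.2.2.1 p.2.2.2) Set.univ (S.parabolic : Set (V ≃ₗ[ℚ] V)) ∧
    -- the characterization of `Γ_{L,I}`
    (∀ (M : S.U ≃ₗ[ℚ] S.U) (γ : bilinOrthogonalGroup S.formW) (ψ : S.W →ₗ[ℚ] S.U)
        (η : homAs S.U),
      S.elt M γ ψ η ∈ S.GammaLI ↔
        (γ : S.W ≃ₗ[ℚ] S.W) ∈ S.GammaLam ∧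
        ∃ hM : M ∈ S.SLI, S.CondPsi M hM ψ ∧ S.CondEta M ψ η) ∧
    -- every `γ ∈ Γ_Λ` and `M ∈ SL(I_{L*}, I)` occur together
    (∀ γ : bilinOrthogonalGroup S.formW, (γ : S.W ≃ₗ[ℚ] S.W) ∈ S.GammaLam → ∀ M ∈ S.SLI,
      ∃ (ψ : S.W →ₗ[ℚ] S.U) (η : homAs S.U), S.elt M γ ψ η ∈ S.GammaLI) ∧
    -- every `M ∈ SL(I_{L*}, I)` admits `ψ`
    (∀ (M : S.U ≃ₗ[ℚ] S.U) (hM : M ∈ S.SLI), ∃ ψ : S.W →ₗ[ℚ] S.U, S.CondPsi M hM ψ) ∧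
    -- every such pair `(M, ψ)` admits `η`, unique up to `Hom^{as}(I*, I)`
    (∀ (M : S.U ≃ₗ[ℚ] S.U) (hM : M ∈ S.SLI) (ψ : S.W →ₗ[ℚ] S.U), S.CondPsi M hM ψ →
      ∃ η : homAs S.U, S.CondEta M ψ η ∧
        ∀ η' : homAs S.U, S.CondEta M ψ η' ↔
          ((η' : Module.Dual ℚ S.U →ₗ[ℚ] S.U) - η) ∈ homAsDual S.I) := by
  refine ⟨S.bijOn_elt, S.elt_mem_GammaLI_iff, ?_, S.exists_condPsi, ?_⟩
  · intro γ hγ M hM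
    obtain ⟨ψ, hψ⟩ := S.exists_condPsi M hM
    obtain ⟨η, hη⟩ := S.exists_condEta M hM ψ hψ
    exact ⟨ψ, η, (S.elt_mem_GammaLI_iff M γ ψ η).2 ⟨hγ, hM, hψ, hη⟩⟩
  · intro M hM ψ hψ
    obtain ⟨η, hη⟩ := S.exists_condEta M hM ψ hψ
    exact ⟨η, hη, S.condEta_iff_sub_mem hη⟩
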